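/- Consider the class of equations $$u_t+k(t)\,u\,u_x+f(t)\,u^2u_x+u_{xxx}=0,$$ where $u$ is a real function of $(t,x)$ and the arbitrary elements $k,f$ are smooth real functions on an open interval $I$, with $f(t)\neq0$ for all $t\in I$. A nondegenerate point transformation $(t,x,u)\mapsto(\tilde t,\tilde x,\tilde u)$, defined on an open set, carries one equation of the class to another if its prolongation to third-order jets matches the two equations as hypersurfaces in jet space. A transformation of the *usual equivalence group* is a nondegenerate point transformation of $(t,x,u,k,f)$, on an open set where $f\ne0$, whose components $\tilde t,\tilde x,\tilde u$ do not involve $k,f$, and which sends every equation of the class to the equation of the class with arbitrary elements $(\tilde k,\tilde f)$; its domain is assumed to have connected projection to $(t,x,u)$-space. A transformation of the *generalized extended equivalence group* is a smooth family of this kind in which all components may depend also on the arbitrary elements, finitely many of their derivatives and finitely many of their repeated antiderivatives, and which, for all arbitrary elements $k,f$ and all choices of their antiderivatives, becomes a nondegenerate point transformation of $(t,x,u)$ that sends the equation with $(k,f)$ to the equation of the class with $(\tilde k,\tilde f)$; its domain, in the space of all these coordinates, is assumed open and connected, with $f\neq0$ on it. **Theorem.** (i) The generalized extended equivalence group of the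 class comprises exactly the transformations $$\tilde t=\delta_1^{3}t+\delta_0,\qquad \tilde x=\delta_1x+\frac{\delta_1\delta_3}{\delta_2^{2}}\int(\delta_2k(t)-\delta_3f(t))\,dt+\delta_4,\qquad \tilde u=\delta_2u+\delta_3,$$ $$\tilde k(\tilde t)=\frac{\delta_2k(t)-2\delta_3f(t)}{\delta_1^{2}\delta_2^{2}},\qquad \tilde f(\tilde t)=\frac{f(t)}{\delta_1^{2}\delta_2^{2}},$$ where $\delta_0,\dots,\delta_4$ are arbitrary real constants with $\delta_1\delta_2\neq0$. Here $\int k\,dt$ and $\int f\,dt$ are the antiderivatives on which the transformation may depend. (ii) No other kind of dependence on the arbitrary elements gives further transformations: for fixed equations of the class with arbitrary elements $(k,f)$ and $(\tilde k,\tilde f)$, the point transformations on a connected open set that carry the first to the second are exactly those given by the formulas in (i) for some constants $\delta_0,\dots,\delta_4$, $\delta_1\delta_2\ne0$, with the relations for $\tilde k,\tilde f$ holding for all $t$ that occur in the set. (iii) The usual equivalence group of the class consists exactly of the transformations in (i) with $\delta_3=0$. -/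

import Mathlib

open Set Filter Topology
open scoped ContDiff

namespace Gardner

/-- The space of the variables `(t, x, u)`. -/
abbrev Base : Type := ℝ × ℝ × ℝ

/-- The left-hand side `u_t + k(t) u u_x + f(t) u² u_x + u_xxx` at the point `(t, x)`. -/
noncomputable def lhs (k f : ℝ → ℝ) (u : ℝ → ℝ → ℝ) (t x : ℝ) : ℝ :=
  deriv (fun s => u s x) t + k t * u t x * deriv (fun y => u t y) x
    + f t * u t x ^ 2 * deriv (fun y => u t y) x + iteratedDeriv 3 (fun y => u t y) x

/-- `(k, f)`, given on the open interval `I`, is an admissible value of the arbitrary elements of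
the class: `k` and `f` are smooth on `I`, and `f` does not vanish there. -/
structure IsArbitraryElement (I : Set ℝ) (k f : ℝ → ℝ) : Prop where
  isOpen : IsOpen I
  ordConnected : I.OrdConnected
  nonempty : I.Nonempty
  smooth_k : ContDiffOn ℝ ∞ k I
  smooth_f : ContDiffOn ℝ ∞ f I
  f_ne_zero : ∀ t ∈ I, f t ≠ 0

/-- The point transformation `φ = (T, X, U)`, on the set `Ω` of points `(t, x, u)`, carries the
equation with coefficients `(k, f)` to the equation with coefficients `(k', f')`: its prolongation
to third-order jets matches the two equations, as hypersurfaces of the jet space.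

Jets are represented by smooth functions `u` near a point `(t, x)`; the image of the jet of `u` is
the jet, at the image point, of a smooth function `v` whose graph contains the image under `φ` of
the graph of `u` near that point (such a `v` exists precisely when `φ` carries the graph of `u`, near
the point considered, to the graph of a smooth function). -/
def CarriesEquation (Ω : Set Base) (φ : Base → Base) (k f k' f' : ℝ → ℝ) : Prop :=
  ∀ (u v : ℝ → ℝ → ℝ) (t x : ℝ), (t, x, u t x) ∈ Ω →
    ContDiffAt ℝ ∞ (fun q : ℝ × ℝ => u q.1 q.2) (t, x) →
    ContDiffAt ℝ ∞ (fun q : ℝ × ℝ => v q.1 q.2)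
      ((φ (t, x, u t x)).1, (φ (t, x, u t x)).2.1) →
    (∀ᶠ q : ℝ × ℝ in 𝓝 (t, x),
      v (φ (q.1, q.2, u q.1 q.2)).1 (φ (q.1, q.2, u q.1 q.2)).2.1
        = (φ (q.1, q.2, u q.1 q.2)).2.2) →
    (lhs k f u t x = 0 ↔ lhs k' f' v (φ (t, x, u t x)).1 (φ (t, x, u t x)).2.1 = 0)

/-- `φ` is a nondegenerate point transformation of the variables `(t, x, u)` on the open set `Ω`. -/
def IsPointTransformation (Ω : Set Base) (φ : Base → Base) : Prop :=
  ContDiffOn ℝ ∞ φ Ω ∧ ∀ z ∈ Ω, (fderiv ℝ φ z).det ≠ 0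

/-- The point transformation `φ` links, over `Ω`, the equation `(k, f)` of the class to the equation
`(k', f')` of the class. -/
structure IsAdmissible (Ω : Set Base) (φ : Base → Base)
    (I : Set ℝ) (k f : ℝ → ℝ) (I' : Set ℝ) (k' f' : ℝ → ℝ) : Prop where
  source : IsArbitraryElement I k f
  target : IsArbitraryElement I' k' f'
  source_mem : ∀ z ∈ Ω, z.1 ∈ I
  target_mem : ∀ z ∈ Ω, (φ z).1 ∈ I'
  nondegenerate : IsPointTransformation Ω φ
  carries : CarriesEquation Ω φ k f k' f'

/-- The space with the coordinates `((t, x, u), (k, f))`. -/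
abbrev UsualSpace : Type := Base × ℝ × ℝ

/-- The points `(t, x, u)` that occur in a set of points `((t, x, u), (k, f))`. -/
def baseSet (D : Set UsualSpace) : Set Base := Prod.fst '' D

/-- A transformation of the usual equivalence group, on the open set `D`: a nondegenerate point
transformation of `(t, x, u, k, f)` whose components `Φ` for `(t, x, u)` do not involve `(k, f)`,
and which sends every equation of the class to an equation of the class.  `Ψ` gives the new arbitrary
elements `(k', f')`. -/
structure IsUsualEquivalence (D : Set UsualSpace) (Φ : Base → Base) (Ψ : UsualSpace → ℝ × ℝ) :
    Prop where
  smooth_base : ContDiffOn ℝ ∞ Φ (baseSet D)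
  smooth_elements : ContDiffOn ℝ ∞ Ψ D
  nondegenerate : ∀ e ∈ D,
    (fderiv ℝ (fun e' : UsualSpace => ((Φ e'.1, Ψ e') : UsualSpace)) e).det ≠ 0
  maps : ∀ (I : Set ℝ) (k f : ℝ → ℝ), IsArbitraryElement I k f →
    ∃ (I' : Set ℝ) (k' f' : ℝ → ℝ),
      IsAdmissible {z | z.1 ∈ I ∧ (z, k z.1, f z.1) ∈ D} Φ I k f I' k' f' ∧
      ∀ z : Base, z.1 ∈ I → (z, k z.1, f z.1) ∈ D →
        Ψ (z, k z.1, f z.1) = (k' (Φ z).1, f' (Φ z).1)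

/-- The space with the coordinates `((t, x, u), (κ, λ))`, where `κ` stands for the `p + 1` times
repeated, …, twice repeated, simple antiderivative of `k` (index `p`), then `k` itself
(index `p + 1`), then the derivatives of `k` up to order `r`; likewise `λ` for `f`. -/
abbrev ExtendedSpace (p r : ℕ) : Type :=
  Base × (Fin (p + r + 2) → ℝ) × (Fin (p + r + 2) → ℝ)

/-- The index of the simple antiderivative of an arbitrary element. -/
def integralIdx (p r : ℕ) : Fin (p + r + 2) := ⟨p, by omega⟩

/-- The index of the arbitrary element itself. -/
def elementIdx (p r : ℕ) : Fin (p + r + 2) := ⟨p + 1, by omega⟩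

/-- The point of the extended space over `z = (t, x, u)` given by functions `K`, `F` whose
derivatives of order `p + 1` are the arbitrary elements. -/
noncomputable def lift (p r : ℕ) (K F : ℝ → ℝ) (z : Base) : ExtendedSpace p r :=
  (z, fun i => iteratedDeriv i K z.1, fun i => iteratedDeriv i F z.1)

/-- A transformation of the generalized extended equivalence group, on the open set `D`: its
components `Φ` for `(t, x, u)` and `Ψ` for the new arbitrary elements `(k', f')` may depend on
`(t, x, u)`, on the arbitrary elements, on their derivatives up to order `r`, and on their repeated
antiderivatives up to multiplicity `p + 1`, and for all arbitrary elements (and all choices of their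
antiderivatives) `Φ` becomes a nondegenerate point transformation of `(t, x, u)` that sends the
equation `(k, f)` to the equation of the class with the arbitrary elements `(k', f')`. -/
structure IsGeneralizedExtendedEquivalence (p r : ℕ) (D : Set (ExtendedSpace p r))
    (Φ : ExtendedSpace p r → Base) (Ψ : ExtendedSpace p r → ℝ × ℝ) : Prop where
  smooth_base : ContDiffOn ℝ ∞ Φ D
  smooth_elements : ContDiffOn ℝ ∞ Ψ D
  maps : ∀ (I : Set ℝ) (k f K F : ℝ → ℝ), IsArbitraryElement I k f →
    ContDiffOn ℝ ∞ K I → ContDiffOn ℝ ∞ F I →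
    (∀ t ∈ I, iteratedDeriv (p + 1) K t = k t) → (∀ t ∈ I, iteratedDeriv (p + 1) F t = f t) →
    ∃ (I' : Set ℝ) (k' f' : ℝ → ℝ),
      IsAdmissible {z | z.1 ∈ I ∧ lift p r K F z ∈ D} (fun z => Φ (lift p r K F z))
        I k f I' k' f' ∧
      ∀ z : Base, z.1 ∈ I → lift p r K F z ∈ D →
        Ψ (lift p r K F z) = (k' (Φ (lift p r K F z)).1, f' (Φ (lift p r K F z)).1)

end Gardner

/-! Everything rests on a single pair of equations: `IsAdmissible.exists_form` finds all point
transformations `(T, X, U)` between them. At any point of `Ω` one may insert polynomial germs with a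
prescribed jet on the source equation. Add to such a germ a perturbation `w` that vanishes at the
point and preserves the source equation there. To leading order the image changes by a nonzero
multiple of `w`. So, in the new coordinates, `w_t' + w_x'x'x' = 0` at the point whenever `w_x' =
w_x'x' = 0` (`lhs_perturbation_eq_zero`). The choice `w = (t - t₀)³` forces `T_x = T_u = 0`; the
choice `w = (t - t₀) - (x - x₀)³ / 6` forces `X_u = 0` and `X_x³ = T_t`.

After that the target equation is an identity polynomial in the free jets `u_x`, `u_xx`
(`determining_identity`). Its `u_xx` part gives `U_uu = U_xu = 0`, and its `u_x` part expresses
`X_t` through the nonlinear coefficients. What remains is quadratic in `u` with leading coefficient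
`f U_x`, so `f ≠ 0` gives `U_x = 0` and then `U_t = 0`. Now `X_t` does not vary with `x`, hence
`X_x` is constant, and comparing powers of `u` yields `k'`, `f'` and `X_t`. Conversely, under the
stated transformations the two left-hand sides are proportional with factor `δ₁³ / δ₂`
(`isAdmissible_of_form`).

For the generalized extended group, every point of the extended space is the lift of functions `K`,
`F` whose next derivatives are arbitrary. Along each lift the previous result applies, with
constants that might depend on `K` and `F`. But a function locally constant along all lifts is
killed by all total derivatives, hence by their differences, which point along the highest
derivatives, and then by commutators, which descend to every lower coordinate. Such a function is
constant (`exists_const_of_lifts`), so the parameters are global. For the usual group constant `k`,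
`f` suffice: `X_t` contains the term `δ₁ δ₃ k / δ₂`, while `Φ` does not involve `k`, so `δ₃ = 0`. -/

namespace Gardner

/-! ### Directional derivatives, and third derivatives along curves. -/

section Directional

variable {E : Type*} [NormedAddCommGroup E] [NormedSpace ℝ E]

theorem natCast_le_infty (n : ℕ) : (n : WithTop ℕ∞) ≤ ∞ := by exact_mod_cast le_top

/-- The derivative of `g` in the direction `v`. -/
noncomputable def dir (v : E) (g : E → ℝ) (z : E) : ℝ := fderiv ℝ g z v

theorem contDiffAt_dir {g : E → ℝ} {z : E} (v : E) (hg : ContDiffAt ℝ ∞ g z) :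
    ContDiffAt ℝ ∞ (dir v g) z :=
  (hg.fderiv_right (m := ∞) (by simp)).clm_apply contDiffAt_const

theorem dir_comm {g : E → ℝ} {z : E} (v w : E) (hg : ContDiffAt ℝ ∞ g z) :
    dir v (dir w g) z = dir w (dir v g) z := by
  have hd : DifferentiableAt ℝ (fderiv ℝ g) z :=
    (hg.fderiv_right (m := ∞) (by simp)).differentiableAt (by simp)
  have key : ∀ a b : E, dir a (dir b g) z = fderiv ℝ (fderiv ℝ g) z a b := by
    intro a b
    change fderiv ℝ (fun y => fderiv ℝ g y b) z a = _
    rw [fderiv_clm_apply hd (differentiableAt_const _)]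
    simp
  rw [key, key]
  have h2 : ContDiffAt ℝ (2 : ℕ) g z := hg.of_le (natCast_le_infty 2)
  exact (h2.isSymmSndFDerivAt (by simp)).eq v w

theorem dir_congr {g h : E → ℝ} {z : E} (v : E) (e : g =ᶠ[𝓝 z] h) : dir v g z = dir v h z := by
  rw [dir, dir, e.fderiv_eq]

theorem dir_eq_zero {g : E → ℝ} {Ω : Set E} (hΩ : IsOpen Ω) (v : E) {c : ℝ}
    (hg : ∀ z ∈ Ω, g z = c) {z : E} (hz : z ∈ Ω) : dir v g z = 0 := by
  rw [dir_congr v (h := fun _ => c) (by filter_upwards [hΩ.mem_nhds hz] with y hy using hg y hy)]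
  simp [dir]

theorem dir_mul {g h : E → ℝ} {z : E} (v : E) (hg : DifferentiableAt ℝ g z)
    (hh : DifferentiableAt ℝ h z) :
    dir v (fun y => g y * h y) z = dir v g z * h z + g z * dir v h z := by
  rw [dir, fderiv_fun_mul hg hh]
  simp [dir]; ring

theorem dir_sub {g h : E → ℝ} {z : E} (v : E) (hg : DifferentiableAt ℝ g z)
    (hh : DifferentiableAt ℝ h z) :
    dir v (fun y => g y - h y) z = dir v g z - dir v h z := by
  rw [dir, fderiv_fun_sub hg hh]
  simp [dir]

theorem eventually_contDiffAt_nat {F : Type*} [NormedAddCommGroup F] [NormedSpace ℝ F]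
    {g : E → F} {z : E} (hg : ContDiffAt ℝ ∞ g z) (n : ℕ) : ∀ᶠ y in 𝓝 z, ContDiffAt ℝ n g y :=
  (hg.of_le (natCast_le_infty n)).eventually (by simp)

theorem eventually_differentiableAt {F : Type*} [NormedAddCommGroup F] [NormedSpace ℝ F]
    {g : E → F} {z : E} (hg : ContDiffAt ℝ ∞ g z) : ∀ᶠ y in 𝓝 z, DifferentiableAt ℝ g y := by
  filter_upwards [eventually_contDiffAt_nat hg 1] with y hy using hy.differentiableAt (by simp)

theorem iteratedDeriv_three_eq {h h1 h2 : ℝ → ℝ} {h3 s : ℝ}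
    (e1 : ∀ᶠ y in 𝓝 s, HasDerivAt h (h1 y) y) (e2 : ∀ᶠ y in 𝓝 s, HasDerivAt h1 (h2 y) y)
    (e3 : HasDerivAt h2 h3 s) : iteratedDeriv 3 h s = h3 := by
  have a1 : deriv h =ᶠ[𝓝 s] h1 := e1.mono fun y hy => hy.deriv
  have a2 : deriv (deriv h) =ᶠ[𝓝 s] h2 :=
    a1.deriv.trans (e2.mono fun y hy => hy.deriv)
  rw [iteratedDeriv_succ, iteratedDeriv_succ, iteratedDeriv_one, a2.deriv_eq, e3.deriv]

theorem contDiffAt_deriv {w : ℝ → ℝ} {s : ℝ} (hw : ContDiffAt ℝ ∞ w s) :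
    ContDiffAt ℝ ∞ (deriv w) s := contDiffAt_dir (1 : ℝ) hw

theorem hasDerivAt_comp_shear {F : E → ℝ} {c a b : E} {w : ℝ → ℝ} {y w' : ℝ}
    (hF : DifferentiableAt ℝ F (c + y • a + w y • b)) (hw : HasDerivAt w w' y) :
    HasDerivAt (fun y => F (c + y • a + w y • b))
      (dir a F (c + y • a + w y • b) + dir b F (c + y • a + w y • b) * w') y := by
  have h : HasDerivAt (fun y : ℝ => c + y • a + w y • b) ((1 : ℝ) • a + w' • b) y :=
    ((((hasDerivAt_id y).smul_const a).const_add c)).add (hw.smul_const b)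
  have := hF.hasFDerivAt.comp_hasDerivAt y h
  refine this.congr_deriv ?_
  simp [dir]; ring

/-- The first and third derivatives of a function along the curve `y ↦ c + y a + w(y) b`. -/
theorem derivs_comp_shear {F : E → ℝ} {c a b : E} {w w1 w2 : ℝ → ℝ} {w3 : ℝ}
    (hF : ContDiffAt ℝ ∞ F (c + w 0 • b))
    (e1 : ∀ᶠ y in 𝓝 0, HasDerivAt w (w1 y) y) (e2 : ∀ᶠ y in 𝓝 0, HasDerivAt w1 (w2 y) y)
    (e3 : HasDerivAt w2 w3 0) :
    deriv (fun y => F (c + y • a + w y • b)) 0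
        = dir a F (c + w 0 • b) + dir b F (c + w 0 • b) * w1 0 ∧
    iteratedDeriv 3 (fun y => F (c + y • a + w y • b)) 0 =
      dir a (dir a (dir a F)) (c + w 0 • b)
      + dir b (dir a (dir a F)) (c + w 0 • b) * w1 0
      + (dir a (dir b (dir a F)) (c + w 0 • b)
        + dir b (dir b (dir a F)) (c + w 0 • b) * w1 0) * w1 0
      + (dir a (dir a (dir b F)) (c + w 0 • b)
        + dir b (dir a (dir b F)) (c + w 0 • b) * w1 0
        + (dir a (dir b (dir b F)) (c + w 0 • b)
          + dir b (dir b (dir b F)) (c + w 0 • b) * w1 0) * w1 0) * w1 0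
      + (dir b (dir a F) (c + w 0 • b) + 2 * dir a (dir b F) (c + w 0 • b)
        + 3 * dir b (dir b F) (c + w 0 • b) * w1 0) * w2 0
      + dir b F (c + w 0 • b) * w3 := by
  have hc : ContinuousAt (fun y : ℝ => c + y • a + w y • b) 0 := by
    have := e1.self_of_nhds.continuousAt
    fun_prop
  have hF0 : ContDiffAt ℝ ∞ F (c + (0 : ℝ) • a + w 0 • b) := by simpa using hF
  have tr : ∀ {g : E → ℝ}, ContDiffAt ℝ ∞ g (c + (0 : ℝ) • a + w 0 • b) →
      ∀ᶠ y in 𝓝 (0 : ℝ), DifferentiableAt ℝ g (c + y • a + w y • b) :=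
    fun hg => hc.eventually (eventually_differentiableAt hg)
  have Fa := contDiffAt_dir a hF0
  have Fb := contDiffAt_dir b hF0
  have Faa := contDiffAt_dir a Fa
  have Fba := contDiffAt_dir b Fa
  have Fab := contDiffAt_dir a Fb
  have Fbb := contDiffAt_dir b Fb
  have one : ∀ {g : E → ℝ}, ContDiffAt ℝ ∞ g (c + (0 : ℝ) • a + w 0 • b) →
      HasDerivAt (fun y => g (c + y • a + w y • b))
        (dir a g (c + w 0 • b) + dir b g (c + w 0 • b) * w1 0) 0 := fun {g} hg => by
    simpa using hasDerivAt_comp_shear (tr hg).self_of_nhds e1.self_of_nhds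
  refine ⟨(one hF0).deriv, ?_⟩
  apply iteratedDeriv_three_eq
    (h1 := fun y => dir a F (c + y • a + w y • b) + dir b F (c + y • a + w y • b) * w1 y)
    (h2 := fun y => dir a (dir a F) (c + y • a + w y • b)
      + dir b (dir a F) (c + y • a + w y • b) * w1 y
      + ((dir a (dir b F) (c + y • a + w y • b)
        + dir b (dir b F) (c + y • a + w y • b) * w1 y) * w1 y
        + dir b F (c + y • a + w y • b) * w2 y))
  · filter_upwards [tr hF0, e1] with y h1 h2 using hasDerivAt_comp_shear h1 h2
  · filter_upwards [tr Fa, tr Fb, e1, e2] with y h1 h2 h3 h4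
    exact (hasDerivAt_comp_shear h1 h3).add ((hasDerivAt_comp_shear h2 h3).mul h4)
  · have := ((one Faa).add ((one Fba).mul e2.self_of_nhds)).add
      (((((one Fab).add ((one Fbb).mul e2.self_of_nhds)).mul e2.self_of_nhds)).add
        ((one Fb).mul e3))
    refine this.congr_deriv ?_
    simp only [zero_smul, add_zero, Pi.add_apply, Pi.mul_apply]
    ring

end Directional

/-! ### Comparing the images of two functions that agree at a point. -/

/-- If `F` vanishes along the first axis, then composing it with `y ↦ (y, w y)`, where `w` has a zero
at the origin, only sees the derivative of `F` in the second variable. -/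
theorem derivs_comp_graph_of_vanishing {F : ℝ × ℝ → ℝ} (hF : ContDiffAt ℝ ∞ F 0)
    (h0 : ∀ᶠ y in 𝓝 (0 : ℝ), F (y, 0) = 0) {w : ℝ → ℝ} (hw : ContDiffAt ℝ ∞ w 0) (w0 : w 0 = 0) :
    deriv (fun y => F (y, w y)) 0 = fderiv ℝ F 0 (0, 1) * deriv w 0 ∧
    (deriv w 0 = 0 → deriv (deriv w) 0 = 0 →
      iteratedDeriv 3 (fun y => F (y, w y)) 0 = fderiv ℝ F 0 (0, 1) * iteratedDeriv 3 w 0) := by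
  have key : ∀ v : ℝ → ℝ, ContDiffAt ℝ ∞ v 0 → v 0 = 0 → _ := fun v hv v0 =>
    derivs_comp_shear (F := F) (c := 0) (a := ((1 : ℝ), (0 : ℝ))) (b := ((0 : ℝ), (1 : ℝ)))
      (w := v) (w1 := deriv v) (w2 := deriv (deriv v)) (w3 := iteratedDeriv 3 v 0)
      (by simpa [v0] using hF)
      ((eventually_differentiableAt hv).mono fun y hy => hy.hasDerivAt)
      ((eventually_differentiableAt (contDiffAt_deriv hv)).mono fun y hy => hy.hasDerivAt)
      (by
        have := ((contDiffAt_deriv (contDiffAt_deriv hv)).differentiableAt (by simp)).hasDerivAt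
        rwa [iteratedDeriv_succ, iteratedDeriv_succ, iteratedDeriv_one])
  obtain ⟨a1, a3⟩ := key w hw w0
  -- The curve `w = 0` shows that the pure derivatives of `F` along the first axis vanish; every
  -- other term carries a factor `w'`, `w''` or `w'''`.
  obtain ⟨b1, b3⟩ := key (fun _ => 0) contDiffAt_const rfl
  have z : (fun y : ℝ => F (y, 0)) =ᶠ[𝓝 0] fun _ => 0 := h0
  have z1 := z.deriv_eq
  have z3 := z.iteratedDeriv_eq 3
  simp [w0] at a1 a3 b1 b3 z1 z3
  rw [z1] at b1
  rw [z3] at b3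
  refine ⟨?_, fun d1 d2 => ?_⟩
  · rw [a1, ← b1]; simp [dir]
  · rw [a3, d1, d2, ← b3]; simp [dir]

/-- The inverse function theorem in the plane, where injectivity of the derivative suffices. It
makes `(t', x')` local coordinates on the image of a graph, so that this image is again a graph. -/
theorem exists_local_inverse {A : ℝ × ℝ → ℝ × ℝ} {q : ℝ × ℝ} (hA : ContDiffAt ℝ ∞ A q)
    (hinj : ∀ v, fderiv ℝ A q v = 0 → v = 0) :
    ∃ S : ℝ × ℝ → ℝ × ℝ, ContDiffAt ℝ ∞ S (A q) ∧ S (A q) = q ∧ (∀ᶠ p in 𝓝 q, S (A p) = p) ∧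
      ∀ᶠ p in 𝓝 (A q), A (S p) = p := by
  have hker : (fderiv ℝ A q : ℝ × ℝ →ₗ[ℝ] ℝ × ℝ).det ≠ 0 := by
    rw [Ne, LinearMap.det_eq_zero_iff_ker_ne_bot, not_not, LinearMap.ker_eq_bot']
    exact hinj
  have hd : HasFDerivAt A ((ContinuousLinearMap.toContinuousLinearEquivOfDetNeZero
      (fderiv ℝ A q) hker : (ℝ × ℝ) ≃L[ℝ] (ℝ × ℝ)) : (ℝ × ℝ) →L[ℝ] (ℝ × ℝ)) q := by
    rw [ContinuousLinearMap.coe_toContinuousLinearEquivOfDetNeZero]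
    exact (hA.differentiableAt (by simp)).hasFDerivAt
  have hs := hA.hasStrictFDerivAt' hd (by simp)
  exact ⟨hA.localInverse hd (by simp), hA.to_localInverse hd (by simp),
    hA.localInverse_apply_image hd (by simp), hs.eventually_left_inverse,
    hs.eventually_right_inverse⟩

/-- The independent variables `(t', x')` of the image of a graph, as functions of `(t, x)`. -/
def baseMap (φ : Base → Base) (u : ℝ × ℝ → ℝ) (q : ℝ × ℝ) : ℝ × ℝ :=
  ((φ (q.1, q.2, u q)).1, (φ (q.1, q.2, u q)).2.1)

theorem contDiffAt_graph {u : ℝ × ℝ → ℝ} {q : ℝ × ℝ} (hu : ContDiffAt ℝ ∞ u q) :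
    ContDiffAt ℝ ∞ (fun q : ℝ × ℝ => ((q.1, q.2, u q) : Base)) q :=
  contDiffAt_fst.prodMk (contDiffAt_snd.prodMk hu)

theorem fderiv_comp_graph {F : Type*} [NormedAddCommGroup F] [NormedSpace ℝ F] {g : Base → F}
    {u : ℝ × ℝ → ℝ} {q : ℝ × ℝ} (hu : ContDiffAt ℝ ∞ u q)
    (hg : DifferentiableAt ℝ g (q.1, q.2, u q)) (v : ℝ × ℝ) :
    fderiv ℝ (fun q : ℝ × ℝ => g (q.1, q.2, u q)) q v
      = fderiv ℝ g (q.1, q.2, u q) (v.1, v.2, fderiv ℝ u q v) := by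
  have h := (hasFDerivAt_fst (𝕜 := ℝ) (p := q)).prodMk ((hasFDerivAt_snd (𝕜 := ℝ) (p := q)).prodMk
    (hu.differentiableAt (by simp)).hasFDerivAt)
  have := HasFDerivAt.comp q (g := g) hg.hasFDerivAt h
  have e : fderiv ℝ (fun q : ℝ × ℝ => g (q.1, q.2, u q)) q = _ := this.fderiv
  rw [e]
  simp

/-- The difference of the target expressions for two functions with the same value. -/
theorem lhs_sub {k f : ℝ → ℝ} {v v' : ℝ × ℝ → ℝ} {t x : ℝ} (hv : ContDiffAt ℝ ∞ v (t, x))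
    (hv' : ContDiffAt ℝ ∞ v' (t, x)) (h0 : v' (t, x) = v (t, x)) :
    lhs k f (fun s y => v' (s, y)) t x - lhs k f (fun s y => v (s, y)) t x =
      deriv (fun y => v' (t + y, x) - v (t + y, x)) 0
      + (k t * v (t, x) + f t * v (t, x) ^ 2) * deriv (fun y => v' (t, x + y) - v (t, x + y)) 0
      + iteratedDeriv 3 (fun y => v' (t, x + y) - v (t, x + y)) 0 := by
  have ct : ∀ {g : ℝ × ℝ → ℝ}, ContDiffAt ℝ ∞ g (t, x) →
      ContDiffAt ℝ ∞ (fun y => g (t + y, x)) 0 := fun {g} hg => by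
    refine ContDiffAt.comp (g := g) (f := fun y : ℝ => (t + y, x)) 0 (by simpa using hg) ?_
    fun_prop
  have cx : ∀ {g : ℝ × ℝ → ℝ}, ContDiffAt ℝ ∞ g (t, x) →
      ContDiffAt ℝ ∞ (fun y => g (t, x + y)) 0 := fun {g} hg => by
    refine ContDiffAt.comp (g := g) (f := fun y : ℝ => (t, x + y)) 0 (by simpa using hg) ?_
    fun_prop
  rw [deriv_fun_sub ((ct hv').differentiableAt (by simp)) ((ct hv).differentiableAt (by simp)),
    deriv_fun_sub ((cx hv').differentiableAt (by simp)) ((cx hv).differentiableAt (by simp)),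
    iteratedDeriv_fun_sub ((cx hv').of_le (natCast_le_infty 3))
      ((cx hv).of_le (natCast_le_infty 3)),
    deriv_comp_const_add (fun s => v' (s, x)), deriv_comp_const_add (fun s => v (s, x)),
    deriv_comp_const_add (fun s => v' (t, s)), deriv_comp_const_add (fun s => v (t, s)),
    iteratedDeriv_comp_const_add 3 (fun s => v' (t, s)),
    iteratedDeriv_comp_const_add 3 (fun s => v (t, s))]
  -- Equal values give equal factors in front of the first `x`-derivative, so the difference is
  -- linear in `v' - v`.
  simp only [lhs, add_zero, h0]
  ring

/-- Both `u` and `u + w` satisfy the source equation at `q` with the same value, so their images `v`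
and `v'` satisfy the target equation at one common point with the same value. Subtracting leaves a
linear relation for `v' - v`, which to the order needed is a nonzero multiple of `w`. The curves
`σt` and `σx` are the preimages, along the graph of `u + w`, of the coordinate lines in the `(t',
x')`-plane. -/
theorem lhs_perturbation_eq_zero {Ω : Set Base} {φ : Base → Base} {k f k' f' : ℝ → ℝ}
    (hc : CarriesEquation Ω φ k f k' f') {u w : ℝ × ℝ → ℝ} {q : ℝ × ℝ}
    (hu : ContDiff ℝ ∞ u) (hw : ContDiff ℝ ∞ w) (w0 : w q = 0)
    (hz : (q.1, q.2, u q) ∈ Ω) (hφ : ContDiffAt ℝ ∞ φ (q.1, q.2, u q))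
    (hsurj : ∃ ζ, fderiv ℝ φ (q.1, q.2, u q) ζ = (0, 0, 1))
    (i1 : ∀ v, fderiv ℝ (baseMap φ u) q v = 0 → v = 0)
    (i2 : ∀ v, fderiv ℝ (baseMap φ fun p => u p + w p) q v = 0 → v = 0)
    (l1 : lhs k f (fun s y => u (s, y)) q.1 q.2 = 0)
    (l2 : lhs k f (fun s y => u (s, y) + w (s, y)) q.1 q.2 = 0) :
    ∃ σt σx : ℝ → ℝ × ℝ, ContDiffAt ℝ ∞ σt 0 ∧ ContDiffAt ℝ ∞ σx 0 ∧ σt 0 = q ∧ σx 0 = q ∧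
      (∀ᶠ y in 𝓝 0, baseMap φ (fun p => u p + w p) (σt y) = baseMap φ u q + (y, 0)) ∧
      (∀ᶠ y in 𝓝 0, baseMap φ (fun p => u p + w p) (σx y) = baseMap φ u q + (0, y)) ∧
      (deriv (fun y => w (σx y)) 0 = 0 → deriv (deriv (fun y => w (σx y))) 0 = 0 →
        deriv (fun y => w (σt y)) 0 + iteratedDeriv 3 (fun y => w (σx y)) 0 = 0) := by
  set uw : ℝ × ℝ → ℝ := fun p => u p + w p with huw
  have huwc : ContDiff ℝ ∞ uw := hu.add hw
  have uwq : uw q = u q := by simp [huw, w0]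
  have cA : ∀ g : ℝ × ℝ → ℝ, ContDiff ℝ ∞ g → g q = u q → ContDiffAt ℝ ∞ (baseMap φ g) q := by
    intro g hg hgq
    have h1 : ContDiffAt ℝ ∞ (fun q : ℝ × ℝ => φ (q.1, q.2, g q)) q :=
      ContDiffAt.comp (g := φ) q (by simpa [hgq] using hφ) (contDiffAt_graph hg.contDiffAt)
    exact h1.fst.prodMk h1.snd.fst
  have A0 : baseMap φ uw q = baseMap φ u q := by simp [baseMap, uwq]
  obtain ⟨S, hS, S0, SL, SR⟩ := exists_local_inverse (cA u hu rfl) i1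
  obtain ⟨R, hR, R0, RL, RR⟩ := exists_local_inverse (cA uw huwc uwq) i2
  have cV : ∀ (g : ℝ × ℝ → ℝ) (Q : ℝ × ℝ → ℝ × ℝ), ContDiff ℝ ∞ g → g q = u q →
      ContDiffAt ℝ ∞ Q (baseMap φ u q) → Q (baseMap φ u q) = q →
      ContDiffAt ℝ ∞ (fun p => (φ ((Q p).1, (Q p).2, g (Q p))).2.2) (baseMap φ u q) := by
    intro g Q hg hgq hQ Q0
    have h1 : ContDiffAt ℝ ∞ (fun p => (((Q p).1, (Q p).2, g (Q p)) : Base)) (baseMap φ u q) :=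
      hQ.fst.prodMk (hQ.snd.prodMk (hg.contDiffAt.comp _ hQ))
    have h2 : ContDiffAt ℝ ∞ (fun p => φ ((Q p).1, (Q p).2, g (Q p))) (baseMap φ u q) :=
      ContDiffAt.comp (g := φ) _ (by simpa [Q0, hgq] using hφ) h1
    exact h2.snd.snd
  rw [A0] at hR R0 RR
  set p0 := baseMap φ u q with hp0
  set v : ℝ × ℝ → ℝ := fun p => (φ ((S p).1, (S p).2, u (S p))).2.2 with hvdef
  set v' : ℝ × ℝ → ℝ := fun p => (φ ((R p).1, (R p).2, uw (R p))).2.2 with hvdef'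
  have hv : ContDiffAt ℝ ∞ v p0 := cV u S hu rfl hS S0
  have hv' : ContDiffAt ℝ ∞ v' p0 := cV uw R huwc uwq hR R0
  have vv0 : v' p0 = v p0 := by simp [hvdef, hvdef', S0, R0, uwq]
  have m1 : lhs k' f' (fun s y => v (s, y)) p0.1 p0.2 = 0 := by
    refine (hc (fun s y => u (s, y)) (fun s y => v (s, y)) q.1 q.2 hz hu.contDiffAt hv ?_).1 l1
    filter_upwards [SL] with p hp
    simp only [hvdef]
    change (φ ((S (baseMap φ u p)).1, (S (baseMap φ u p)).2, u (S (baseMap φ u p)))).2.2 = _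
    rw [hp]
  have m2 : lhs k' f' (fun s y => v' (s, y)) p0.1 p0.2 = 0 := by
    have := (hc (fun s y => uw (s, y)) (fun s y => v' (s, y)) q.1 q.2
      (by simpa [uwq] using hz) huwc.contDiffAt ?_ ?_).1 l2
    · change lhs k' f' (fun s y => v' (s, y)) (baseMap φ uw q).1 (baseMap φ uw q).2 = 0 at this
      rwa [A0] at this
    · change ContDiffAt ℝ ∞ v' (baseMap φ uw q)
      rwa [A0]
    · filter_upwards [RL] with p hp
      simp only [hvdef']
      change (φ ((R (baseMap φ uw p)).1, (R (baseMap φ uw p)).2, uw (R (baseMap φ uw p)))).2.2 = _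
      rw [hp]
  have diff := lhs_sub (k := k') (f := f') (t := p0.1) (x := p0.2) hv hv' vv0
  rw [m1, m2, sub_zero] at diff
  set z0 : Base := (q.1, q.2, u q) with hz0
  -- `G` measures how far the image of a point lies above the graph of `v`. It vanishes on the graph
  -- of `u`, and on the graph of `u + w` it equals `v' - v` at the image point.
  set G : Base → ℝ := fun z => (φ z).2.2 - v ((φ z).1, (φ z).2.1) with hG
  have hvz : ContDiffAt ℝ ∞ v ((φ z0).1, (φ z0).2.1) := hv
  have cG : ContDiffAt ℝ ∞ G z0 := hφ.snd.snd.sub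
    (ContDiffAt.comp (g := v) z0 hvz (hφ.fst.prodMk hφ.snd.fst))
  have G0 : ∀ᶠ p in 𝓝 q, G (p.1, p.2, u p) = 0 := by
    filter_upwards [SL] with p hp
    simp only [hG, hvdef]
    change _ - (φ ((S (baseMap φ u p)).1, (S (baseMap φ u p)).2, u (S (baseMap φ u p)))).2.2 = 0
    rw [hp, sub_self]
  have Gdiff : ∀ᶠ p in 𝓝 p0, v' p - v p = G ((R p).1, (R p).2, uw (R p)) := by
    filter_upwards [RR] with p hp
    simp only [hG, hvdef']
    change _ = _ - v (baseMap φ uw (R p))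
    rw [hp]
  set C : ℝ := fderiv ℝ G z0 (0, 0, 1) with hC
  -- If `dφ ζ` is the new `u`-direction, then `dG ζ = 1`. Modulo a tangent vector to the graph of
  -- `u`, on which `dG` vanishes, `ζ` is a multiple of `∂_u`; hence `∂_u G ≠ 0`.
  have hCne : C ≠ 0 := by
    obtain ⟨ζ, hζ⟩ := hsurj
    have hφd := (hφ.differentiableAt (by simp)).hasFDerivAt
    have e1 : fderiv ℝ G z0 ζ = 1 := by
      have h1 := hφd.snd.snd
      have h2 := HasFDerivAt.comp z0 (g := v) (f := fun z => ((φ z).1, (φ z).2.1))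
        (hvz.differentiableAt (by simp)).hasFDerivAt (hφd.fst.prodMk hφd.snd.fst)
      have h3 : fderiv ℝ G z0 = _ := (h1.sub h2).fderiv
      rw [h3]
      simp only [sub_apply, ContinuousLinearMap.comp_apply,
        ContinuousLinearMap.prod_apply, hζ, ContinuousLinearMap.coe_snd',
        ContinuousLinearMap.coe_fst']
      rw [show (((0 : ℝ), (0 : ℝ)) : ℝ × ℝ) = 0 from rfl, map_zero, sub_zero]
    have e2 : fderiv ℝ G z0 (ζ.1, ζ.2.1, fderiv ℝ u q (ζ.1, ζ.2.1)) = 0 := by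
      have := fderiv_comp_graph (g := G) hu.contDiffAt (cG.differentiableAt (by simp))
        (ζ.1, ζ.2.1)
      rw [← this]
      have : (fun p : ℝ × ℝ => G (p.1, p.2, u p)) =ᶠ[𝓝 q] fun _ => 0 := G0
      rw [this.fderiv_eq]; simp
    have e3 : ζ = (ζ.1, ζ.2.1, fderiv ℝ u q (ζ.1, ζ.2.1))
        + (ζ.2.2 - fderiv ℝ u q (ζ.1, ζ.2.1)) • ((0, 0, 1) : Base) := by
      ext <;> simp
    intro hC0
    rw [e3, map_add, e2, map_smul, ← hC, hC0] at e1
    simp at e1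
  have line : ∀ d : ℝ × ℝ, ContDiffAt ℝ ∞ (fun y : ℝ => R (p0 + y • d)) 0 ∧
      R (p0 + (0 : ℝ) • d) = q ∧
      (∀ᶠ y in 𝓝 (0 : ℝ), baseMap φ uw (R (p0 + y • d)) = p0 + y • d) ∧
      deriv (fun y : ℝ => v' (p0 + y • d) - v (p0 + y • d)) 0
        = C * deriv (fun y : ℝ => w (R (p0 + y • d))) 0 ∧
      (deriv (fun y : ℝ => w (R (p0 + y • d))) 0 = 0 →
        deriv (deriv (fun y : ℝ => w (R (p0 + y • d)))) 0 = 0 →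
        iteratedDeriv 3 (fun y : ℝ => v' (p0 + y • d) - v (p0 + y • d)) 0
          = C * iteratedDeriv 3 (fun y : ℝ => w (R (p0 + y • d))) 0) := by
    intro d
    have cl : ContDiffAt ℝ ∞ (fun y : ℝ => p0 + y • d) 0 := by fun_prop
    have tl : Tendsto (fun y : ℝ => p0 + y • d) (𝓝 0) (𝓝 p0) := by
      simpa using cl.continuousAt.tendsto
    have cσ : ContDiffAt ℝ ∞ (fun y : ℝ => R (p0 + y • d)) 0 :=
      ContDiffAt.comp (g := R) 0 (by simpa using hR) cl
    have σ0 : R (p0 + (0 : ℝ) • d) = q := by simpa using R0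
    have tσ : Tendsto (fun y : ℝ => R (p0 + y • d)) (𝓝 0) (𝓝 q) := by
      have := cσ.continuousAt.tendsto
      rwa [σ0] at this
    -- The variables of `F` are the parameter along the line and the height above the graph of `u`:
    -- `F (y, 0) = 0`, and `v' - v` along the line is `F (y, w)`.
    set F : ℝ × ℝ → ℝ := fun e => G ((R (p0 + e.1 • d)).1, (R (p0 + e.1 • d)).2,
      u (R (p0 + e.1 • d)) + e.2) with hF
    have cR1 : ContDiffAt ℝ ∞ (fun e : ℝ × ℝ => R (p0 + e.1 • d)) 0 :=
      ContDiffAt.comp (g := fun y : ℝ => R (p0 + y • d)) (f := Prod.fst) (0 : ℝ × ℝ) cσ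
        contDiffAt_fst
    have cF : ContDiffAt ℝ ∞ F 0 := by
      refine ContDiffAt.comp (g := G) (f := fun e : ℝ × ℝ => (((R (p0 + e.1 • d)).1,
        (R (p0 + e.1 • d)).2, u (R (p0 + e.1 • d)) + e.2) : Base)) (0 : ℝ × ℝ) ?_ ?_
      · simpa [R0] using cG
      · exact cR1.fst.prodMk (cR1.snd.prodMk ((hu.contDiffAt.comp _ cR1).add contDiffAt_snd))
    have F0 : ∀ᶠ y in 𝓝 (0 : ℝ), F (y, 0) = 0 := by
      filter_upwards [tσ.eventually G0] with y hy
      simpa [hF] using hy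
    have cw : ContDiffAt ℝ ∞ (fun y : ℝ => w (R (p0 + y • d))) 0 := hw.contDiffAt.comp _ cσ
    have FC : fderiv ℝ F 0 (0, 1) = C := by
      have h1 : HasDerivAt (fun s : ℝ => F (0, s)) (fderiv ℝ F 0 (0, 1)) 0 := by
        have := (cF.differentiableAt (by simp)).hasFDerivAt.comp_hasDerivAt (0 : ℝ)
          (f := fun s : ℝ => ((0 : ℝ), s)) ((hasDerivAt_const _ _).prodMk (hasDerivAt_id _))
        exact this
      have h2 : HasDerivAt (fun s : ℝ => F (0, s)) C 0 := by
        have e : (fun s : ℝ => F (0, s)) = fun s => G (q.1, q.2, u q + s) := by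
          funext s; simp [hF, R0]
        rw [e]
        have hGd : HasFDerivAt G (fderiv ℝ G z0) (q.1, q.2, u q + 0) := by
          simpa using (cG.differentiableAt (by simp)).hasFDerivAt
        exact hGd.comp_hasDerivAt (0 : ℝ)
          (f := fun s : ℝ => ((q.1, q.2, u q + s) : Base)) ((hasDerivAt_const _ _).prodMk
            ((hasDerivAt_const _ _).prodMk ((hasDerivAt_id _).const_add _)))
      exact h1.unique h2
    obtain ⟨d1, d3⟩ := derivs_comp_graph_of_vanishing cF F0 cw (by simp [R0, w0])
    rw [FC] at d1 d3
    have ev : (fun y : ℝ => v' (p0 + y • d) - v (p0 + y • d)) =ᶠ[𝓝 0]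
        fun y => F (y, w (R (p0 + y • d))) := by
      filter_upwards [tl.eventually Gdiff] with y hy
      rw [hy]
    refine ⟨cσ, σ0, ?_, ?_, ?_⟩
    · filter_upwards [tl.eventually RR] with y hy using hy
    · rw [ev.deriv_eq, d1]
    · intro a b
      rw [ev.iteratedDeriv_eq, d3 a b]
  obtain ⟨ta, tb, tc, td, -⟩ := line (1, 0)
  obtain ⟨xa, xb, xc, xd, xe⟩ := line (0, 1)
  refine ⟨_, _, ta, xa, tb, xb, ?_, ?_, ?_⟩
  · filter_upwards [tc] with y hy
    rw [hy]; simp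
  · filter_upwards [xc] with y hy
    rw [hy]; simp
  · intro a b
    have xe' := xe a b
    rw [a] at xd
    have et : (fun y : ℝ => v' (p0 + y • ((1, 0) : ℝ × ℝ)) - v (p0 + y • ((1, 0) : ℝ × ℝ)))
        = fun y => v' (p0.1 + y, p0.2) - v (p0.1 + y, p0.2) := by
      funext y
      have : p0 + y • ((1, 0) : ℝ × ℝ) = (p0.1 + y, p0.2) := by ext <;> simp
      rw [this]
    have ex : (fun y : ℝ => v' (p0 + y • ((0, 1) : ℝ × ℝ)) - v (p0 + y • ((0, 1) : ℝ × ℝ)))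
        = fun y => v' (p0.1, p0.2 + y) - v (p0.1, p0.2 + y) := by
      funext y
      have : p0 + y • ((0, 1) : ℝ × ℝ) = (p0.1, p0.2 + y) := by ext <;> simp
      rw [this]
    rw [et] at td
    rw [ex] at xd xe'
    rw [td, xd, xe'] at diff
    have : C * (deriv (fun y : ℝ => w (R (p0 + y • ((1, 0) : ℝ × ℝ)))) 0 +
        iteratedDeriv 3 (fun y : ℝ => w (R (p0 + y • ((0, 1) : ℝ × ℝ)))) 0) = 0 := by
      linarith
    exact (mul_eq_zero.1 this).resolve_left hCne

/-! ### Partial derivatives and polynomial test functions. -/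

/-- The partial derivative with respect to `t`. -/
noncomputable def Dt (g : Base → ℝ) : Base → ℝ := dir ((1, 0, 0) : Base) g

/-- The partial derivative with respect to `x`. -/
noncomputable def Dx (g : Base → ℝ) : Base → ℝ := dir ((0, 1, 0) : Base) g

/-- The partial derivative with respect to `u`. -/
noncomputable def Du (g : Base → ℝ) : Base → ℝ := dir ((0, 0, 1) : Base) g

theorem fderiv_base_apply (g : Base → ℝ) (z ζ : Base) :
    fderiv ℝ g z ζ = ζ.1 * Dt g z + ζ.2.1 * Dx g z + ζ.2.2 * Du g z := by
  have : ζ = ζ.1 • ((1, 0, 0) : Base) + ζ.2.1 • ((0, 1, 0) : Base) + ζ.2.2 • ((0, 0, 1) : Base) := by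
    ext <;> simp
  conv_lhs => rw [this]
  simp only [map_add, map_smul, smul_eq_mul]
  rfl

/-- The new time of a transformation of the variables `(t, x, u)`. -/
def tComp (φ : Base → Base) (z : Base) : ℝ := (φ z).1

/-- The new space variable of a transformation of the variables `(t, x, u)`. -/
def xComp (φ : Base → Base) (z : Base) : ℝ := (φ z).2.1

/-- The new dependent variable of a transformation of the variables `(t, x, u)`. -/
def uComp (φ : Base → Base) (z : Base) : ℝ := (φ z).2.2

theorem fderiv_eq_comps {φ : Base → Base} {z : Base} (hφ : DifferentiableAt ℝ φ z) (ζ : Base) :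
    fderiv ℝ φ z ζ =
      (fderiv ℝ (tComp φ) z ζ, fderiv ℝ (xComp φ) z ζ, fderiv ℝ (uComp φ) z ζ) := by
  have h := hφ.hasFDerivAt
  have h1 : fderiv ℝ (tComp φ) z = _ := h.fst.fderiv
  have h2 : fderiv ℝ (xComp φ) z = _ := h.snd.fst.fderiv
  have h3 : fderiv ℝ (uComp φ) z = _ := h.snd.snd.fderiv
  rw [h1, h2, h3]
  rfl

theorem exists_fderiv_eq {φ : Base → Base} {z : Base} (hdet : (fderiv ℝ φ z).det ≠ 0) (η : Base) :
    ∃ ζ, fderiv ℝ φ z ζ = η :=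
  ⟨((fderiv ℝ φ z).toContinuousLinearEquivOfDetNeZero hdet).symm η, by
    rw [← ContinuousLinearMap.toContinuousLinearEquivOfDetNeZero_apply _ hdet]; simp⟩

theorem fderiv_baseMap {φ : Base → Base} {u : ℝ × ℝ → ℝ} {q : ℝ × ℝ} (hu : ContDiffAt ℝ ∞ u q)
    (hφ : DifferentiableAt ℝ φ (q.1, q.2, u q)) (v : ℝ × ℝ) :
    fderiv ℝ (baseMap φ u) q v =
      (fderiv ℝ (tComp φ) (q.1, q.2, u q) (v.1, v.2, fderiv ℝ u q v),
        fderiv ℝ (xComp φ) (q.1, q.2, u q) (v.1, v.2, fderiv ℝ u q v)) := by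
  have h := hφ.hasFDerivAt
  have h1 : fderiv ℝ (fun z => ((φ z).1, (φ z).2.1)) (q.1, q.2, u q) = _ :=
    (h.fst.prodMk h.snd.fst).fderiv
  have h2 := fderiv_comp_graph (g := fun z => ((φ z).1, (φ z).2.1)) hu
    (h.fst.prodMk h.snd.fst).differentiableAt v
  have h3 := fderiv_eq_comps hφ (v.1, v.2, fderiv ℝ u q v)
  have h4 : fderiv ℝ (baseMap φ u) q v
      = fderiv ℝ (fun z => ((φ z).1, (φ z).2.1)) (q.1, q.2, u q) (v.1, v.2, fderiv ℝ u q v) := h2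
  rw [h4, h1]
  simp [h3]

/-- The cubic polynomials used as test functions. -/
noncomputable def testFun (q : ℝ × ℝ) (a m p c r s : ℝ) (y : ℝ × ℝ) : ℝ :=
  a + m * (y.1 - q.1) + p * (y.2 - q.2) + c * (y.2 - q.2) ^ 2 / 2 + r * (y.2 - q.2) ^ 3 / 6
    + s * (y.1 - q.1) ^ 3

theorem contDiff_testFun (q : ℝ × ℝ) (a m p c r s : ℝ) : ContDiff ℝ ∞ (testFun q a m p c r s) := by
  unfold testFun; fun_prop

theorem testFun_self (q : ℝ × ℝ) (a m p c r s : ℝ) : testFun q a m p c r s q = a := by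
  simp [testFun]

theorem hasDerivAt_testFun_fst (q : ℝ × ℝ) (a m p c r s : ℝ) :
    HasDerivAt (fun y => testFun q a m p c r s (y, q.2)) m q.1 := by
  unfold testFun
  have h : HasDerivAt (fun y : ℝ => y - q.1) 1 q.1 := (hasDerivAt_id _).sub_const _
  have := (((((h.const_mul m).const_add a).add_const (p * (q.2 - q.2))).add_const
    (c * (q.2 - q.2) ^ 2 / 2)).add_const (r * (q.2 - q.2) ^ 3 / 6)).add ((h.pow 3).const_mul s)
  refine this.congr_deriv ?_
  simp

theorem hasDerivAt_testFun_snd (q : ℝ × ℝ) (a m p c r s y : ℝ) :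
    HasDerivAt (fun y => testFun q a m p c r s (q.1, y))
      (p + c * (y - q.2) + r * (y - q.2) ^ 2 / 2) y := by
  unfold testFun
  have h : HasDerivAt (fun y : ℝ => y - q.2) 1 y := (hasDerivAt_id _).sub_const _
  have := ((((h.const_mul p).const_add (a + m * (q.1 - q.1))).add
    (((h.pow 2).const_mul c).div_const 2)).add (((h.pow 3).const_mul r).div_const 6)).add_const
    (s * (q.1 - q.1) ^ 3)
  refine this.congr_deriv ?_
  simp; ring

theorem hasDerivAt_testFun_snd_two (q : ℝ × ℝ) (p c r y : ℝ) :
    HasDerivAt (fun y => p + c * (y - q.2) + r * (y - q.2) ^ 2 / 2) (c + r * (y - q.2)) y := by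
  have h : HasDerivAt (fun y : ℝ => y - q.2) 1 y := (hasDerivAt_id _).sub_const _
  have := ((h.const_mul c).const_add p).add (((h.pow 2).const_mul r).div_const 2)
  refine this.congr_deriv ?_
  simp; ring

theorem fderiv_testFun (q : ℝ × ℝ) (a m p c r s : ℝ) (v : ℝ × ℝ) :
    fderiv ℝ (testFun q a m p c r s) q v = m * v.1 + p * v.2 := by
  have hd := ((contDiff_testFun q a m p c r s).differentiable (by simp) q).hasFDerivAt
  have h1 : HasDerivAt (fun y => testFun q a m p c r s (y, q.2)) _ q.1 :=
    hd.comp_hasDerivAt q.1 (f := fun y : ℝ => (y, q.2)) ((hasDerivAt_id _).prodMk (hasDerivAt_const _ _))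
  have h2 : HasDerivAt (fun y => testFun q a m p c r s (q.1, y)) _ q.2 :=
    hd.comp_hasDerivAt q.2 (f := fun y : ℝ => (q.1, y)) ((hasDerivAt_const _ _).prodMk (hasDerivAt_id _))
  have e1 := h1.unique (hasDerivAt_testFun_fst q a m p c r s)
  have e2 := h2.unique (hasDerivAt_testFun_snd q a m p c r s q.2)
  have : v = v.1 • ((1, 0) : ℝ × ℝ) + v.2 • ((0, 1) : ℝ × ℝ) := by ext <;> simp
  conv_lhs => rw [this]
  rw [map_add, map_smul, map_smul, e1, e2]
  simp; ring

/-- At `q` the parameters `m`, `p`, `c`, `r` are `u_t`, `u_x`, `u_xx`, `u_xxx`; the cube in time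
weighted by `s` is invisible to the equation. -/
theorem lhs_testFun (k f : ℝ → ℝ) (q : ℝ × ℝ) (a m p c r s : ℝ) :
    lhs k f (fun t x => testFun q a m p c r s (t, x)) q.1 q.2
      = m + (k q.1 * a + f q.1 * a ^ 2) * p + r := by
  have h3 : iteratedDeriv 3 (fun y => testFun q a m p c r s (q.1, y)) q.2 = r := by
    refine iteratedDeriv_three_eq
      (Eventually.of_forall fun y => hasDerivAt_testFun_snd q a m p c r s y)
      (Eventually.of_forall fun y => hasDerivAt_testFun_snd_two q p c r y) ?_
    have h : HasDerivAt (fun y : ℝ => y - q.2) 1 q.2 := (hasDerivAt_id _).sub_const _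
    refine ((h.const_mul r).const_add c).congr_deriv (by simp)
  have h0 : testFun q a m p c r s (q.1, q.2) = a := testFun_self q a m p c r s
  simp only [lhs]
  rw [(hasDerivAt_testFun_fst q a m p c r s).deriv,
    (hasDerivAt_testFun_snd q a m p c r s q.2).deriv, h3, h0]
  simp; ring

theorem testFun_add (q : ℝ × ℝ) (a m p c r s m' r' s' : ℝ) (y : ℝ × ℝ) :
    testFun q a m p c r s y + testFun q 0 m' 0 0 r' s' y
      = testFun q a (m + m') p c (r + r') (s + s') y := by
  simp only [testFun]; ring

/-- Cramer's rule: `h` is the nonvanishing of the Jacobian of `(t, x) ↦ (t', x')` along the graph.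
-/
theorem baseMap_testFun_injective {φ : Base → Base} {q : ℝ × ℝ} {a : ℝ}
    (hφ : DifferentiableAt ℝ φ (q.1, q.2, a)) (m p c r s : ℝ)
    (h : (Dt (tComp φ) (q.1, q.2, a) + Du (tComp φ) (q.1, q.2, a) * m)
        * (Dx (xComp φ) (q.1, q.2, a) + Du (xComp φ) (q.1, q.2, a) * p)
      - (Dx (tComp φ) (q.1, q.2, a) + Du (tComp φ) (q.1, q.2, a) * p)
        * (Dt (xComp φ) (q.1, q.2, a) + Du (xComp φ) (q.1, q.2, a) * m) ≠ 0) (v : ℝ × ℝ)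
    (hv : fderiv ℝ (baseMap φ (testFun q a m p c r s)) q v = 0) : v = 0 := by
  have hs := testFun_self q a m p c r s
  rw [fderiv_baseMap (contDiff_testFun q a m p c r s).contDiffAt (by rwa [hs]), hs,
    fderiv_testFun, fderiv_base_apply, fderiv_base_apply, Prod.mk_eq_zero] at hv
  obtain ⟨h1, h2⟩ := hv
  simp only at h1 h2
  ext
  · refine (mul_eq_zero.1 ?_).resolve_left h
    linear_combination (Dx (xComp φ) (q.1, q.2, a) + Du (xComp φ) (q.1, q.2, a) * p) * h1
      - (Dx (tComp φ) (q.1, q.2, a) + Du (tComp φ) (q.1, q.2, a) * p) * h2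
  · refine (mul_eq_zero.1 ?_).resolve_left h
    linear_combination (Dt (tComp φ) (q.1, q.2, a) + Du (tComp φ) (q.1, q.2, a) * m) * h2
      - (Dt (xComp φ) (q.1, q.2, a) + Du (xComp φ) (q.1, q.2, a) * m) * h1

/-- The velocity of a curve in the `(t, x)`-plane whose image under `baseMap` is a line. -/
theorem deriv_lift_line {φ : Base → Base} {q : ℝ × ℝ} {a : ℝ}
    (hφ : DifferentiableAt ℝ φ (q.1, q.2, a)) (m p c r s : ℝ) {σ : ℝ → ℝ × ℝ}
    (hσ : ContDiffAt ℝ ∞ σ 0) (σ0 : σ 0 = q) {p0 d : ℝ × ℝ}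
    (h : ∀ᶠ y : ℝ in 𝓝 0, baseMap φ (testFun q a m p c r s) (σ y) = p0 + y • d) :
    (Dt (tComp φ) (q.1, q.2, a) + Du (tComp φ) (q.1, q.2, a) * m) * (deriv σ 0).1
      + (Dx (tComp φ) (q.1, q.2, a) + Du (tComp φ) (q.1, q.2, a) * p) * (deriv σ 0).2 = d.1 ∧
    (Dt (xComp φ) (q.1, q.2, a) + Du (xComp φ) (q.1, q.2, a) * m) * (deriv σ 0).1
      + (Dx (xComp φ) (q.1, q.2, a) + Du (xComp φ) (q.1, q.2, a) * p) * (deriv σ 0).2 = d.2 := by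
  have hs := testFun_self q a m p c r s
  have hd : DifferentiableAt ℝ (baseMap φ (testFun q a m p c r s)) q := by
    have h1 : DifferentiableAt ℝ (fun y : ℝ × ℝ => φ (y.1, y.2, testFun q a m p c r s y)) q :=
      DifferentiableAt.comp q (g := φ) (by rwa [hs])
        ((contDiffAt_graph (contDiff_testFun q a m p c r s).contDiffAt).differentiableAt (by simp))
    exact h1.fst.prodMk h1.snd.fst
  have hd' : HasFDerivAt (baseMap φ (testFun q a m p c r s))
      (fderiv ℝ (baseMap φ (testFun q a m p c r s)) q) (σ 0) := by
    rw [σ0]; exact hd.hasFDerivAt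
  have h1 := hd'.comp_hasDerivAt 0 (hσ.differentiableAt (by simp)).hasDerivAt
  have h2 : HasDerivAt (fun y : ℝ => p0 + y • d) d 0 := by
    simpa using ((hasDerivAt_id (0 : ℝ)).smul_const d).const_add p0
  have h3 := h1.unique (h2.congr_of_eventuallyEq h)
  rw [fderiv_baseMap (contDiff_testFun q a m p c r s).contDiffAt (by rwa [hs]), hs,
    fderiv_testFun, fderiv_base_apply, fderiv_base_apply] at h3
  rw [← h3]
  constructor <;> simp <;> ring

/-- For cubes, the vanishing conditions in `lhs_perturbation_eq_zero` hold automatically, and the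
third derivative sees only the velocity of `g`. -/
theorem derivs_cube {g : ℝ → ℝ} (hg : ContDiffAt ℝ ∞ g 0) (g0 : g 0 = 0) (c : ℝ) :
    deriv (fun y => c * g y ^ 3) 0 = 0 ∧ deriv (deriv fun y => c * g y ^ 3) 0 = 0 ∧
      iteratedDeriv 3 (fun y => c * g y ^ 3) 0 = 6 * c * deriv g 0 ^ 3 := by
  have e1 : ∀ᶠ y in 𝓝 0, HasDerivAt g (deriv g y) y :=
    (eventually_differentiableAt hg).mono fun y hy => hy.hasDerivAt
  have e2 : ∀ᶠ y in 𝓝 0, HasDerivAt (deriv g) (deriv (deriv g) y) y :=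
    (eventually_differentiableAt (contDiffAt_deriv hg)).mono fun y hy => hy.hasDerivAt
  have e3 : HasDerivAt (deriv (deriv g)) (deriv (deriv (deriv g)) 0) 0 :=
    ((contDiffAt_deriv (contDiffAt_deriv hg)).differentiableAt (by simp)).hasDerivAt
  have f1 : ∀ᶠ y in 𝓝 0, HasDerivAt (fun y => c * g y ^ 3) (c * (3 * g y ^ 2 * deriv g y)) y :=
    e1.mono fun y hy => by simpa using (hy.pow 3).const_mul c
  have f2 : ∀ᶠ y in 𝓝 0, HasDerivAt (fun y => c * (3 * g y ^ 2 * deriv g y))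
      (c * (6 * g y * deriv g y ^ 2 + 3 * g y ^ 2 * deriv (deriv g) y)) y := by
    filter_upwards [e1, e2] with y h1 h2
    refine ((((h1.pow 2).const_mul 3).mul h2).congr_deriv ?_).const_mul c
    simp; ring
  have f3 : HasDerivAt (fun y => c * (6 * g y * deriv g y ^ 2 + 3 * g y ^ 2 * deriv (deriv g) y))
      (6 * c * deriv g 0 ^ 3) 0 := by
    have h1 := e1.self_of_nhds
    have h2 := e2.self_of_nhds
    refine ((((h1.const_mul 6).mul (h2.pow 2)).add
      (((h1.pow 2).const_mul 3).mul e3)).const_mul c).congr_deriv ?_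
    simp [g0]; ring
  have d1 : deriv (fun y => c * g y ^ 3) =ᶠ[𝓝 0] fun y => c * (3 * g y ^ 2 * deriv g y) :=
    f1.mono fun y hy => hy.deriv
  refine ⟨?_, ?_, iteratedDeriv_three_eq f1 f2 f3⟩
  · rw [f1.self_of_nhds.deriv, g0]; simp
  · rw [d1.deriv_eq, f2.self_of_nhds.deriv, g0]; simp

/-- The Jacobian of `(t, x) ↦ (t', x')` along a graph with `u_t = m`, `u_x = p`. -/
noncomputable def graphJacobian (φ : Base → Base) (z : Base) (m p : ℝ) : ℝ :=
  (Dt (tComp φ) z + Du (tComp φ) z * m) * (Dx (xComp φ) z + Du (xComp φ) z * p)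
    - (Dx (tComp φ) z + Du (tComp φ) z * p) * (Dt (xComp φ) z + Du (xComp φ) z * m)

theorem contDiffAt_comps {φ : Base → Base} {z : Base} (hφ : ContDiffAt ℝ ∞ φ z) :
    ContDiffAt ℝ ∞ (tComp φ) z ∧ ContDiffAt ℝ ∞ (xComp φ) z ∧ ContDiffAt ℝ ∞ (uComp φ) z :=
  ⟨hφ.fst, hφ.snd.fst, hφ.snd.snd⟩

theorem exists_comps {φ : Base → Base} {z : Base} (hφ : DifferentiableAt ℝ φ z)
    (hdet : (fderiv ℝ φ z).det ≠ 0) (a b c : ℝ) : ∃ ζ : Base,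
      ζ.1 * Dt (tComp φ) z + ζ.2.1 * Dx (tComp φ) z + ζ.2.2 * Du (tComp φ) z = a ∧
      ζ.1 * Dt (xComp φ) z + ζ.2.1 * Dx (xComp φ) z + ζ.2.2 * Du (xComp φ) z = b ∧
      ζ.1 * Dt (uComp φ) z + ζ.2.1 * Dx (uComp φ) z + ζ.2.2 * Du (uComp φ) z = c := by
  obtain ⟨ζ, hζ⟩ := exists_fderiv_eq hdet (a, b, c)
  rw [fderiv_eq_comps hφ, fderiv_base_apply, fderiv_base_apply, fderiv_base_apply] at hζ
  simp only [Prod.mk.injEq] at hζ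
  exact ⟨ζ, hζ⟩

theorem hasDerivAt_fst_snd {σ : ℝ → ℝ × ℝ} {d : ℝ × ℝ} {y : ℝ} (h : HasDerivAt σ d y) :
    HasDerivAt (fun s => (σ s).1) d.1 y ∧ HasDerivAt (fun s => (σ s).2) d.2 y :=
  ⟨(ContinuousLinearMap.fst ℝ ℝ ℝ).hasFDerivAt.comp_hasDerivAt y h,
    (ContinuousLinearMap.snd ℝ ℝ ℝ).hasFDerivAt.comp_hasDerivAt y h⟩

/-- Raising `u_t` by `m'` and lowering `u_xxx` by the same amount leaves the source equation intact,
and so does a cube in `t`. Both Jacobians must be nonzero so that both images are graphs. The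
function `u` returned is the perturbed germ, and the three linear equations are the velocities of
the lifted coordinate lines. -/
theorem perturbation_testFun {Ω : Set Base} {φ : Base → Base} {k f k' f' : ℝ → ℝ}
    (hc : CarriesEquation Ω φ k f k' f') {q : ℝ × ℝ} {a : ℝ} (hz : (q.1, q.2, a) ∈ Ω)
    (hφ : ContDiffAt ℝ ∞ φ (q.1, q.2, a)) (hdet : (fderiv ℝ φ (q.1, q.2, a)).det ≠ 0)
    (m p m' s' : ℝ) (hj : graphJacobian φ (q.1, q.2, a) m p ≠ 0)
    (hj' : graphJacobian φ (q.1, q.2, a) (m + m') p ≠ 0) :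
    ∃ (σt σx : ℝ → ℝ × ℝ) (u : ℝ × ℝ → ℝ), ContDiffAt ℝ ∞ σt 0 ∧ ContDiffAt ℝ ∞ σx 0 ∧
      σt 0 = q ∧ σx 0 = q ∧ ContDiff ℝ ∞ u ∧ u q = a ∧
      (∀ᶠ y in 𝓝 0, baseMap φ u (σx y) = baseMap φ u q + y • (0, 1)) ∧
      ((Dt (tComp φ) (q.1, q.2, a) + Du (tComp φ) (q.1, q.2, a) * (m + m')) * (deriv σt 0).1
        + (Dx (tComp φ) (q.1, q.2, a) + Du (tComp φ) (q.1, q.2, a) * p) * (deriv σt 0).2 = 1) ∧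
      ((Dt (tComp φ) (q.1, q.2, a) + Du (tComp φ) (q.1, q.2, a) * (m + m')) * (deriv σx 0).1
        + (Dx (tComp φ) (q.1, q.2, a) + Du (tComp φ) (q.1, q.2, a) * p) * (deriv σx 0).2 = 0) ∧
      ((Dt (xComp φ) (q.1, q.2, a) + Du (xComp φ) (q.1, q.2, a) * (m + m')) * (deriv σx 0).1
        + (Dx (xComp φ) (q.1, q.2, a) + Du (xComp φ) (q.1, q.2, a) * p) * (deriv σx 0).2 = 1) ∧
      (deriv (fun y => testFun q 0 m' 0 0 (-m') s' (σx y)) 0 = 0 →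
        deriv (deriv (fun y => testFun q 0 m' 0 0 (-m') s' (σx y))) 0 = 0 →
        m' * (deriv σt 0).1 + iteratedDeriv 3 (fun y => testFun q 0 m' 0 0 (-m') s' (σx y)) 0
          = 0) := by
  have hd := hφ.differentiableAt (n := ∞) (by simp)
  -- This `u_xxx` puts the unperturbed test function on the equation at `q`.
  set r : ℝ := -m - (k q.1 * a + f q.1 * a ^ 2) * p with hr
  have hadd : (fun y => testFun q a m p 0 r 0 y + testFun q 0 m' 0 0 (-m') s' y)
      = testFun q a (m + m') p 0 (r + -m') (0 + s') := funext fun y => testFun_add _ _ _ _ _ _ _ _ _ _ _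
  have hs := testFun_self q a m p 0 r 0
  have hs' := testFun_self q a (m + m') p 0 (r + -m') (0 + s')
  have hbase : baseMap φ (testFun q a m p 0 r 0) q
      = baseMap φ (testFun q a (m + m') p 0 (r + -m') (0 + s')) q := by
    simp only [baseMap, hs, hs']
  obtain ⟨σt, σx, ct, cx, t0, x0, lt, lx, h⟩ :=
    lhs_perturbation_eq_zero hc (u := testFun q a m p 0 r 0) (w := testFun q 0 m' 0 0 (-m') s')
      (q := q) (contDiff_testFun _ _ _ _ _ _ _) (contDiff_testFun _ _ _ _ _ _ _)
      (testFun_self _ _ _ _ _ _ _) (by rwa [hs]) (by rwa [hs])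
      (by rw [hs]; exact exists_fderiv_eq hdet _)
      (fun v => baseMap_testFun_injective hd m p 0 r 0 hj v)
      (by rw [hadd]; exact fun v => baseMap_testFun_injective hd _ p 0 _ _ hj' v)
      (by rw [lhs_testFun]; ring)
      (by
        have := lhs_testFun k f q a (m + m') p 0 (r + -m') (0 + s')
        rw [← hadd] at this
        rw [this]; ring)
  rw [hadd, hbase] at lt lx
  have lt' : ∀ᶠ y : ℝ in 𝓝 0, baseMap φ (testFun q a (m + m') p 0 (r + -m') (0 + s')) (σt y)
      = baseMap φ (testFun q a (m + m') p 0 (r + -m') (0 + s')) q + y • ((1, 0) : ℝ × ℝ) := by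
    filter_upwards [lt] with y hy
    rw [hy]; simp
  have lx' : ∀ᶠ y : ℝ in 𝓝 0, baseMap φ (testFun q a (m + m') p 0 (r + -m') (0 + s')) (σx y)
      = baseMap φ (testFun q a (m + m') p 0 (r + -m') (0 + s')) q + y • ((0, 1) : ℝ × ℝ) := by
    filter_upwards [lx] with y hy
    rw [hy]; simp
  have vt := deriv_lift_line hd (m + m') p 0 (r + -m') (0 + s') ct t0 lt'
  have vx := deriv_lift_line hd (m + m') p 0 (r + -m') (0 + s') cx x0 lx'
  refine ⟨σt, σx, _, ct, cx, t0, x0, contDiff_testFun _ _ _ _ _ _ _, hs', lx', vt.1, vx.1, vx.2,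
    fun h1 h2 => ?_⟩
  have hw : HasFDerivAt (testFun q 0 m' 0 0 (-m') s')
      (fderiv ℝ (testFun q 0 m' 0 0 (-m') s') q) (σt 0) := by
    rw [t0]
    exact ((contDiff_testFun q 0 m' 0 0 (-m') s').differentiable (by simp) q).hasFDerivAt
  have := (hw.comp_hasDerivAt 0 (ct.differentiableAt (by simp)).hasDerivAt).deriv
  rw [fderiv_testFun] at this
  have h3 := h h1 h2
  have e : deriv (fun y => testFun q 0 m' 0 0 (-m') s' (σt y)) 0 = m' * (deriv σt 0).1 :=
    this.trans (by ring)
  rwa [e] at h3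

/-! ### First-order constraints on the new time and space variables. -/

section

variable {Ω : Set Base} {φ : Base → Base} {k f k' f' : ℝ → ℝ}

/-- The new time does not depend on `x` and `u`. -/
theorem tComp_partials_eq_zero (hc : CarriesEquation Ω φ k f k' f') {z : Base} (hz : z ∈ Ω)
    (hφ : ContDiffAt ℝ ∞ φ z) (hdet : (fderiv ℝ φ z).det ≠ 0) :
    Dx (tComp φ) z = 0 ∧ Du (tComp φ) z = 0 := by
  have key : ∀ m p : ℝ, graphJacobian φ z m p ≠ 0 → Dx (tComp φ) z + Du (tComp φ) z * p = 0 := by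
    intro m p hj
    -- The perturbation is `w = (t - t₀)³`. It forces the lifted `x'`-line to have zero
    -- `t`-velocity; its `x`-velocity is then nonzero while `t'` stays fixed.
    obtain ⟨σt, σx, u, -, cx, -, x0, -, -, -, -, h1, h2, h⟩ :=
      perturbation_testFun hc (q := (z.1, z.2.1)) (a := z.2.2) hz hφ hdet m p 0 1 hj (by simpa using hj)
    have c1 : ContDiffAt ℝ ∞ (fun y => (σx y).1 - z.1) 0 := cx.fst.sub contDiffAt_const
    obtain ⟨d1, d2, d3⟩ := derivs_cube c1 (by simp [x0]) 1
    have e : (fun y => testFun (z.1, z.2.1) 0 0 0 0 (-0) 1 (σx y))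
        = fun y => 1 * ((σx y).1 - z.1) ^ 3 := by
      funext y; simp [testFun]
    rw [e] at h
    have h3 := h d1 d2
    have e1 : deriv (fun y => (σx y).1 - z.1) 0 = (deriv σx 0).1 :=
      ((hasDerivAt_fst_snd (cx.differentiableAt (by simp)).hasDerivAt).1.sub_const _).deriv
    rw [d3, e1] at h3
    have h4 : (deriv σx 0).1 = 0 := by
      have : (deriv σx 0).1 ^ 3 = 0 := by linarith
      exact pow_eq_zero_iff (by norm_num) |>.1 this
    change _ * _ + (Dx (tComp φ) z + Du (tComp φ) z * p) * _ = 0 at h1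
    rw [h4] at h1 h2
    simp only [mul_zero, zero_add] at h1 h2
    rcases mul_eq_zero.1 h1 with h5 | h5
    · exact h5
    · rw [h5] at h2; simp at h2
  have prod : ∀ m p : ℝ, graphJacobian φ z m p * (Dx (tComp φ) z + Du (tComp φ) z * p) = 0 := by
    intro m p
    by_cases hj : graphJacobian φ z m p = 0
    · rw [hj, zero_mul]
    · rw [key m p hj, mul_zero]
  obtain ⟨ζ, a1, a2, -⟩ := exists_comps (hφ.differentiableAt (by simp)) hdet 1 0 0
  obtain ⟨η, b1, b2, -⟩ := exists_comps (hφ.differentiableAt (by simp)) hdet 0 1 0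
  simp only [graphJacobian] at prod
  generalize Dt (tComp φ) z = Tt at *
  generalize Dx (tComp φ) z = Tx at *
  generalize Du (tComp φ) z = Tu at *
  generalize Dt (xComp φ) z = Xt at *
  generalize Dx (xComp φ) z = Xx at *
  generalize Du (xComp φ) z = Xu at *
  by_contra hne
  -- Here the Jacobian vanishes for every `m`, and it is affine in `m`, so both coefficients vanish.
  -- Two such values of `p` annihilate all 2×2 minors of `(dT, dX)`, against nondegeneracy.
  have hP : ∀ p : ℝ, Tx + Tu * p ≠ 0 →
      (Tt * (Xx + Xu * p) - (Tx + Tu * p) * Xt = 0 ∧ Tu * Xx - Tx * Xu = 0) := by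
    intro p hp
    have h0 := (mul_eq_zero.1 (prod 0 p)).resolve_right hp
    have h1 := (mul_eq_zero.1 (prod 1 p)).resolve_right hp
    exact ⟨by linarith, by linarith⟩
  have two : ∃ p p' : ℝ, p ≠ p' ∧ Tx + Tu * p ≠ 0 ∧ Tx + Tu * p' ≠ 0 := by
    by_cases hTu : Tu = 0
    · subst hTu
      have : Tx ≠ 0 := fun h => hne ⟨h, rfl⟩
      exact ⟨0, 1, by norm_num, by simpa using this, by simpa using this⟩
    · refine ⟨(1 - Tx) / Tu, (2 - Tx) / Tu, ?_, ?_, ?_⟩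
      · intro h
        rw [div_left_inj' hTu] at h
        linarith
      · rw [mul_div_cancel₀ _ hTu]; norm_num
      · rw [mul_div_cancel₀ _ hTu]; norm_num
  obtain ⟨p, p', hpp, hp, hp'⟩ := two
  obtain ⟨e1, e2⟩ := hP p hp
  obtain ⟨e3, -⟩ := hP p' hp'
  have m1 : Tt * Xu - Tu * Xt = 0 := by
    have : (p - p') * (Tt * Xu - Tu * Xt) = 0 := by linear_combination e1 - e3
    exact (mul_eq_zero.1 this).resolve_left (sub_ne_zero.2 hpp)
  have m2 : Tt * Xx - Tx * Xt = 0 := by linear_combination e1 - p * m1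
  have : (1 : ℝ) = 0 := by
    have e4 : (ζ.1 * Tt + ζ.2.1 * Tx + ζ.2.2 * Tu) * (η.1 * Xt + η.2.1 * Xx + η.2.2 * Xu)
        - (η.1 * Tt + η.2.1 * Tx + η.2.2 * Tu) * (ζ.1 * Xt + ζ.2.1 * Xx + ζ.2.2 * Xu) = 0 := by
      linear_combination (ζ.1 * η.2.1 - η.1 * ζ.2.1) * m2 + (ζ.1 * η.2.2 - η.1 * ζ.2.2) * m1
        - (ζ.2.1 * η.2.2 - η.2.1 * ζ.2.2) * e2
    rw [a1, a2, b1, b2] at e4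
    simp at e4
  exact one_ne_zero this

theorem iteratedDeriv_three_congr_deriv {g h : ℝ → ℝ} {s : ℝ} (e : deriv g =ᶠ[𝓝 s] deriv h) :
    deriv g s = deriv h s ∧ deriv (deriv g) s = deriv (deriv h) s ∧
      iteratedDeriv 3 g s = iteratedDeriv 3 h s := by
  refine ⟨e.self_of_nhds, e.deriv_eq, ?_⟩
  rw [iteratedDeriv_succ', iteratedDeriv_succ' (f := h), e.iteratedDeriv_eq]

/-- The new space variable does not depend on `u`, and is scaled like the cube root of time. -/
theorem xComp_partials (hΩ : IsOpen Ω) (hc : CarriesEquation Ω φ k f k' f')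
    (hφ : ∀ z ∈ Ω, ContDiffAt ℝ ∞ φ z) (hdet : ∀ z ∈ Ω, (fderiv ℝ φ z).det ≠ 0)
    {z : Base} (hz : z ∈ Ω) :
    Du (xComp φ) z = 0 ∧ Dx (xComp φ) z ^ 3 = Dt (tComp φ) z ∧ Dx (xComp φ) z ≠ 0 := by
  have hT : ∀ z ∈ Ω, Dx (tComp φ) z = 0 ∧ Du (tComp φ) z = 0 := fun z hz =>
    tComp_partials_eq_zero hc hz (hφ z hz) (hdet z hz)
  have hTt : ∀ z ∈ Ω, Dt (tComp φ) z ≠ 0 := by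
    intro z hz h
    obtain ⟨ζ, a1, -, -⟩ := exists_comps ((hφ z hz).differentiableAt (by simp)) (hdet z hz) 1 0 0
    rw [h, (hT z hz).1, (hT z hz).2] at a1
    simp at a1
  have key : ∀ p : ℝ, Dx (xComp φ) z + Du (xComp φ) z * p ≠ 0 →
      (Dx (xComp φ) z + Du (xComp φ) z * p) ^ 3 = Dt (tComp φ) z := by
    intro p hp
    have hj : ∀ m, graphJacobian φ z m p ≠ 0 := by
      intro m
      simp only [graphJacobian, (hT z hz).1, (hT z hz).2, zero_mul, add_zero, sub_zero]
      exact mul_ne_zero (hTt z hz) hp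
    -- The perturbation is `w = (t - t₀) - (x - x₀)³ / 6`, which lies in the kernel of `∂_t + ∂_x³`.
    obtain ⟨σt, σx, u, -, cx, -, x0, hu, uq, l, h0, h1, h2, h⟩ :=
      perturbation_testFun hc (q := (z.1, z.2.1)) (a := z.2.2) hz (hφ z hz) (hdet z hz) 0 p 1 0
        (hj _) (hj _)
    change (Dt (tComp φ) z + Du (tComp φ) z * _) * _
      + (Dx (tComp φ) z + Du (tComp φ) z * p) * _ = 1 at h0
    change (Dt (tComp φ) z + Du (tComp φ) z * _) * _
      + (Dx (tComp φ) z + Du (tComp φ) z * p) * _ = 0 at h1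
    change (Dt (xComp φ) z + Du (xComp φ) z * _) * _
      + (Dx (xComp φ) z + Du (xComp φ) z * p) * _ = 1 at h2
    rw [(hT z hz).1, (hT z hz).2] at h0 h1
    simp only [zero_mul, add_zero] at h0 h1
    have τ0 : (deriv σx 0).1 = 0 := (mul_eq_zero.1 h1).resolve_left (hTt z hz)
    rw [τ0, mul_zero, zero_add] at h2
    have cz : ContDiffAt ℝ ∞ (fun y => (((σx y).1, (σx y).2, u (σx y)) : Base)) 0 :=
      cx.fst.prodMk (cx.snd.prodMk (hu.contDiffAt.comp _ cx))
    have z0 : (((σx 0).1, (σx 0).2, u (σx 0)) : Base) = z := by rw [x0, uq]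
    -- Near the point `T` varies with `t` only, and `T` is constant along `σx`, so `t` is constant
    -- there. The linear term of `w` therefore contributes nothing, and a pure cube remains.
    have τ' : ∀ᶠ y in 𝓝 (0 : ℝ), (deriv σx y).1 = 0 := by
      have hmem : ∀ᶠ y in 𝓝 (0 : ℝ), (((σx y).1, (σx y).2, u (σx y)) : Base) ∈ Ω :=
        cz.continuousAt.eventually_mem (by rw [z0]; exact hΩ.mem_nhds hz)
      filter_upwards [hmem, eventually_differentiableAt cx, l.eventually_nhds] with y hy1 hy2 hy3
      have hg : HasDerivAt (fun y => (((σx y).1, (σx y).2, u (σx y)) : Base))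
          ((deriv σx y).1, (deriv σx y).2, fderiv ℝ u (σx y) (deriv σx y)) y :=
        (hasDerivAt_fst_snd hy2.hasDerivAt).1.prodMk ((hasDerivAt_fst_snd hy2.hasDerivAt).2.prodMk
          ((hu.differentiable (by simp) _).hasFDerivAt.comp_hasDerivAt y hy2.hasDerivAt))
      have h3 := ((contDiffAt_comps (hφ _ hy1)).1.differentiableAt
        (by simp)).hasFDerivAt.comp_hasDerivAt y hg
      have h4 : HasDerivAt (fun _ : ℝ => (baseMap φ u (z.1, z.2.1)).1) 0 y := hasDerivAt_const _ _
      have h5 : (tComp φ ∘ fun y => (((σx y).1, (σx y).2, u (σx y)) : Base)) =ᶠ[𝓝 y]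
          fun _ : ℝ => (baseMap φ u (z.1, z.2.1)).1 := by
        filter_upwards [hy3] with s hs
        have := congrArg Prod.fst hs
        simpa [baseMap, tComp] using this
      have h6 := h3.unique (h4.congr_of_eventuallyEq h5)
      rw [fderiv_base_apply, (hT _ hy1).1, (hT _ hy1).2] at h6
      simp only [mul_zero, add_zero] at h6
      exact (mul_eq_zero.1 h6).resolve_right (hTt _ hy1)
    have c2 : ContDiffAt ℝ ∞ (fun y => (σx y).2 - z.2.1) 0 := cx.snd.sub contDiffAt_const
    obtain ⟨d1, d2, d3⟩ := derivs_cube c2 (by simp [x0]) (-1 / 6)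
    have e1 : deriv (fun y => (σx y).2 - z.2.1) 0 = (deriv σx 0).2 :=
      ((hasDerivAt_fst_snd (cx.differentiableAt (by simp)).hasDerivAt).2.sub_const _).deriv
    have e : deriv (fun y => testFun (z.1, z.2.1) 0 1 0 0 (-1) 0 (σx y)) =ᶠ[𝓝 0]
        deriv fun y => (-1 / 6) * ((σx y).2 - z.2.1) ^ 3 := by
      filter_upwards [τ', eventually_differentiableAt cx] with y hy1 hy2
      have g1 := (hasDerivAt_fst_snd hy2.hasDerivAt).1.sub_const z.1
      have g2 := (((hasDerivAt_fst_snd hy2.hasDerivAt).2.sub_const z.2.1).pow 3).const_mul (-1 / 6 : ℝ)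
      have g3 : (fun y => testFun (z.1, z.2.1) 0 1 0 0 (-1) 0 (σx y))
          = fun y => ((σx y).1 - z.1) + (-1 / 6) * ((σx y).2 - z.2.1) ^ 3 := by
        funext y; simp [testFun]; ring
      rw [g3]
      have g4 := (g1.add g2).deriv
      have g5 := g2.deriv
      simp only [hy1, zero_add] at g4
      exact g4.trans g5.symm
    obtain ⟨f1, f2, f3⟩ := iteratedDeriv_three_congr_deriv e
    have h3 := h (f1.trans d1) (f2.trans d2)
    rw [f3, d3, e1] at h3
    generalize (deriv σx 0).2 = ξ at *
    generalize (deriv σt 0).1 = τ at *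
    generalize Dx (xComp φ) z + Du (xComp φ) z * p = A at *
    have h4 : τ = ξ ^ 3 := by linarith
    calc A ^ 3 = A ^ 3 * (Dt (tComp φ) z * τ) := by rw [h0, mul_one]
      _ = Dt (tComp φ) z * (A * ξ) ^ 3 := by rw [h4]; ring
      _ = _ := by rw [h2]; ring
  -- With nonzero slope, `X_x + X_u p` would take the values 1 and 2, whose cubes would both equal
  -- `T_t`.
  have hXu : Du (xComp φ) z = 0 := by
    by_contra hne
    have k1 := key ((1 - Dx (xComp φ) z) / Du (xComp φ) z)
    have k2 := key ((2 - Dx (xComp φ) z) / Du (xComp φ) z)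
    rw [mul_div_cancel₀ _ hne] at k1 k2
    have k1' := k1 (by norm_num)
    have k2' := k2 (by norm_num)
    ring_nf at k1' k2'
    linarith
  have hXx : Dx (xComp φ) z ≠ 0 := by
    intro h
    obtain ⟨ζ, a1, a2, -⟩ := exists_comps ((hφ z hz).differentiableAt (by simp)) (hdet z hz) 0 1 0
    rw [(hT z hz).1, (hT z hz).2] at a1
    simp only [mul_zero, add_zero] at a1
    have := (mul_eq_zero.1 a1).resolve_right (hTt z hz)
    rw [this, h, hXu] at a2
    simp at a2
  have := key 0
  rw [mul_zero, add_zero] at this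
  exact ⟨hXu, this hXx, hXx⟩

end

/-! ### The determining identity. -/

theorem iteratedDeriv_comp_affine (n : ℕ) (g : ℝ → ℝ) (b a y : ℝ) :
    iteratedDeriv n (fun y => g (b + a * y)) y = a ^ n * iteratedDeriv n g (b + a * y) := by
  induction n generalizing y with
  | zero => simp
  | succ n ih =>
    rw [iteratedDeriv_succ, iteratedDeriv_succ, funext ih, deriv_const_mul_field,
      deriv_comp_mul_left a (fun s => iteratedDeriv n g (b + s)) y, deriv_comp_const_add,
      smul_eq_mul]
    ring

theorem eventually_eq_of_hasDerivAt_zero {g : ℝ → ℝ} {s : ℝ}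
    (h : ∀ᶠ y in 𝓝 s, HasDerivAt g 0 y) : ∀ᶠ y in 𝓝 s, g y = g s := by
  obtain ⟨ε, hε, hb⟩ := Metric.eventually_nhds_iff_ball.1 h
  filter_upwards [Metric.ball_mem_nhds s hε] with y hy
  exact Metric.isOpen_ball.is_const_of_deriv_eq_zero (convex_ball s ε).isPreconnected
    (fun x hx => (hb x hx).differentiableAt.differentiableWithinAt) (fun x hx => (hb x hx).deriv)
    hy (Metric.mem_ball_self hε)

section

variable {Ω : Set Base} {φ : Base → Base} {k f k' f' : ℝ → ℝ}

/-- The second derivatives of the new space variable. -/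
theorem xComp_second_partials (hΩ : IsOpen Ω) (hc : CarriesEquation Ω φ k f k' f')
    (hφ : ∀ z ∈ Ω, ContDiffAt ℝ ∞ φ z) (hdet : ∀ z ∈ Ω, (fderiv ℝ φ z).det ≠ 0)
    {z : Base} (hz : z ∈ Ω) : Dx (Dx (xComp φ)) z = 0 ∧ Du (Dx (xComp φ)) z = 0 := by
  have hX := fun z hz => xComp_partials hΩ hc hφ hdet (z := z) hz
  have hT := fun z hz => tComp_partials_eq_zero hc (z := z) hz (hφ z hz) (hdet z hz)
  obtain ⟨cT, cX, -⟩ := contDiffAt_comps (hφ z hz)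
  constructor
  · have d := (contDiffAt_dir ((0, 1, 0) : Base) cX).differentiableAt (by simp)
    -- Differentiate `X_x³ = T_t` in `x`, using `T_tx = 0`.
    have h1 : Dx (Dt (tComp φ)) z = 0 := by
      rw [Dx, Dt, dir_comm _ _ cT]
      exact dir_eq_zero hΩ _ (fun y hy => (hT y hy).1) hz
    have h2 : Dx (Dt (tComp φ)) z
        = Dx (fun y => Dx (xComp φ) y * (Dx (xComp φ) y * Dx (xComp φ) y)) z := by
      refine dir_congr _ ?_
      filter_upwards [hΩ.mem_nhds hz] with y hy
      rw [← (hX y hy).2.1]; ring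
    rw [h1] at h2
    have h3 : Dx (fun y => Dx (xComp φ) y * (Dx (xComp φ) y * Dx (xComp φ) y)) z
        = 3 * Dx (xComp φ) z ^ 2 * Dx (Dx (xComp φ)) z := by
      have e1 := dir_mul ((0, 1, 0) : Base) d (d.mul d)
      have e2 := dir_mul ((0, 1, 0) : Base) d d
      change Dx (fun y => Dx (xComp φ) y * (Dx (xComp φ) y * Dx (xComp φ) y)) z
        = Dx (Dx (xComp φ)) z * (Dx (xComp φ) z * Dx (xComp φ) z)
          + Dx (xComp φ) z * Dx (fun y => Dx (xComp φ) y * Dx (xComp φ) y) z at e1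
      change Dx (fun y => Dx (xComp φ) y * Dx (xComp φ) y) z
        = Dx (Dx (xComp φ)) z * Dx (xComp φ) z + Dx (xComp φ) z * Dx (Dx (xComp φ)) z at e2
      rw [e1, e2]; ring
    rw [h3] at h2
    have h4 := (hX z hz).2.2
    exact (mul_eq_zero.1 h2.symm).resolve_left (by positivity)
  · rw [Du, Dx, dir_comm _ _ cX]
    exact dir_eq_zero hΩ _ (fun y hy => (hX y hy).1) hz

/-- The equation for the components of the transformation, along a test function. -/
theorem determining_identity (hΩ : IsOpen Ω) (hc : CarriesEquation Ω φ k f k' f')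
    (hφ : ∀ z ∈ Ω, ContDiffAt ℝ ∞ φ z) (hdet : ∀ z ∈ Ω, (fderiv ℝ φ z).det ≠ 0)
    {z : Base} (hz : z ∈ Ω) (p c : ℝ) :
    Dt (uComp φ) z - Du (uComp φ) z * ((k z.1 * z.2.2 + f z.1 * z.2.2 ^ 2) * p)
      - Dt (xComp φ) z / Dx (xComp φ) z * (Dx (uComp φ) z + Du (uComp φ) z * p)
      + Dx (xComp φ) z ^ 2
        * (k' (tComp φ z) * uComp φ z + f' (tComp φ z) * uComp φ z ^ 2)
        * (Dx (uComp φ) z + Du (uComp φ) z * p)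
      + (Dx (Dx (Dx (uComp φ))) z + Du (Dx (Dx (uComp φ))) z * p
        + (Dx (Du (Dx (uComp φ))) z + Du (Du (Dx (uComp φ))) z * p) * p
        + (Dx (Dx (Du (uComp φ))) z + Du (Dx (Du (uComp φ))) z * p
          + (Dx (Du (Du (uComp φ))) z + Du (Du (Du (uComp φ))) z * p) * p) * p
        + (Du (Dx (uComp φ)) z + 2 * Dx (Du (uComp φ)) z + 3 * Du (Du (uComp φ)) z * p) * c)
      = 0 := by
  obtain ⟨Xu, Xx3, Xx⟩ := xComp_partials hΩ hc hφ hdet hz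
  obtain ⟨Tx, Tu⟩ := tComp_partials_eq_zero hc hz (hφ z hz) (hdet z hz)
  obtain ⟨cT, cX, cU⟩ := contDiffAt_comps (hφ z hz)
  set q : ℝ × ℝ := (z.1, z.2.1) with hq
  set a : ℝ := z.2.2 with ha
  have hza : (q.1, q.2, a) = z := rfl
  -- With `u_xxx = 0`, this `u_t` satisfies the source equation, while `u_x = p` and `u_xx = c` stay
  -- free.
  set m : ℝ := -((k z.1 * a + f z.1 * a ^ 2) * p) with hm
  set u := testFun q a m p c 0 0 with hu
  have uc : ContDiff ℝ ∞ u := contDiff_testFun _ _ _ _ _ _ _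
  have uq : u q = a := testFun_self _ _ _ _ _ _ _
  have zq : (q.1, q.2, u q) = z := by rw [uq]
  have hd := (hφ z hz).differentiableAt (by simp)
  have cA : ContDiffAt ℝ ∞ (baseMap φ u) q := by
    have h1 : ContDiffAt ℝ ∞ (fun y : ℝ × ℝ => φ (y.1, y.2, u y)) q :=
      ContDiffAt.comp (g := φ) q (by rw [zq]; exact hφ z hz) (contDiffAt_graph uc.contDiffAt)
    exact h1.fst.prodMk h1.snd.fst
  have hA0 : baseMap φ u q = (tComp φ z, xComp φ z) := by
    simp only [baseMap, zq]; rfl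
  obtain ⟨S, hS, S0, SL, -⟩ := exists_local_inverse cA (fun v =>
    baseMap_testFun_injective (a := a) hd m p c 0 0 (by
      rw [hza, Tx, Tu, Xu, ← Xx3]
      simpa using Xx) v)
  set v : ℝ × ℝ → ℝ := fun y => uComp φ ((S y).1, (S y).2, u (S y)) with hv
  have cv : ContDiffAt ℝ ∞ v (baseMap φ u q) := by
    refine ContDiffAt.comp (g := uComp φ) _ ?_ (hS.fst.prodMk (hS.snd.prodMk (uc.contDiffAt.comp _ hS)))
    rw [S0, zq]; exact cU
  have vA : ∀ᶠ y in 𝓝 q, v (baseMap φ u y) = uComp φ (y.1, y.2, u y) := by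
    filter_upwards [SL] with y hy
    simp only [hv, hy]
  have hl : lhs k' f' (fun s y => v (s, y)) (tComp φ z) (xComp φ z) = 0 := by
    have := (hc (fun s y => u (s, y)) (fun s y => v (s, y)) q.1 q.2
      (by change (q.1, q.2, u q) ∈ Ω; rwa [zq]) uc.contDiffAt cv vA).1
      (by rw [hu, lhs_testFun]; simp [hm, hq])
    change lhs k' f' (fun s y => v (s, y)) (baseMap φ u q).1 (baseMap φ u q).2 = 0 at this
    rwa [hA0] at this
  have v0 : v (tComp φ z, xComp φ z) = uComp φ z := by
    have := vA.self_of_nhds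
    rwa [hA0, zq] at this
  rw [hA0] at cv
  have vd := cv.differentiableAt (by simp)
  have vT : HasDerivAt (fun s => v (s, xComp φ z)) (fderiv ℝ v (tComp φ z, xComp φ z) (1, 0))
      (tComp φ z) :=
    vd.hasFDerivAt.comp_hasDerivAt _ (f := fun s : ℝ => (s, xComp φ z))
      ((hasDerivAt_id _).prodMk (hasDerivAt_const _ _))
  have vX : HasDerivAt (fun s => v (tComp φ z, s)) (fderiv ℝ v (tComp φ z, xComp φ z) (0, 1))
      (xComp φ z) :=
    vd.hasFDerivAt.comp_hasDerivAt _ (f := fun s : ℝ => (tComp φ z, s))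
      ((hasDerivAt_const _ _).prodMk (hasDerivAt_id _))
  -- The `t`-derivative of `v (T, X) = U` along the graph, simplified by `T_u = X_u = 0`.
  have tm : Dt (tComp φ) z * fderiv ℝ v (tComp φ z, xComp φ z) (1, 0)
      + Dt (xComp φ) z * fderiv ℝ v (tComp φ z, xComp φ z) (0, 1)
      = Dt (uComp φ) z + Du (uComp φ) z * m := by
    have e1 : fderiv ℝ (fun y => v (baseMap φ u y)) q (1, 0)
        = fderiv ℝ (fun y : ℝ × ℝ => uComp φ (y.1, y.2, u y)) q (1, 0) := by
      rw [EventuallyEq.fderiv_eq vA]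
    rw [fderiv_comp_graph uc.contDiffAt (by rw [zq]; exact cU.differentiableAt (by simp)), zq,
      hu, fderiv_testFun, fderiv_base_apply, ← hu] at e1
    have hvd : HasFDerivAt v (fderiv ℝ v (tComp φ z, xComp φ z)) (baseMap φ u q) := by
      rw [hA0]; exact vd.hasFDerivAt
    have e2 : fderiv ℝ (fun y => v (baseMap φ u y)) q = _ :=
      (hvd.comp q (cA.differentiableAt (by simp)).hasFDerivAt).fderiv
    rw [e2, ContinuousLinearMap.comp_apply,
      fderiv_baseMap uc.contDiffAt (by rw [zq]; exact hd), zq, hu, fderiv_testFun,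
      fderiv_base_apply, fderiv_base_apply, Tx, Tu, Xu] at e1
    have e3 : (((1 : ℝ) * Dt (tComp φ) z, (1 : ℝ) * Dt (xComp φ) z) : ℝ × ℝ)
        = Dt (tComp φ) z • ((1, 0) : ℝ × ℝ) + Dt (xComp φ) z • ((0, 1) : ℝ × ℝ) := by
      ext <;> simp
    simp only [mul_zero, add_zero, zero_mul, mul_one] at e1
    rw [e3, map_add, map_smul, map_smul, smul_eq_mul, smul_eq_mul] at e1
    linarith
  set w : ℝ → ℝ := fun y => u (q.1, q.2 + y) with hw
  have ws : ∀ y, HasDerivAt w (p + c * y) y := by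
    intro y
    have := (hasDerivAt_testFun_snd q a m p c 0 0 (q.2 + y)).comp_const_add q.2 y
    refine this.congr_deriv ?_
    simp
  have w2 : ∀ y : ℝ, HasDerivAt (fun y => p + c * y) c y := by
    intro y
    simpa using ((hasDerivAt_id y).const_mul c).const_add p
  have w0 : w 0 = a := by simp [hw]; exact uq
  have cur : ∀ y : ℝ, ((q.1, q.2, 0) : Base) + y • ((0, 1, 0) : Base) + w y • ((0, 0, 1) : Base)
      = (q.1, q.2 + y, u (q.1, q.2 + y)) := by
    intro y
    ext <;> simp [hw]
  have cur0 : ((q.1, q.2, 0) : Base) + w 0 • ((0, 0, 1) : Base) = z := by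
    have := cur 0
    rw [zero_smul, add_zero] at this
    rw [this, add_zero]; exact zq
  obtain ⟨s1, s3⟩ := derivs_comp_shear (F := uComp φ) (c := ((q.1, q.2, 0) : Base))
    (a := ((0, 1, 0) : Base)) (b := ((0, 0, 1) : Base)) (w := w) (w1 := fun y => p + c * y)
    (w2 := fun _ => c) (w3 := 0) (by rw [cur0]; exact cU) (Eventually.of_forall ws)
    (Eventually.of_forall w2) (hasDerivAt_const _ _)
  have tend : Tendsto (fun y : ℝ => ((q.1, q.2, 0) : Base) + y • ((0, 1, 0) : Base)
      + w y • ((0, 0, 1) : Base)) (𝓝 0) (𝓝 z) := by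
    have hwc : Continuous w := continuous_iff_continuousAt.2 fun y => (ws y).continuousAt
    have : Continuous (fun y : ℝ => ((q.1, q.2, 0) : Base) + y • ((0, 1, 0) : Base)
      + w y • ((0, 0, 1) : Base)) := by fun_prop
    have h := this.tendsto 0
    rwa [zero_smul, add_zero, cur0] at h
  have mem := tend.eventually (hΩ.mem_nhds hz)
  have shear : ∀ g : Base → ℝ, (∀ y ∈ Ω, DifferentiableAt ℝ g y) →
      ∀ᶠ y : ℝ in 𝓝 0, HasDerivAt (fun y : ℝ => g (((q.1, q.2, 0) : Base) + y • ((0, 1, 0) : Base)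
      + w y • ((0, 0, 1) : Base)))
        (Dx g (((q.1, q.2, 0) : Base) + y • ((0, 1, 0) : Base) + w y • ((0, 0, 1) : Base))
        + Du g (((q.1, q.2, 0) : Base) + y • ((0, 1, 0) : Base) + w y • ((0, 0, 1) : Base))
          * (p + c * y)) y := by
    intro g hg
    filter_upwards [mem] with y hy using hasDerivAt_comp_shear (hg _ hy) (ws y)
  -- On the slice of fixed `t` of the graph, `T` is constant and `X` is affine in `x` with slope
  -- `X_x`. Hence `x'`-derivatives of the image are `x`-derivatives divided by powers of `X_x`.
  have lineT := eventually_eq_of_hasDerivAt_zero (by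
    filter_upwards [mem, shear (tComp φ) fun y hy =>
      (contDiffAt_comps (hφ y hy)).1.differentiableAt (by simp)] with y hy h
    obtain ⟨h1, h2⟩ := tComp_partials_eq_zero hc hy (hφ _ hy) (hdet _ hy)
    exact h.congr_deriv (by rw [h1, h2]; ring))
  have lineXx := eventually_eq_of_hasDerivAt_zero (by
    filter_upwards [mem, shear (Dx (xComp φ)) fun y hy =>
      (contDiffAt_dir _ (contDiffAt_comps (hφ y hy)).2.1).differentiableAt (by simp)] with y hy h
    obtain ⟨h1, h2⟩ := xComp_second_partials hΩ hc hφ hdet hy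
    exact h.congr_deriv (by rw [h1, h2]; ring))
  simp only [zero_smul, add_zero, cur0] at lineT lineXx
  have lineX := eventually_eq_of_hasDerivAt_zero (g := fun y : ℝ =>
      xComp φ (((q.1, q.2, 0) : Base) + y • ((0, 1, 0) : Base) + w y • ((0, 0, 1) : Base))
        - Dx (xComp φ) z * y) (s := 0) (by
    filter_upwards [mem, lineXx, shear (xComp φ) fun y hy =>
      (contDiffAt_comps (hφ y hy)).2.1.differentiableAt (by simp)] with y hy h1 h
    refine (h.sub ((hasDerivAt_id y).const_mul _)).congr_deriv ?_
    rw [h1, (xComp_partials hΩ hc hφ hdet hy).1]; ring)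
  simp only [zero_smul, add_zero, cur0, mul_zero, sub_zero] at lineX
  have tq : Tendsto (fun y : ℝ => (q.1, q.2 + y)) (𝓝 0) (𝓝 q) := by
    have : Continuous (fun y : ℝ => (q.1, q.2 + y)) := by fun_prop
    simpa using this.tendsto 0
  have ev : (fun y : ℝ => v (tComp φ z, xComp φ z + Dx (xComp φ) z * y)) =ᶠ[𝓝 0] fun y =>
      uComp φ (((q.1, q.2, 0) : Base) + y • ((0, 1, 0) : Base) + w y • ((0, 0, 1) : Base)) := by
    filter_upwards [lineT, lineX, tq.eventually vA] with y h1 h2 h3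
    rw [cur] at h1 h2 ⊢
    rw [← h3]
    change _ = v (tComp φ _, xComp φ _)
    simp only
    rw [h1, sub_eq_iff_eq_add.1 h2]
  have D1 : Dx (xComp φ) z * fderiv ℝ v (tComp φ z, xComp φ z) (0, 1)
      = Dx (uComp φ) z + Du (uComp φ) z * p := by
    have e := ev.deriv_eq
    rw [s1, cur0] at e
    have e' := iteratedDeriv_comp_affine 1 (fun s => v (tComp φ z, s)) (xComp φ z)
      (Dx (xComp φ) z) 0
    simp only [iteratedDeriv_one, pow_one, mul_zero, add_zero] at e'
    rw [vX.deriv] at e'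
    rw [← e', e]
    simp only [mul_zero, add_zero]; rfl
  have D3 := iteratedDeriv_comp_affine 3 (fun s => v (tComp φ z, s)) (xComp φ z)
      (Dx (xComp φ) z) 0
  rw [ev.iteratedDeriv_eq 3, s3, cur0] at D3
  simp only [mul_zero, add_zero] at D3
  simp only [lhs] at hl
  rw [vT.deriv, vX.deriv, v0] at hl
  rw [Xx3.symm] at tm
  have g1 : fderiv ℝ v (tComp φ z, xComp φ z) (0, 1)
      = (Dx (uComp φ) z + Du (uComp φ) z * p) / Dx (xComp φ) z := by
    rw [← D1, mul_div_cancel_left₀ _ Xx]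
  change Dx (Dx (Dx (uComp φ))) z + Du (Dx (Dx (uComp φ))) z * p
        + (Dx (Du (Dx (uComp φ))) z + Du (Du (Dx (uComp φ))) z * p) * p
        + (Dx (Dx (Du (uComp φ))) z + Du (Dx (Du (uComp φ))) z * p
          + (Dx (Du (Du (uComp φ))) z + Du (Du (Du (uComp φ))) z * p) * p) * p
        + (Du (Dx (uComp φ)) z + 2 * Dx (Du (uComp φ)) z + 3 * Du (Du (uComp φ)) z * p) * c
        = _ at D3
  rw [D3]
  rw [hm] at tm
  have tm' : Dx (xComp φ) z ^ 3 * fderiv ℝ v (tComp φ z, xComp φ z) (1, 0)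
      = Dt (uComp φ) z - Du (uComp φ) z * ((k z.1 * a + f z.1 * a ^ 2) * p)
        - Dt (xComp φ) z / Dx (xComp φ) z * (Dx (uComp φ) z + Du (uComp φ) z * p) := by
    rw [g1] at tm
    have : Dt (xComp φ) z / Dx (xComp φ) z * (Dx (uComp φ) z + Du (uComp φ) z * p)
      = Dt (xComp φ) z * ((Dx (uComp φ) z + Du (uComp φ) z * p) / Dx (xComp φ) z) := by ring
    rw [this]
    linarith
  rw [← tm', ← D1]
  -- The identity is the target equation multiplied by `X_x³ = T_t`.
  linear_combination Dx (xComp φ) z ^ 3 * hl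

end

/-! ### Functions along short lines, and the determining equations. -/

section Line

variable {E : Type*} [NormedAddCommGroup E] [NormedSpace ℝ E] {Ω : Set E}

theorem eventually_line_mem (hΩ : IsOpen Ω) {z : E} (hz : z ∈ Ω) (v : E) :
    ∀ᶠ s : ℝ in 𝓝 0, z + s • v ∈ Ω := by
  have : Continuous fun s : ℝ => z + s • v := by fun_prop
  exact this.continuousAt.eventually_mem (by simpa using hΩ.mem_nhds hz)

theorem hasDerivAt_line {g : E → ℝ} {z v : E} {s : ℝ} (hg : DifferentiableAt ℝ g (z + s • v)) :
    HasDerivAt (fun s : ℝ => g (z + s • v)) (dir v g (z + s • v)) s := by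
  have h : HasDerivAt (fun s : ℝ => z + s • v) v s := by
    simpa using ((hasDerivAt_id s).smul_const v).const_add z
  exact hg.hasFDerivAt.comp_hasDerivAt s h

theorem eventually_line_const (hΩ : IsOpen Ω) {g : E → ℝ} (v : E)
    (hg : ∀ z ∈ Ω, DifferentiableAt ℝ g z) (h0 : ∀ z ∈ Ω, dir v g z = 0) {z : E} (hz : z ∈ Ω) :
    ∀ᶠ s : ℝ in 𝓝 0, g (z + s • v) = g z := by
  have := eventually_eq_of_hasDerivAt_zero (g := fun s : ℝ => g (z + s • v)) (s := 0) (by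
    filter_upwards [eventually_line_mem hΩ hz v] with s hs
    exact (hasDerivAt_line (hg _ hs)).congr_deriv (h0 _ hs))
  simpa using this

theorem eventually_line_affine (hΩ : IsOpen Ω) {g : E → ℝ} (v : E)
    (hg : ∀ z ∈ Ω, DifferentiableAt ℝ g z) (hg' : ∀ z ∈ Ω, DifferentiableAt ℝ (dir v g) z)
    (h0 : ∀ z ∈ Ω, dir v (dir v g) z = 0) {z : E} (hz : z ∈ Ω) :
    ∀ᶠ s : ℝ in 𝓝 0, g (z + s • v) = g z + s * dir v g z := by
  have := eventually_eq_of_hasDerivAt_zero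
    (g := fun s : ℝ => g (z + s • v) - s * dir v g z) (s := 0) (by
    filter_upwards [eventually_line_mem hΩ hz v, eventually_line_const hΩ v hg' h0 hz] with s hs h
    refine ((hasDerivAt_line (hg _ hs)).sub ((hasDerivAt_id s).mul_const _)).congr_deriv ?_
    rw [h]; ring)
  filter_upwards [this] with s hs
  simp at hs
  linarith

end Line

/-- Three values near zero determine a quadratic polynomial. This allows powers of `u` to be
compared on arbitrarily short segments inside `Ω`. -/
theorem quadratic_coeffs_eq_zero {a b c : ℝ} (h : ∀ᶠ s : ℝ in 𝓝 0, a + b * s + c * s ^ 2 = 0) :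
    a = 0 ∧ b = 0 ∧ c = 0 := by
  obtain ⟨ε, hε, hb⟩ := Metric.eventually_nhds_iff_ball.1 h
  have h0 := hb 0 (by simpa using hε)
  have h1 := hb (ε / 2) (by simp [abs_of_pos hε]; linarith)
  have h2 := hb (-(ε / 2)) (by simp [abs_of_pos hε]; linarith)
  have ha : a = 0 := by simpa using h0
  have hbz : b * ε = 0 := by linarith
  have hcz : c * ε ^ 2 = 0 := by nlinarith
  exact ⟨ha, (mul_eq_zero.1 hbz).resolve_right hε.ne', (mul_eq_zero.1 hcz).resolve_right (by positivity)⟩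

theorem exists_const_of_partials {Ω : Set Base} (hΩ : IsOpen Ω) (hconn : IsPreconnected Ω)
    {g : Base → ℝ} (hg : ∀ z ∈ Ω, DifferentiableAt ℝ g z)
    (h : ∀ z ∈ Ω, Dt g z = 0 ∧ Dx g z = 0 ∧ Du g z = 0) : ∃ c, ∀ z ∈ Ω, g z = c := by
  refine hΩ.exists_is_const_of_fderiv_eq_zero hconn
    (fun z hz => (hg z hz).differentiableWithinAt) fun z hz => ?_
  refine ContinuousLinearMap.ext fun ζ => ?_
  obtain ⟨h1, h2, h3⟩ := h z hz
  rw [fderiv_base_apply, h1, h2, h3]; simp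

theorem exists_antiderivative {I : Set ℝ} (hI : IsOpen I) (hI' : I.OrdConnected) {g : ℝ → ℝ}
    (hg : ContinuousOn g I) : ∃ γ : ℝ → ℝ, ∀ t ∈ I, HasDerivAt γ (g t) t := by
  rcases I.eq_empty_or_nonempty with rfl | ⟨t0, ht0⟩
  · exact ⟨0, by simp⟩
  · refine ⟨fun t => ∫ s in t0..t, g s, fun t ht => ?_⟩
    refine intervalIntegral.integral_hasDerivAt_right
      (ContinuousOn.intervalIntegrable (hg.mono (hI'.uIcc_subset ht0 ht)))
      (hg.stronglyMeasurableAtFilter hI t ht) (hg.continuousAt (hI.mem_nhds ht))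

section

variable {Ω : Set Base} {φ : Base → Base} {k f k' f' : ℝ → ℝ}

/-- The determining equations for the components of the transformation. -/
theorem determining_equations (hΩ : IsOpen Ω) (hc : CarriesEquation Ω φ k f k' f')
    (hφ : ∀ z ∈ Ω, ContDiffAt ℝ ∞ φ z) (hdet : ∀ z ∈ Ω, (fderiv ℝ φ z).det ≠ 0)
    (hf : ∀ z ∈ Ω, f z.1 ≠ 0) {z : Base} (hz : z ∈ Ω) :
    Du (uComp φ) z ≠ 0 ∧ Du (Du (uComp φ)) z = 0 ∧ Dx (Du (uComp φ)) z = 0 ∧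
      Dx (uComp φ) z = 0 ∧ Dt (uComp φ) z = 0 ∧
      Dt (xComp φ) z = Dx (xComp φ) z * (Dx (xComp φ) z ^ 2
        * (k' (tComp φ z) * uComp φ z + f' (tComp φ z) * uComp φ z ^ 2)
        - (k z.1 * z.2.2 + f z.1 * z.2.2 ^ 2)) := by
  have cU := fun z hz => (contDiffAt_comps (hφ z hz)).2.2
  have diff : ∀ {g : Base → ℝ} {z}, ContDiffAt ℝ ∞ g z → DifferentiableAt ℝ g z :=
    fun h => h.differentiableAt (by simp)
  -- These are the coefficients of `u_xx` and `u_x u_xx`, which are `3 U_xu` and `3 U_uu`.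
  have second : ∀ z ∈ Ω, Du (Du (uComp φ)) z = 0 ∧ Dx (Du (uComp φ)) z = 0 ∧
      Du (Dx (uComp φ)) z = 0 := by
    intro z hz
    have hcomm : Du (Dx (uComp φ)) z = Dx (Du (uComp φ)) z := dir_comm _ _ (cU z hz)
    have i00 := determining_identity hΩ hc hφ hdet hz 0 0
    have i01 := determining_identity hΩ hc hφ hdet hz 0 1
    have i10 := determining_identity hΩ hc hφ hdet hz 1 0
    have i11 := determining_identity hΩ hc hφ hdet hz 1 1
    have e1 : Dx (Du (uComp φ)) z = 0 := by linarith
    have e2 : Du (Du (uComp φ)) z = 0 := by linarith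
    exact ⟨e2, e1, by rw [hcomm, e1]⟩
  have third : ∀ z ∈ Ω, Du (Dx (Dx (uComp φ))) z = 0 := by
    intro z hz
    rw [Du, Dx, dir_comm (g := Dx (uComp φ)) _ _ (contDiffAt_dir _ (cU z hz))]
    exact dir_eq_zero hΩ _ (fun y hy => (second y hy).2.2) hz
  have zero : ∀ z ∈ Ω, Dx (Du (Dx (uComp φ))) z = 0 ∧ Du (Du (Dx (uComp φ))) z = 0 ∧
      Dx (Dx (Du (uComp φ))) z = 0 ∧ Du (Dx (Du (uComp φ))) z = 0 ∧
      Dx (Du (Du (uComp φ))) z = 0 ∧ Du (Du (Du (uComp φ))) z = 0 := fun z hz =>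
    ⟨dir_eq_zero hΩ _ (fun y hy => (second y hy).2.2) hz,
      dir_eq_zero hΩ _ (fun y hy => (second y hy).2.2) hz,
      dir_eq_zero hΩ _ (fun y hy => (second y hy).2.1) hz,
      dir_eq_zero hΩ _ (fun y hy => (second y hy).2.1) hz,
      dir_eq_zero hΩ _ (fun y hy => (second y hy).1) hz,
      dir_eq_zero hΩ _ (fun y hy => (second y hy).1) hz⟩
  have Uu : ∀ z ∈ Ω, Du (uComp φ) z ≠ 0 := by
    intro z hz h
    obtain ⟨Xu, Xx3, Xx⟩ := xComp_partials hΩ hc hφ hdet hz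
    obtain ⟨Tx, Tu⟩ := tComp_partials_eq_zero hc hz (hφ z hz) (hdet z hz)
    obtain ⟨ζ, a1, a2, a3⟩ := exists_comps ((hφ z hz).differentiableAt (by simp)) (hdet z hz) 0 0 1
    rw [Tx, Tu, ← Xx3] at a1
    simp only [mul_zero, add_zero] at a1
    have b1 := (mul_eq_zero.1 a1).resolve_right (pow_ne_zero 3 Xx)
    rw [b1, Xu] at a2
    simp only [zero_mul, zero_add, mul_zero, add_zero] at a2
    rw [b1, (mul_eq_zero.1 a2).resolve_right Xx, h] at a3
    simp at a3
  -- The third-order terms with a `u`-derivative are gone, so the identity is affine in `p`. The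
  -- slope is divisible by `U_u ≠ 0` and gives the first relation; inserting it in the constant term
  -- gives the second.
  have split : ∀ z ∈ Ω, Dx (xComp φ) z ^ 2
        * (k' (tComp φ z) * uComp φ z + f' (tComp φ z) * uComp φ z ^ 2)
        = k z.1 * z.2.2 + f z.1 * z.2.2 ^ 2 + Dt (xComp φ) z / Dx (xComp φ) z ∧
      Dt (uComp φ) z + (k z.1 * z.2.2 + f z.1 * z.2.2 ^ 2) * Dx (uComp φ) z
        + Dx (Dx (Dx (uComp φ))) z = 0 := by
    intro z hz
    obtain ⟨z1, z2, z3, z4, z5, z6⟩ := zero z hz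
    have i0 := determining_identity hΩ hc hφ hdet hz 0 0
    have i1 := determining_identity hΩ hc hφ hdet hz 1 0
    rw [third z hz, z1, z2, z3, z4, z5, z6] at i0 i1
    have e1 : Du (uComp φ) z * (Dx (xComp φ) z ^ 2
        * (k' (tComp φ z) * uComp φ z + f' (tComp φ z) * uComp φ z ^ 2)
        - (k z.1 * z.2.2 + f z.1 * z.2.2 ^ 2 + Dt (xComp φ) z / Dx (xComp φ) z)) = 0 := by
      linear_combination i1 - i0
    have e2 := sub_eq_zero.1 ((mul_eq_zero.1 e1).resolve_left (Uu z hz))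
    refine ⟨e2, ?_⟩
    linear_combination i0 - Dx (uComp φ) z * e2
  -- Along `u`-lines `U_t` is affine and `U_x`, `U_xxx` are constant, so the second relation of
  -- `split` is quadratic in `u` with leading coefficient `f U_x`.
  have Ux : ∀ z ∈ Ω, Dx (uComp φ) z = 0 := by
    intro z hz
    have l1 := eventually_line_affine hΩ (g := Dt (uComp φ)) ((0, 0, 1) : Base)
      (fun z hz => diff (contDiffAt_dir _ (cU z hz)))
      (fun z hz => diff (contDiffAt_dir _ (contDiffAt_dir _ (cU z hz)))) (by
        intro z hz
        rw [dir_congr (h := Dt (Du (uComp φ))) _ (by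
          filter_upwards [hΩ.mem_nhds hz] with y hy using dir_comm _ _ (cU y hy))]
        rw [Dt, dir_comm (g := Du (uComp φ)) _ _ (contDiffAt_dir _ (cU z hz))]
        exact dir_eq_zero hΩ _ (fun y hy => (second y hy).1) hz) hz
    have l2 := eventually_line_const hΩ (g := Dx (uComp φ)) ((0, 0, 1) : Base)
      (fun z hz => diff (contDiffAt_dir _ (cU z hz))) (fun z hz => (second z hz).2.2) hz
    have l3 := eventually_line_const hΩ (g := Dx (Dx (Dx (uComp φ)))) ((0, 0, 1) : Base)
      (fun z hz => diff (contDiffAt_dir _ (contDiffAt_dir _ (contDiffAt_dir _ (cU z hz)))))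
      (by
        intro z hz
        rw [Dx, dir_comm (g := Dx (Dx (uComp φ))) _ _
          (contDiffAt_dir _ (contDiffAt_dir _ (cU z hz)))]
        exact dir_eq_zero hΩ _ third hz) hz
    have l4 := quadratic_coeffs_eq_zero
      (a := Dt (uComp φ) z + (k z.1 * z.2.2 + f z.1 * z.2.2 ^ 2) * Dx (uComp φ) z
        + Dx (Dx (Dx (uComp φ))) z)
      (b := Du (Dt (uComp φ)) z + (k z.1 + 2 * f z.1 * z.2.2) * Dx (uComp φ) z)
      (c := f z.1 * Dx (uComp φ) z) (by
        filter_upwards [l1, l2, l3, eventually_line_mem hΩ hz (0, 0, 1)] with s h1 h2 h3 h4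
        have h5 := (split _ h4).2
        rw [h1, h2, h3] at h5
        simp only [Prod.fst_add, Prod.snd_add, Prod.smul_fst, Prod.smul_snd, smul_eq_mul,
          mul_zero, add_zero, mul_one] at h5
        change Dt (uComp φ) z + s * Du (Dt (uComp φ)) z + _ + _ = _ at h5
        linear_combination h5)
    exact (mul_eq_zero.1 l4.2.2).resolve_left (hf z hz)
  have Xx := (xComp_partials hΩ hc hφ hdet hz).2.2
  refine ⟨Uu z hz, (second z hz).1, (second z hz).2.1, Ux z hz, ?_, ?_⟩
  · have h1 := (split z hz).2
    have h2 : Dx (Dx (Dx (uComp φ))) z = 0 :=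
      dir_eq_zero hΩ _ (fun y hy => dir_eq_zero hΩ _ (fun w hw => Ux w hw) hy) hz
    rw [Ux z hz, h2] at h1
    linarith
  · rw [(split z hz).1]
    field_simp
    ring

end

/-! ### The general form of an admissible transformation. -/

/-- An admissible transformation on a connected open set has the form stated in the theorem. -/
theorem IsAdmissible.exists_form {Ω : Set Base} {φ : Base → Base} {I I' : Set ℝ}
    {k f k' f' : ℝ → ℝ} (hΩ : IsOpen Ω) (hconn : IsConnected Ω)
    (h : IsAdmissible Ω φ I k f I' k' f') :
    ∃ (δ₀ δ₁ δ₂ δ₃ δ₄ : ℝ) (γ : ℝ → ℝ), δ₁ * δ₂ ≠ 0 ∧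
      (∀ t ∈ I, HasDerivAt γ (δ₂ * k t - δ₃ * f t) t) ∧
      ∀ t x u : ℝ, (t, x, u) ∈ Ω →
        φ (t, x, u) =
          (δ₁ ^ 3 * t + δ₀, δ₁ * x + δ₁ * δ₃ / δ₂ ^ 2 * γ t + δ₄, δ₂ * u + δ₃) ∧
        k' (δ₁ ^ 3 * t + δ₀) = (δ₂ * k t - 2 * δ₃ * f t) / (δ₁ ^ 2 * δ₂ ^ 2) ∧
        f' (δ₁ ^ 3 * t + δ₀) = f t / (δ₁ ^ 2 * δ₂ ^ 2) := by
  have hc := h.carries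
  have hφ : ∀ z ∈ Ω, ContDiffAt ℝ ∞ φ z := fun z hz =>
    h.nondegenerate.1.contDiffAt (hΩ.mem_nhds hz)
  have hdet := h.nondegenerate.2
  have hf : ∀ z ∈ Ω, f z.1 ≠ 0 := fun z hz => h.source.f_ne_zero _ (h.source_mem z hz)
  have diff : ∀ {g : Base → ℝ} {z}, ContDiffAt ℝ ∞ g z → DifferentiableAt ℝ g z :=
    fun h => h.differentiableAt (by simp)
  have cT := fun z hz => (contDiffAt_comps (hφ z hz)).1
  have cX := fun z hz => (contDiffAt_comps (hφ z hz)).2.1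
  have cU := fun z hz => (contDiffAt_comps (hφ z hz)).2.2
  have ht := fun z hz => tComp_partials_eq_zero hc (z := z) hz (hφ z hz) (hdet z hz)
  have hx := fun z hz => xComp_partials hΩ hc hφ hdet (z := z) hz
  have hx2 := fun z hz => xComp_second_partials hΩ hc hφ hdet (z := z) hz
  have hu := fun z hz => determining_equations hΩ hc hφ hdet hf (z := z) hz
  obtain ⟨z0, hz0⟩ := hconn.nonempty
  have hsub : ∀ {g h : Base → ℝ} {z v : Base}, DifferentiableAt ℝ g z → DifferentiableAt ℝ h z →
    dir v (fun y => g y - h y) z = dir v g z - dir v h z := fun a b => dir_sub _ a b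
  have lin : ∀ (a : ℝ) (z v : Base),
      dir v (fun y : Base => a * y.1) z = a * v.1 ∧ dir v (fun y : Base => a * y.2.1) z = a * v.2.1 ∧
      dir v (fun y : Base => a * y.2.2) z = a * v.2.2 := by
    intro a z v
    have h1 := (hasFDerivAt_fst (𝕜 := ℝ) (p := z)).const_mul a
    have h2 := ((hasFDerivAt_snd (𝕜 := ℝ) (p := z)).fst).const_mul a
    have h3 := ((hasFDerivAt_snd (𝕜 := ℝ) (p := z)).snd).const_mul a
    simp only [dir]
    rw [h1.fderiv, h2.fderiv, h3.fderiv]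
    simp
  obtain ⟨δ₂, h2⟩ := exists_const_of_partials hΩ hconn.isPreconnected (g := Du (uComp φ))
    (fun z hz => diff (contDiffAt_dir _ (cU z hz))) (fun z hz => ⟨by
      rw [Dt, Du, dir_comm _ _ (cU z hz)]
      exact dir_eq_zero hΩ _ (fun y hy => (hu y hy).2.2.2.2.1) hz, (hu z hz).2.2.1, (hu z hz).2.1⟩)
  obtain ⟨δ₃, h3⟩ := exists_const_of_partials hΩ hconn.isPreconnected
    (g := fun z => uComp φ z - δ₂ * z.2.2)
    (fun z hz => (diff (cU z hz)).sub (by fun_prop)) (fun z hz => by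
      have l := fun v => (lin δ₂ z v).2.2
      have s := fun v => hsub (v := v) (diff (cU z hz))
        (h := fun z => δ₂ * z.2.2) (by fun_prop)
      refine ⟨?_, ?_, ?_⟩
      · have := (hu z hz).2.2.2.2.1
        rw [Dt] at *; rw [s, l, this]; simp
      · have := (hu z hz).2.2.2.1
        rw [Dx] at *; rw [s, l, this]; simp
      · have := h2 z hz
        rw [Du] at *; rw [s, l, this]; simp)
  have Uform : ∀ z ∈ Ω, uComp φ z = δ₂ * z.2.2 + δ₃ := fun z hz => by linarith [h3 z hz]
  have d2 : δ₂ ≠ 0 := by rw [← h2 z0 hz0]; exact (hu z0 hz0).1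
  -- The formula for `X_t` involves only `t`, `u`, `T`, `U` and `X_x`, none of which varies along an
  -- `x`-line.
  have Xtx : ∀ z ∈ Ω, Dx (Dt (xComp φ)) z = 0 := by
    intro z hz
    have l1 := eventually_line_const hΩ (0, 1, 0) (fun z hz => diff (cT z hz)) (fun z hz => (ht z hz).1) hz
    have l2 := eventually_line_const hΩ (0, 1, 0) (fun z hz => diff (contDiffAt_dir _ (cX z hz)))
      (fun z hz => (hx2 z hz).1) hz
    have l3 : (fun s : ℝ => Dt (xComp φ) (z + s • ((0, 1, 0) : Base))) =ᶠ[𝓝 0]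
        fun _ => Dt (xComp φ) z := by
      filter_upwards [l1, l2, eventually_line_mem hΩ hz (0, 1, 0)] with s a1 a2 a3
      change Dx (xComp φ) (z + s • ((0, 1, 0) : Base)) = Dx (xComp φ) z at a2
      rw [(hu _ a3).2.2.2.2.2, (hu z hz).2.2.2.2.2, Uform _ a3, Uform z hz, a1, a2]
      simp
    have l4 := (hasDerivAt_line (z := z) (v := ((0, 1, 0) : Base)) (s := 0)
      (by rw [zero_smul, add_zero]; exact diff (contDiffAt_dir ((1, 0, 0) : Base) (cX z hz)))).deriv
    have l5 := l3.deriv_eq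
    change deriv (fun s : ℝ => Dt (xComp φ) (z + s • ((0, 1, 0) : Base))) 0 = _ at l4
    rw [l4] at l5
    simpa [Dx, Dt] using l5
  obtain ⟨δ₁, h1⟩ := exists_const_of_partials hΩ hconn.isPreconnected (g := Dx (xComp φ))
    (fun z hz => diff (contDiffAt_dir _ (cX z hz))) (fun z hz => ⟨by
      rw [Dt, Dx, dir_comm _ _ (cX z hz)]; exact Xtx z hz, hx2 z hz⟩)
  have d1 : δ₁ ≠ 0 := by rw [← h1 z0 hz0]; exact (hx z0 hz0).2.2
  obtain ⟨δ₀, h0⟩ := exists_const_of_partials hΩ hconn.isPreconnected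
    (g := fun z => tComp φ z - δ₁ ^ 3 * z.1)
    (fun z hz => (diff (cT z hz)).sub (by fun_prop)) (fun z hz => by
      have l := fun v => (lin (δ₁ ^ 3) z v).1
      have s := fun v => hsub (v := v) (diff (cT z hz))
        (h := fun z => δ₁ ^ 3 * z.1) (by fun_prop)
      refine ⟨?_, ?_, ?_⟩
      · have := (hx z hz).2.1
        rw [h1 z hz] at this
        rw [Dt] at *; rw [s, l, ← this]; simp
      · have := (ht z hz).1
        rw [Dx] at *; rw [s, l, this]; simp
      · have := (ht z hz).2
        rw [Du] at *; rw [s, l, this]; simp)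
  have Tform : ∀ z ∈ Ω, tComp φ z = δ₁ ^ 3 * z.1 + δ₀ := fun z hz => by linarith [h0 z hz]
  -- Since `X_t` does not depend on `u`, the formula for it is a polynomial identity in `u`; its
  -- coefficients of degree one and two give `k'` and `f'`.
  have coeffs : ∀ z ∈ Ω, k' (tComp φ z) = (δ₂ * k z.1 - 2 * δ₃ * f z.1) / (δ₁ ^ 2 * δ₂ ^ 2) ∧
      f' (tComp φ z) = f z.1 / (δ₁ ^ 2 * δ₂ ^ 2) := by
    intro z hz
    have l1 := eventually_line_const hΩ (0, 0, 1) (fun z hz => diff (cT z hz)) (fun z hz => (ht z hz).2) hz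
    have l2 := eventually_line_const hΩ (g := Dt (xComp φ)) (0, 0, 1)
      (fun z hz => diff (contDiffAt_dir _ (cX z hz)))
      (by
        intro z hz
        rw [Dt, dir_comm _ _ (cX z hz)]
        exact dir_eq_zero hΩ _ (fun y hy => (hx y hy).1) hz) hz
    have l4 := quadratic_coeffs_eq_zero
      (a := δ₁ * (δ₁ ^ 2 * (k' (tComp φ z) * uComp φ z + f' (tComp φ z) * uComp φ z ^ 2)
        - (k z.1 * z.2.2 + f z.1 * z.2.2 ^ 2)) - Dt (xComp φ) z)
      (b := δ₁ * (δ₁ ^ 2 * (k' (tComp φ z) * δ₂ + 2 * f' (tComp φ z) * uComp φ z * δ₂)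
        - (k z.1 + 2 * f z.1 * z.2.2)))
      (c := δ₁ * (δ₁ ^ 2 * (f' (tComp φ z) * δ₂ ^ 2) - f z.1)) (by
        filter_upwards [l1, l2, eventually_line_mem hΩ hz (0, 0, 1)] with s a1 a2 a3
        have a4 := (hu _ a3).2.2.2.2.2
        rw [a1, a2, h1 _ a3, Uform _ a3] at a4
        rw [Uform z hz]
        simp only [Prod.fst_add, Prod.snd_add, Prod.smul_fst, Prod.smul_snd, smul_eq_mul,
          mul_zero, add_zero, mul_one] at a4
        linear_combination -a4)
    obtain ⟨-, b1, b2⟩ := l4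
    have c1 := (mul_eq_zero.1 b1).resolve_left d1
    have c2 := (mul_eq_zero.1 b2).resolve_left d1
    rw [Uform z hz] at c1
    have e2 : f' (tComp φ z) = f z.1 / (δ₁ ^ 2 * δ₂ ^ 2) := by
      field_simp; linarith
    refine ⟨?_, e2⟩
    field_simp
    linear_combination δ₂ * c1 - (2 * δ₂ * z.2.2 + 2 * δ₃) * c2
  obtain ⟨γ, hγ⟩ := exists_antiderivative h.source.isOpen h.source.ordConnected
    (g := fun t => δ₂ * k t - δ₃ * f t)
    ((continuousOn_const.mul h.source.smooth_k.continuousOn).sub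
      (continuousOn_const.mul h.source.smooth_f.continuousOn))
  -- With `k'` and `f'` inserted, the formula for `X_t` collapses to its degree-zero part `δ₁ δ₃ /
  -- δ₂² (δ₂ k - δ₃ f)`, so subtracting the antiderivative leaves a constant.
  obtain ⟨δ₄, h4⟩ := exists_const_of_partials hΩ hconn.isPreconnected
    (g := fun z => xComp φ z - δ₁ * z.2.1 - δ₁ * δ₃ / δ₂ ^ 2 * γ z.1)
    (fun z hz => ((diff (cX z hz)).sub (by fun_prop)).sub
      (((hγ _ (h.source_mem z hz)).differentiableAt.comp z (differentiableAt_fst)).const_mul _))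
    (fun z hz => by
      have l := fun v => (lin δ₁ z v).2.1
      have gd : HasFDerivAt (fun y : Base => δ₁ * δ₃ / δ₂ ^ 2 * γ y.1) _ z :=
        (((hγ _ (h.source_mem z hz)).hasFDerivAt.comp z (hasFDerivAt_fst (𝕜 := ℝ) (p := z))).const_mul
          (δ₁ * δ₃ / δ₂ ^ 2))
      have s := fun v => hsub (v := v) (diff (cX z hz))
        (h := fun z => δ₁ * z.2.1) (by fun_prop)
      have s' := fun v => hsub (z := z) (v := v) (g := fun z => xComp φ z - δ₁ * z.2.1)
        ((diff (cX z hz)).sub (by fun_prop)) gd.differentiableAt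
      have gv : ∀ v : Base, dir v (fun y : Base => δ₁ * δ₃ / δ₂ ^ 2 * γ y.1) z
          = δ₁ * δ₃ / δ₂ ^ 2 * (v.1 * (δ₂ * k z.1 - δ₃ * f z.1)) := by
        intro v
        rw [dir, gd.fderiv]
        simp
      refine ⟨?_, ?_, ?_⟩
      · have := (hu z hz).2.2.2.2.2
        rw [(coeffs z hz).1, (coeffs z hz).2, Uform z hz, h1 z hz] at this
        rw [Dt] at *; rw [s', s, l, gv, this]
        field_simp
        ring
      · have := h1 z hz
        rw [Dx] at *; rw [s', s, l, gv, this]; simp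
      · have := (hx z hz).1
        rw [Du] at *; rw [s', s, l, gv, this]; simp)
  refine ⟨δ₀, δ₁, δ₂, δ₃, δ₄, γ, mul_ne_zero d1 d2, hγ, fun t x u hz => ?_⟩
  have e1 := Tform _ hz
  have e2 := Uform _ hz
  have e3 := h4 _ hz
  have e4 := coeffs _ hz
  rw [e1] at e4
  refine ⟨?_, e4⟩
  ext
  · exact e1
  · change xComp φ (t, x, u) = _
    simp only at e3 ⊢
    linarith
  · exact e2

/-! ### The converse: transformations of the stated form are admissible. -/

theorem iteratedDeriv_succ_comp_affine (n : ℕ) (g : ℝ → ℝ) (c d b a y : ℝ) :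
    iteratedDeriv (n + 1) (fun y => c * g (b + a * y) - d) y
      = c * (a ^ (n + 1) * iteratedDeriv (n + 1) g (b + a * y)) := by
  have h : deriv (fun y => c * g (b + a * y) - d)
      = fun y => (c * a) * deriv g (b + a * y) := by
    funext y
    have := iteratedDeriv_comp_affine 1 g b a y
    simp only [iteratedDeriv_one, pow_one] at this
    rw [deriv_sub_const, deriv_const_mul_field, this]; ring
  rw [iteratedDeriv_succ', h, iteratedDeriv_const_mul_field, iteratedDeriv_comp_affine,
    iteratedDeriv_succ']
  ring

theorem contDiffOn_antiderivative {I : Set ℝ} (hI : IsOpen I) {g ξ : ℝ → ℝ}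
    (hg : ContDiffOn ℝ ∞ g I) (h : ∀ t ∈ I, HasDerivAt ξ (g t) t) : ContDiffOn ℝ ∞ ξ I := by
  rw [contDiffOn_infty_iff_deriv_of_isOpen hI]
  exact ⟨fun t ht => (h t ht).differentiableAt.differentiableWithinAt,
    hg.congr fun t ht => (h t ht).deriv⟩

/-- The transformations of the theorem are admissible. -/
theorem isAdmissible_of_form {Ω : Set Base} {φ : Base → Base} {I I' : Set ℝ} {k f k' f' : ℝ → ℝ}
    (hΩ : IsOpen Ω) (hs : IsArbitraryElement I k f) (ht : IsArbitraryElement I' k' f')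
    (hsm : ∀ z ∈ Ω, z.1 ∈ I) (htm : ∀ z ∈ Ω, (φ z).1 ∈ I') {δ₀ δ₁ δ₂ δ₃ : ℝ} {ξ : ℝ → ℝ}
    (hδ : δ₁ * δ₂ ≠ 0)
    (hξ : ∀ t ∈ I, HasDerivAt ξ (δ₁ * δ₃ / δ₂ ^ 2 * (δ₂ * k t - δ₃ * f t)) t)
    (hφ : ∀ z ∈ Ω, φ z = (δ₁ ^ 3 * z.1 + δ₀, δ₁ * z.2.1 + ξ z.1, δ₂ * z.2.2 + δ₃))
    (hk : ∀ z ∈ Ω, k' (δ₁ ^ 3 * z.1 + δ₀) = (δ₂ * k z.1 - 2 * δ₃ * f z.1) / (δ₁ ^ 2 * δ₂ ^ 2))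
    (hf : ∀ z ∈ Ω, f' (δ₁ ^ 3 * z.1 + δ₀) = f z.1 / (δ₁ ^ 2 * δ₂ ^ 2)) :
    IsAdmissible Ω φ I k f I' k' f' := by
  have d1 : δ₁ ≠ 0 := left_ne_zero_of_mul hδ
  have d2 : δ₂ ≠ 0 := right_ne_zero_of_mul hδ
  have cξ : ContDiffOn ℝ ∞ ξ I := contDiffOn_antiderivative hs.isOpen
    (contDiffOn_const.mul ((contDiffOn_const.mul hs.smooth_k).sub
      (contDiffOn_const.mul hs.smooth_f))) hξ
  refine ⟨hs, ht, hsm, htm, ⟨?_, ?_⟩, ?_⟩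
  · refine ContDiffOn.congr ?_ hφ
    have c1 : ContDiffOn ℝ ∞ (fun z : Base => ξ z.1) Ω :=
      cξ.comp contDiff_fst.contDiffOn hsm
    have c2 : ContDiff ℝ ∞ (fun z : Base => δ₁ ^ 3 * z.1 + δ₀) := by fun_prop
    have c3 : ContDiff ℝ ∞ (fun z : Base => δ₁ * z.2.1) := by fun_prop
    have c4 : ContDiff ℝ ∞ (fun z : Base => δ₂ * z.2.2 + δ₃) := by fun_prop
    exact c2.contDiffOn.prodMk ((c3.contDiffOn.add c1).prodMk c4.contDiffOn)
  · intro z hz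
    have e1 : HasFDerivAt (fun z : Base => δ₁ ^ 3 * z.1 + δ₀) _ z :=
      ((hasFDerivAt_fst (𝕜 := ℝ) (p := z)).const_mul (δ₁ ^ 3)).add_const δ₀
    have e2 : HasFDerivAt (fun z : Base => δ₁ * z.2.1 + ξ z.1) _ z :=
      (((hasFDerivAt_snd (𝕜 := ℝ) (p := z)).fst).const_mul δ₁).add
        ((hξ z.1 (hsm z hz)).hasFDerivAt.comp z (hasFDerivAt_fst (𝕜 := ℝ) (p := z)))
    have e3 : HasFDerivAt (fun z : Base => δ₂ * z.2.2 + δ₃) _ z :=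
      (((hasFDerivAt_snd (𝕜 := ℝ) (p := z)).snd).const_mul δ₂).add_const δ₃
    have ev : φ =ᶠ[𝓝 z] fun z => (δ₁ ^ 3 * z.1 + δ₀, δ₁ * z.2.1 + ξ z.1, δ₂ * z.2.2 + δ₃) := by
      filter_upwards [hΩ.mem_nhds hz] with y hy using hφ y hy
    rw [ev.fderiv_eq, (e1.prodMk (e2.prodMk e3)).fderiv]
    rw [ContinuousLinearMap.det, Ne, LinearMap.det_eq_zero_iff_ker_ne_bot, not_not,
      LinearMap.ker_eq_bot']
    intro ζ hζ
    simp [d1, d2] at hζ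
    obtain ⟨h1, h2, h3⟩ := hζ
    simp [h1, d1] at h2
    ext <;> simp [h1, h2, h3]
  · intro u v t x hz hu hv hrel
    have hcont : ContinuousAt (fun q : ℝ × ℝ => ((q.1, q.2, u q.1 q.2) : Base)) (t, x) :=
      continuousAt_fst.prodMk (continuousAt_snd.prodMk hu.continuousAt)
    have hmem : ∀ᶠ q : ℝ × ℝ in 𝓝 (t, x), ((q.1, q.2, u q.1 q.2) : Base) ∈ Ω :=
      hcont.eventually_mem (hΩ.mem_nhds hz)
    have rel : ∀ᶠ q : ℝ × ℝ in 𝓝 (t, x),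
        v (δ₁ ^ 3 * q.1 + δ₀) (δ₁ * q.2 + ξ q.1) = δ₂ * u q.1 q.2 + δ₃ := by
      filter_upwards [hmem, hrel] with q h1 h2
      simpa [hφ _ h1] using h2
    rw [hφ _ hz] at hv ⊢
    simp only at hv ⊢
    have vd := (hv.differentiableAt (by simp)).hasFDerivAt
    set T := δ₁ ^ 3 * t + δ₀ with hT
    set X := δ₁ * x + ξ t with hX
    set L := fderiv ℝ (fun q : ℝ × ℝ => v q.1 q.2) (T, X) with hL
    have vT : HasDerivAt (fun s => v s X) (L (1, 0)) T :=
      HasFDerivAt.comp_hasDerivAt T (f := fun s : ℝ => (s, X)) vd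
        ((hasDerivAt_id _).prodMk (hasDerivAt_const _ _))
    have vX : HasDerivAt (fun s => v T s) (L (0, 1)) X :=
      HasFDerivAt.comp_hasDerivAt X (f := fun s : ℝ => (T, s)) vd
        ((hasDerivAt_const _ _).prodMk (hasDerivAt_id _))
    have tx : Tendsto (fun y : ℝ => (t, y)) (𝓝 x) (𝓝 (t, x)) :=
      (Continuous.prodMk_right t).tendsto x
    have tt : Tendsto (fun s : ℝ => (s, x)) (𝓝 t) (𝓝 (t, x)) :=
      (Continuous.prodMk_left x).tendsto t
    -- At fixed `t` the transformation is an affine rescaling, so `ξ` does not enter the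
    -- `x`-derivatives; it enters only through the `t`-derivative.
    have ux : (fun y => u t y) =ᶠ[𝓝 x] fun y => δ₂⁻¹ * v T (ξ t + δ₁ * y) - δ₃ / δ₂ := by
      filter_upwards [tx.eventually rel] with y hy
      rw [add_comm (ξ t), hy]
      field_simp; ring
    have ux1 := ux.iteratedDeriv_eq 1
    have ux3 := ux.iteratedDeriv_eq 3
    rw [iteratedDeriv_succ_comp_affine 0 (fun s => v T s), add_comm (ξ t)] at ux1
    rw [iteratedDeriv_succ_comp_affine 2 (fun s => v T s), add_comm (ξ t)] at ux3
    simp only [zero_add, iteratedDeriv_one, pow_one] at ux1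
    rw [vX.deriv] at ux1
    have u0 : v T X = δ₂ * u t x + δ₃ := rel.self_of_nhds
    have ud : DifferentiableAt ℝ (fun s => u s x) t :=
      DifferentiableAt.comp t (g := fun q : ℝ × ℝ => u q.1 q.2) (f := fun s : ℝ => (s, x))
        (hu.differentiableAt (by simp)) (by fun_prop)
    have ut : δ₁ ^ 3 * L (1, 0) + δ₁ * δ₃ / δ₂ ^ 2 * (δ₂ * k t - δ₃ * f t) * L (0, 1)
        = δ₂ * deriv (fun s => u s x) t := by
      have h1 : HasDerivAt (fun s : ℝ => ((δ₁ ^ 3 * s + δ₀, δ₁ * x + ξ s) : ℝ × ℝ))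
          (δ₁ ^ 3 * 1, δ₁ * δ₃ / δ₂ ^ 2 * (δ₂ * k t - δ₃ * f t)) t :=
        (((hasDerivAt_id t).const_mul _).add_const _).prodMk ((hξ t (hsm _ hz)).const_add _)
      have h2 := HasFDerivAt.comp_hasDerivAt t
        (f := fun s : ℝ => ((δ₁ ^ 3 * s + δ₀, δ₁ * x + ξ s) : ℝ × ℝ)) vd h1
      have h3 := ((ud.hasDerivAt.const_mul δ₂).add_const δ₃).congr_of_eventuallyEq
        (f₁ := fun s => v (δ₁ ^ 3 * s + δ₀) (δ₁ * x + ξ s)) (tt.eventually rel)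
      rw [← h2.unique h3]
      have : ((δ₁ ^ 3 * 1, δ₁ * δ₃ / δ₂ ^ 2 * (δ₂ * k t - δ₃ * f t)) : ℝ × ℝ)
          = δ₁ ^ 3 • ((1, 0) : ℝ × ℝ)
            + (δ₁ * δ₃ / δ₂ ^ 2 * (δ₂ * k t - δ₃ * f t)) • ((0, 1) : ℝ × ℝ) := by
        ext <;> simp
      rw [this, map_add, map_smul, map_smul, smul_eq_mul, smul_eq_mul]
    -- The drift coming from `ξ'` cancels the degree-zero part in `u` of `k' (δ₂ u + δ₃) + f' (δ₂ u
    -- + δ₃)²`.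
    have main : lhs k f u t x = δ₁ ^ 3 / δ₂ * lhs k' f' v T X := by
      have ut' : deriv (fun s => u s x) t = (δ₁ ^ 3 * L (1, 0)
          + δ₁ * δ₃ / δ₂ ^ 2 * (δ₂ * k t - δ₃ * f t) * L (0, 1)) / δ₂ := by
        rw [ut]; field_simp
      simp only [lhs]
      rw [vT.deriv, vX.deriv, ut', ux1, ux3, u0, hk _ hz, hf _ hz]
      simp only [hX]
      field_simp
      ring
    rw [main]
    simp [d1, d2]

/-- The image of an arbitrary element under a transformation of the theorem. -/
theorem IsArbitraryElement.target {I : Set ℝ} {k f : ℝ → ℝ} (h : IsArbitraryElement I k f)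
    (δ₀ δ₃ : ℝ) {δ₁ δ₂ : ℝ} (hδ : δ₁ * δ₂ ≠ 0) :
    ∃ (I' : Set ℝ) (k' f' : ℝ → ℝ), IsArbitraryElement I' k' f' ∧
      ∀ t ∈ I, δ₁ ^ 3 * t + δ₀ ∈ I' ∧
        k' (δ₁ ^ 3 * t + δ₀) = (δ₂ * k t - 2 * δ₃ * f t) / (δ₁ ^ 2 * δ₂ ^ 2) ∧
        f' (δ₁ ^ 3 * t + δ₀) = f t / (δ₁ ^ 2 * δ₂ ^ 2) := by
  have d1 : δ₁ ≠ 0 := left_ne_zero_of_mul hδ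
  have d2 : δ₂ ≠ 0 := right_ne_zero_of_mul hδ
  set b : ℝ → ℝ := fun s => (s - δ₀) / δ₁ ^ 3 with hb
  have ba : ∀ t, b (δ₁ ^ 3 * t + δ₀) = t := fun t => by simp only [hb]; field_simp; ring
  have ab : ∀ s, δ₁ ^ 3 * b s + δ₀ = s := fun s => by simp only [hb]; field_simp; ring
  have cb : ContDiff ℝ ∞ b := by simp only [hb]; fun_prop
  have hset : b ⁻¹' I = (fun t => δ₁ ^ 3 * t + δ₀) '' I := by
    ext s
    constructor
    · exact fun hs => ⟨b s, hs, ab s⟩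
    · rintro ⟨t, ht, rfl⟩
      simpa [ba] using ht
  refine ⟨b ⁻¹' I, fun s => (δ₂ * k (b s) - 2 * δ₃ * f (b s)) / (δ₁ ^ 2 * δ₂ ^ 2),
    fun s => f (b s) / (δ₁ ^ 2 * δ₂ ^ 2), ⟨?_, ?_, ?_, ?_, ?_, ?_⟩, ?_⟩
  · exact h.isOpen.preimage cb.continuous
  · rw [hset]
    have := h.ordConnected
    exact ((isPreconnected_iff_ordConnected.2 this).image _ (by fun_prop)).ordConnected
  · rw [hset]; exact h.nonempty.image _
  · have ck := h.smooth_k.comp cb.contDiffOn (s := b ⁻¹' I) fun _ hx => hx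
    have cf := h.smooth_f.comp cb.contDiffOn (s := b ⁻¹' I) fun _ hx => hx
    exact ((contDiffOn_const.mul ck).sub (contDiffOn_const.mul cf)).div_const _
  · exact (h.smooth_f.comp cb.contDiffOn (s := b ⁻¹' I) fun _ hx => hx).div_const _
  · exact fun s hs => div_ne_zero (h.f_ne_zero _ hs) (by positivity)
  · intro t ht
    simp only [mem_preimage, ba]
    exact ⟨ht, trivial, trivial⟩

/-! ### Jets of the arbitrary elements and lifts to the extended space. -/

theorem exists_jet (n : ℕ) (c : ℕ → ℝ) (t : ℝ) :
    ∃ K : ℝ → ℝ, ContDiff ℝ ∞ K ∧ ∀ i ≤ n, iteratedDeriv i K t = c i := by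
  induction n generalizing c with
  | zero => exact ⟨fun _ => c 0, contDiff_const, fun i hi => by simp [Nat.le_zero.1 hi]⟩
  | succ n ih =>
    -- Integrating a function with the shifted jet gains one order; the constant of integration is
    -- `c 0`.
    obtain ⟨K, hK, hc⟩ := ih fun i => c (i + 1)
    have hd : ∀ x, HasDerivAt (fun x => c 0 + ∫ s in t..x, K s) (K x) x := fun x =>
      (intervalIntegral.integral_hasDerivAt_right (hK.continuous.intervalIntegrable _ _)
        (hK.continuous.stronglyMeasurableAtFilter _ _) hK.continuous.continuousAt).const_add _
    have hd' : deriv (fun x => c 0 + ∫ s in t..x, K s) = K := funext fun x => (hd x).deriv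
    refine ⟨_, contDiff_infty_iff_deriv.2 ⟨fun x => (hd x).differentiableAt, by rwa [hd']⟩, ?_⟩
    intro i hi
    cases i with
    | zero => simp
    | succ i => rw [iteratedDeriv_succ', hd']; exact hc i (by omega)

theorem contDiffOn_iteratedDeriv {I : Set ℝ} (hI : IsOpen I) {K : ℝ → ℝ} (hK : ContDiffOn ℝ ∞ K I)
    (i : ℕ) : ContDiffOn ℝ ∞ (iteratedDeriv i K) I := by
  induction i with
  | zero => simpa using hK
  | succ i ih =>
    rw [iteratedDeriv_succ]
    exact ((contDiffOn_infty_iff_deriv_of_isOpen hI).1 ih).2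

theorem hasDerivAt_iteratedDeriv {I : Set ℝ} (hI : IsOpen I) {K : ℝ → ℝ}
    (hK : ContDiffOn ℝ ∞ K I) (i : ℕ) {t : ℝ} (ht : t ∈ I) :
    HasDerivAt (iteratedDeriv i K) (iteratedDeriv (i + 1) K t) t := by
  rw [iteratedDeriv_succ]
  exact (((contDiffOn_iteratedDeriv hI hK i).contDiffAt (hI.mem_nhds ht)).differentiableAt
    (by simp)).hasDerivAt

/-- The total derivative of a tuple of consecutive derivatives, the next derivative being `c`. -/
def jetShift {N : ℕ} (κ : Fin N → ℝ) (c : ℝ) (i : Fin N) : ℝ :=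
  if h : (i : ℕ) + 1 < N then κ ⟨i + 1, h⟩ else c

theorem jetShift_lift {N : ℕ} {K : ℝ → ℝ} {t : ℝ} (i : Fin N) :
    jetShift (fun j : Fin N => iteratedDeriv j K t) (iteratedDeriv N K t) i
      = iteratedDeriv (i + 1) K t := by
  unfold jetShift
  split_ifs with h
  · rfl
  · have := i.2
    rw [show (i : ℕ) + 1 = N by omega]

theorem continuousOn_lift (p r : ℕ) {I : Set ℝ} (hI : IsOpen I) {K F : ℝ → ℝ}
    (hK : ContDiffOn ℝ ∞ K I) (hF : ContDiffOn ℝ ∞ F I) :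
    ContinuousOn (lift p r K F) {z : Base | z.1 ∈ I} := by
  have h : ∀ {G : ℝ → ℝ}, ContDiffOn ℝ ∞ G I → ContinuousOn
      (fun z : Base => fun i : Fin (p + r + 2) => iteratedDeriv i G z.1) {z : Base | z.1 ∈ I} :=
    fun hG => continuousOn_pi.2 fun i =>
      (contDiffOn_iteratedDeriv hI hG i).continuousOn.comp continuous_fst.continuousOn fun _ h => h
  exact continuousOn_id.prodMk ((h hK).prodMk (h hF))

theorem isOpen_lift_preimage (p r : ℕ) {I : Set ℝ} (hI : IsOpen I) {K F : ℝ → ℝ}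
    (hK : ContDiffOn ℝ ∞ K I) (hF : ContDiffOn ℝ ∞ F I) {D : Set (ExtendedSpace p r)}
    (hD : IsOpen D) : IsOpen {z : Base | z.1 ∈ I ∧ lift p r K F z ∈ D} :=
  (continuousOn_lift p r hI hK hF).isOpen_inter_preimage (hI.preimage continuous_fst) hD

theorem hasDerivAt_lift (p r : ℕ) {K F : ℝ → ℝ} (hK : ContDiff ℝ ∞ K) (hF : ContDiff ℝ ∞ F)
    (z v : Base) : HasDerivAt (fun s : ℝ => lift p r K F (z + s • v))
      (v, v.1 • jetShift (fun i : Fin (p + r + 2) => iteratedDeriv i K z.1)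
          (iteratedDeriv (p + r + 2) K z.1),
        v.1 • jetShift (fun i : Fin (p + r + 2) => iteratedDeriv i F z.1)
          (iteratedDeriv (p + r + 2) F z.1)) 0 := by
  have h0 : HasDerivAt (fun s : ℝ => z + s • v) v 0 := by
    simpa using ((hasDerivAt_id (0 : ℝ)).smul_const v).const_add z
  have h1 : HasDerivAt (fun s : ℝ => z.1 + s * v.1) v.1 0 := by
    simpa using ((hasDerivAt_id (0 : ℝ)).mul_const v.1).const_add z.1
  have h : ∀ {G : ℝ → ℝ}, ContDiff ℝ ∞ G → HasDerivAt
      (fun s : ℝ => fun i : Fin (p + r + 2) => iteratedDeriv i G (z.1 + s * v.1))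
      (v.1 • jetShift (fun i : Fin (p + r + 2) => iteratedDeriv i G z.1)
          (iteratedDeriv (p + r + 2) G z.1)) 0 := by
    intro G hG
    refine hasDerivAt_pi.2 fun i => ?_
    have hd : HasDerivAt (iteratedDeriv i G) (iteratedDeriv (i + 1) G z.1) (z.1 + 0 * v.1) := by
      rw [zero_mul, add_zero]
      exact hasDerivAt_iteratedDeriv isOpen_univ hG.contDiffOn i (mem_univ _)
    refine (HasDerivAt.comp 0 hd h1).congr_deriv ?_
    rw [Pi.smul_apply, jetShift_lift, smul_eq_mul, mul_comm]
  exact h0.prodMk ((h hK).prodMk (h hF))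

/-- A function on the extended space whose pullbacks along the lifts of all functions are locally
constant is constant. -/
theorem exists_const_of_lifts {p r : ℕ} {D : Set (ExtendedSpace p r)} (hD : IsOpen D)
    (hconn : IsPreconnected D) {g : ExtendedSpace p r → ℝ} (hg : ∀ e ∈ D, ContDiffAt ℝ ∞ g e)
    (H : ∀ e ∈ D, ∀ a b : ℝ, ∃ K F : ℝ → ℝ, ContDiff ℝ ∞ K ∧ ContDiff ℝ ∞ F ∧
      lift p r K F e.1 = e ∧ iteratedDeriv (p + r + 2) K e.1.1 = a ∧
      iteratedDeriv (p + r + 2) F e.1.1 = b ∧ ∀ᶠ z in 𝓝 e.1, g (lift p r K F z) = g e) :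
    ∃ c, ∀ e ∈ D, g e = c := by
  have diff := fun e he => (hg e he).differentiableAt (n := ∞) (by simp)
  -- Local constancy along a lift says that `g` is killed by the total derivative in which the
  -- derivatives beyond the last coordinates have the values `a` and `b`.
  have total : ∀ e ∈ D, ∀ (a b : ℝ) (v : Base),
      dir ((v, v.1 • jetShift e.2.1 a, v.1 • jetShift e.2.2 b) : ExtendedSpace p r) g e = 0 := by
    intro e he a b v
    obtain ⟨K, F, hK, hF, hl, ha, hb, hev⟩ := H e he a b
    have h1 := hasDerivAt_lift p r hK hF e.1 v
    have hgd : HasFDerivAt g (fderiv ℝ g e) (lift p r K F (e.1 + (0 : ℝ) • v)) := by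
      rw [zero_smul, add_zero, hl]; exact (diff e he).hasFDerivAt
    have h2 := hgd.comp_hasDerivAt 0 h1
    have hc : Tendsto (fun s : ℝ => e.1 + s • v) (𝓝 0) (𝓝 e.1) := by
      have : Continuous fun s : ℝ => e.1 + s • v := by fun_prop
      simpa using this.tendsto 0
    have h3 : HasDerivAt (g ∘ fun s : ℝ => lift p r K F (e.1 + s • v)) 0 0 :=
      (hasDerivAt_const (0 : ℝ) (g e)).congr_of_eventuallyEq (hc.eventually hev)
    have h4 := h2.unique h3
    have e1 : (fun i : Fin (p + r + 2) => iteratedDeriv i K e.1.1) = e.2.1 :=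
      congrArg (fun e : ExtendedSpace p r => e.2.1) hl
    have e2 : (fun i : Fin (p + r + 2) => iteratedDeriv i F e.1.1) = e.2.2 :=
      congrArg (fun e : ExtendedSpace p r => e.2.2) hl
    rwa [ha, hb, e1, e2] at h4
  have dadd : ∀ (v w e : ExtendedSpace p r), dir (v + w) g e = dir v g e + dir w g e :=
    fun v w e => map_add _ _ _
  have dsmul : ∀ (s : ℝ) (v e : ExtendedSpace p r), dir (s • v) g e = s * dir v g e :=
    fun s v e => map_smul _ _ _
  -- Two total derivatives at the same point differ by a vector in the two highest coordinates.
  have top : ∀ e ∈ D, ∀ a b : ℝ,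
      dir ((0, jetShift 0 a, jetShift 0 b) : ExtendedSpace p r) g e = 0 := by
    intro e he a b
    have h1 := total e he a b (1, 0, 0)
    have h2 := total e he 0 0 (1, 0, 0)
    have h3 : (((1, 0, 0), (1 : ℝ) • jetShift e.2.1 a, (1 : ℝ) • jetShift e.2.2 b) :
        ExtendedSpace p r) = ((1, 0, 0), (1 : ℝ) • jetShift e.2.1 0, (1 : ℝ) • jetShift e.2.2 0)
          + ((0, jetShift 0 a, jetShift 0 b) : ExtendedSpace p r) := by
      refine Prod.ext (by simp) (Prod.ext ?_ ?_) <;> funext i <;> simp [jetShift] <;>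
        split_ifs <;> simp
    simp only at h1 h2
    rw [h3, dadd, h2, zero_add] at h1
    exact h1
  -- The commutator of a constant vertical field with the total derivative is the field shifted one
  -- order down. It appears here as the coefficient of `s` when the total derivative is transported
  -- along the field.
  have step : ∀ κ l : Fin (p + r + 2) → ℝ,
      (∀ e ∈ D, dir ((0, κ, l) : ExtendedSpace p r) g e = 0) →
      ∀ e ∈ D, dir ((0, jetShift κ 0, jetShift l 0) : ExtendedSpace p r) g e = 0 := by
    intro κ l h e he
    have cst : ∀ v : ExtendedSpace p r, ∀ᶠ s : ℝ in 𝓝 0,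
        dir v g (e + s • ((0, κ, l) : ExtendedSpace p r)) = dir v g e := by
      intro v
      refine eventually_line_const hD _
        (fun y hy => (contDiffAt_dir v (hg y hy)).differentiableAt (by simp)) (fun y hy => ?_) he
      rw [dir_comm _ _ (hg y hy)]
      exact dir_eq_zero hD v h hy
    refine (quadratic_coeffs_eq_zero (a := 0) (c := 0) ?_).2.1
    filter_upwards [eventually_line_mem hD he ((0, κ, l) : ExtendedSpace p r),
      cst ((1, 0, 0), (1 : ℝ) • jetShift e.2.1 0, (1 : ℝ) • jetShift e.2.2 0),
      cst (0, jetShift κ 0, jetShift l 0)] with s h1 h2 h3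
    have h4 := total _ h1 0 0 (1, 0, 0)
    have h0 := total e he 0 0 (1, 0, 0)
    have h5 : (((1, 0, 0), (1 : ℝ) • jetShift (e + s • ((0, κ, l) : ExtendedSpace p r)).2.1 0,
        (1 : ℝ) • jetShift (e + s • ((0, κ, l) : ExtendedSpace p r)).2.2 0) :
        ExtendedSpace p r) = ((1, 0, 0), (1 : ℝ) • jetShift e.2.1 0, (1 : ℝ) • jetShift e.2.2 0)
          + s • ((0, jetShift κ 0, jetShift l 0) : ExtendedSpace p r) := by
      refine Prod.ext (by simp) (Prod.ext ?_ ?_) <;> funext i <;> simp [jetShift] <;>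
        split_ifs <;> simp
    simp only at h4 h0
    rw [h5, dadd, dsmul, h2, h3, h0] at h4
    linarith
  -- Descent from the highest derivative: after `n` steps all vertical fields supported in the last
  -- `n` coordinates kill `g`.
  have all : ∀ n : ℕ, ∀ κ l : Fin (p + r + 2) → ℝ,
      (∀ i : Fin (p + r + 2), (i : ℕ) + n < p + r + 2 → κ i = 0 ∧ l i = 0) →
      ∀ e ∈ D, dir ((0, κ, l) : ExtendedSpace p r) g e = 0 := by
    intro n
    induction n with
    | zero =>
      intro κ l h e _
      have : ((0, κ, l) : ExtendedSpace p r) = 0 := by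
        refine Prod.ext rfl (Prod.ext ?_ ?_) <;> funext i
        · exact (h i i.2).1
        · exact (h i i.2).2
      rw [this]; exact map_zero _
    | succ n ih =>
      intro κ l h e he
      -- `jetShift` undoes `back` except in the last coordinate, which is covered by `top`.
      set back : (Fin (p + r + 2) → ℝ) → Fin (p + r + 2) → ℝ := fun a i =>
        if (i : ℕ) = 0 then 0 else a ⟨i - 1, by omega⟩ with hback
      have hb : ∀ a : Fin (p + r + 2) → ℝ,
          a = jetShift (back a) 0 + jetShift 0 (a ⟨p + r + 1, by omega⟩) := by
        intro a
        funext i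
        have hi := i.2
        by_cases h1 : (i : ℕ) + 1 < p + r + 2
        · simp [jetShift, h1, hback]
        · have h2 : i = ⟨p + r + 1, by omega⟩ := Fin.ext (by simp; omega)
          simp only [jetShift, Pi.add_apply, h1, dite_false, zero_add]
          rw [h2]
      have e1 : ((0, κ, l) : ExtendedSpace p r)
          = (0, jetShift (back κ) 0, jetShift (back l) 0)
            + (0, jetShift 0 (κ ⟨p + r + 1, by omega⟩), jetShift 0 (l ⟨p + r + 1, by omega⟩)) :=
        Prod.ext (by simp) (Prod.ext (hb κ) (hb l))
      rw [e1, dadd, top e he, add_zero]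
      refine step _ _ (ih _ _ fun i hi => ?_) e he
      simp only [hback]
      split_ifs with h0
      · exact ⟨rfl, rfl⟩
      · exact h _ (by simp; omega)
  refine hD.exists_is_const_of_fderiv_eq_zero hconn
    (fun e he => (diff e he).differentiableWithinAt) fun e he => ?_
  refine ContinuousLinearMap.ext fun w => ?_
  have h1 : w = (w.1, w.1.1 • jetShift e.2.1 0, w.1.1 • jetShift e.2.2 0)
      + ((0, w.2.1 - w.1.1 • jetShift e.2.1 0, w.2.2 - w.1.1 • jetShift e.2.2 0) :
        ExtendedSpace p r) := by
    refine Prod.ext (by simp) (Prod.ext ?_ ?_) <;> simp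
  change dir w g e = 0
  rw [h1, dadd, total e he, all (p + r + 2) _ _ (fun i hi => by omega) e he, add_zero]

theorem IsAdmissible.mono {Ω Ω' : Set Base} {φ : Base → Base} {I I' : Set ℝ} {k f k' f' : ℝ → ℝ}
    (h : IsAdmissible Ω φ I k f I' k' f') (hs : Ω' ⊆ Ω) : IsAdmissible Ω' φ I k f I' k' f' :=
  ⟨h.source, h.target, fun z hz => h.source_mem z (hs hz), fun z hz => h.target_mem z (hs hz),
    ⟨h.nondegenerate.1.mono hs, fun z hz => h.nondegenerate.2 z (hs hz)⟩,
    fun u v t x hz => h.carries u v t x (hs hz)⟩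

/-! ### The generalized extended equivalence group. -/

/-- The new variables of the theorem, as functions on the extended space. -/
noncomputable def extendedBase {p r : ℕ} (δ₀ δ₁ δ₂ δ₃ δ₄ : ℝ) (e : ExtendedSpace p r) : Base :=
  (δ₁ ^ 3 * e.1.1 + δ₀,
    δ₁ * e.1.2.1 + δ₁ * δ₃ / δ₂ ^ 2 *
      (δ₂ * e.2.1 (integralIdx p r) - δ₃ * e.2.2 (integralIdx p r)) + δ₄,
    δ₂ * e.1.2.2 + δ₃)

/-- The new arbitrary elements of the theorem, as functions on the extended space. -/
noncomputable def extendedElements {p r : ℕ} (δ₁ δ₂ δ₃ : ℝ) (e : ExtendedSpace p r) : ℝ × ℝ :=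
  ((δ₂ * e.2.1 (elementIdx p r) - 2 * δ₃ * e.2.2 (elementIdx p r)) / (δ₁ ^ 2 * δ₂ ^ 2),
    e.2.2 (elementIdx p r) / (δ₁ ^ 2 * δ₂ ^ 2))

theorem contDiff_extendedBase {p r : ℕ} (δ₀ δ₁ δ₂ δ₃ δ₄ : ℝ) :
    ContDiff ℝ ∞ (extendedBase (p := p) (r := r) δ₀ δ₁ δ₂ δ₃ δ₄) := by
  unfold extendedBase; fun_prop

theorem contDiff_extendedElements {p r : ℕ} (δ₁ δ₂ δ₃ : ℝ) :
    ContDiff ℝ ∞ (extendedElements (p := p) (r := r) δ₁ δ₂ δ₃) := by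
  unfold extendedElements; fun_prop

section Extended

variable {p r : ℕ} {D : Set (ExtendedSpace p r)} {Φ : ExtendedSpace p r → Base}
  {Ψ : ExtendedSpace p r → ℝ × ℝ}

/-- The derivatives of order `p` of `K` and `F` are antiderivatives of `k` and `f`, so on each lift
the formula is of the kind covered by `isAdmissible_of_form`. -/
theorem IsGeneralizedExtendedEquivalence.of_form (hD : IsOpen D) {δ₀ δ₁ δ₂ δ₃ δ₄ : ℝ}
    (hδ : δ₁ * δ₂ ≠ 0) (hΦ : ∀ e ∈ D, Φ e = extendedBase δ₀ δ₁ δ₂ δ₃ δ₄ e)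
    (hΨ : ∀ e ∈ D, Ψ e = extendedElements δ₁ δ₂ δ₃ e) :
    IsGeneralizedExtendedEquivalence p r D Φ Ψ := by
  refine ⟨(contDiff_extendedBase δ₀ δ₁ δ₂ δ₃ δ₄).contDiffOn.congr hΦ,
    (contDiff_extendedElements δ₁ δ₂ δ₃).contDiffOn.congr hΨ, ?_⟩
  intro I k f K F hs hK hF hk hf
  obtain ⟨I', k', f', ht, hrel⟩ := hs.target δ₀ δ₃ hδ
  have hform : ∀ z ∈ {z : Base | z.1 ∈ I ∧ lift p r K F z ∈ D}, Φ (lift p r K F z)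
      = (δ₁ ^ 3 * z.1 + δ₀, δ₁ * z.2.1 + (δ₁ * δ₃ / δ₂ ^ 2 *
        (δ₂ * iteratedDeriv p K z.1 - δ₃ * iteratedDeriv p F z.1) + δ₄), δ₂ * z.2.2 + δ₃) := by
    rintro z ⟨-, hz⟩
    rw [hΦ _ hz, ← add_assoc]
    rfl
  refine ⟨I', k', f', ?_, ?_⟩
  · refine isAdmissible_of_form (isOpen_lift_preimage p r hs.isOpen hK hF hD) hs ht
      (fun z hz => hz.1) (fun z hz => ?_) hδ
      (ξ := fun t => δ₁ * δ₃ / δ₂ ^ 2 * (δ₂ * iteratedDeriv p K t - δ₃ * iteratedDeriv p F t) + δ₄)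
      (fun t ht => ?_) hform (fun z hz => (hrel z.1 hz.1).2.1) (fun z hz => (hrel z.1 hz.1).2.2)
    · rw [hform z hz]; exact (hrel z.1 hz.1).1
    · have h1 := hasDerivAt_iteratedDeriv hs.isOpen hK p ht
      have h2 := hasDerivAt_iteratedDeriv hs.isOpen hF p ht
      rw [hk t ht] at h1
      rw [hf t ht] at h2
      exact (((h1.const_mul δ₂).sub (h2.const_mul δ₃)).const_mul _).add_const _
  · intro z hz hzD
    rw [hΨ _ hzD, hform z ⟨hz, hzD⟩]
    simp only
    rw [(hrel z.1 hz).2.1, (hrel z.1 hz).2.2, ← hk _ hz, ← hf _ hz]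
    rfl

/-- Pulling back along a lift through `e` turns `Φ` into a point transformation between two fixed
equations, to which `IsAdmissible.exists_form` applies on a ball. The constants may still depend on
`K` and `F`. -/
theorem IsGeneralizedExtendedEquivalence.local_form (hD : IsOpen D)
    (hne : ∀ e ∈ D, e.2.2 (elementIdx p r) ≠ 0)
    (h : IsGeneralizedExtendedEquivalence p r D Φ Ψ) {e : ExtendedSpace p r} (he : e ∈ D)
    (a b : ℝ) : ∃ K F : ℝ → ℝ, ContDiff ℝ ∞ K ∧ ContDiff ℝ ∞ F ∧ lift p r K F e.1 = e ∧
      iteratedDeriv (p + r + 2) K e.1.1 = a ∧ iteratedDeriv (p + r + 2) F e.1.1 = b ∧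
      ∃ δ₀ δ₁ δ₂ δ₃ δ₄ : ℝ, δ₁ * δ₂ ≠ 0 ∧ ∀ᶠ z in 𝓝 e.1, lift p r K F z ∈ D ∧
        Φ (lift p r K F z) = extendedBase δ₀ δ₁ δ₂ δ₃ δ₄ (lift p r K F z) ∧
        Ψ (lift p r K F z) = extendedElements δ₁ δ₂ δ₃ (lift p r K F z) := by
  have jet : ∀ (κ : Fin (p + r + 2) → ℝ) (c : ℝ), ∃ K : ℝ → ℝ, ContDiff ℝ ∞ K ∧
      (fun i : Fin (p + r + 2) => iteratedDeriv i K e.1.1) = κ ∧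
      iteratedDeriv (p + r + 2) K e.1.1 = c := by
    intro κ c
    -- The jet is prescribed one order beyond the coordinates of the extended space, which leaves
    -- `c` free.
    obtain ⟨K, hK, hj⟩ := exists_jet (p + r + 2)
      (fun i => if h : i < p + r + 2 then κ ⟨i, h⟩ else c) e.1.1
    refine ⟨K, hK, funext fun i => ?_, ?_⟩
    · rw [hj i i.2.le, dif_pos i.2]
    · rw [hj _ le_rfl, dif_neg (lt_irrefl _)]
  obtain ⟨K, hK, jK, tK⟩ := jet e.2.1 a
  obtain ⟨F, hF, jF, tF⟩ := jet e.2.2 b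
  have hl : lift p r K F e.1 = e := Prod.ext rfl (Prod.ext jK jF)
  refine ⟨K, F, hK, hF, hl, tK, tF, ?_⟩
  have sm : ∀ {G : ℝ → ℝ}, ContDiff ℝ ∞ G → ∀ i, ContDiff ℝ ∞ (iteratedDeriv i G) :=
    fun hG i => contDiffOn_univ.1 (contDiffOn_iteratedDeriv isOpen_univ hG.contDiffOn i)
  have f0 : iteratedDeriv (p + 1) F e.1.1 ≠ 0 := by
    have := hne e he
    rwa [← jF] at this
  -- The chosen `f` is known to be nonzero only at the centre, hence the restriction to a small
  -- interval.
  obtain ⟨ε, hε, hball⟩ := Metric.eventually_nhds_iff_ball.1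
    ((sm hF (p + 1)).continuous.continuousAt.eventually_ne f0)
  set I := Metric.ball e.1.1 ε with hI
  have hs : IsArbitraryElement I (iteratedDeriv (p + 1) K) (iteratedDeriv (p + 1) F) :=
    ⟨Metric.isOpen_ball, (convex_ball _ _).ordConnected, ⟨_, Metric.mem_ball_self hε⟩,
      (sm hK _).contDiffOn, (sm hF _).contDiffOn, hball⟩
  obtain ⟨I', k', f', hadm, hΨ⟩ := h.maps I _ _ K F hs hK.contDiffOn hF.contDiffOn
    (fun _ _ => rfl) (fun _ _ => rfl)
  have hopen := isOpen_lift_preimage p r hs.isOpen hK.contDiffOn hF.contDiffOn hD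
  have hmem : e.1 ∈ {z : Base | z.1 ∈ I ∧ lift p r K F z ∈ D} :=
    ⟨Metric.mem_ball_self hε, by rwa [hl]⟩
  obtain ⟨ε', hε', hsub⟩ := Metric.isOpen_iff.1 hopen e.1 hmem
  obtain ⟨δ₀, δ₁, δ₂, δ₃, δ₄, γ, hδ, hγ, hform⟩ := (hadm.mono hsub).exists_form Metric.isOpen_ball
    ⟨⟨_, Metric.mem_ball_self hε'⟩, (convex_ball _ _).isPreconnected⟩
  -- The antiderivative `γ` and the one supplied by `K` and `F` differ by a constant, which is
  -- absorbed into `δ₄`.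
  obtain ⟨c, hc⟩ := hs.isOpen.exists_is_const_of_deriv_eq_zero
    (f := fun t => γ t - (δ₂ * iteratedDeriv p K t - δ₃ * iteratedDeriv p F t))
    (convex_ball _ _).isPreconnected
    (fun t ht => ((hγ t ht).differentiableAt.sub
      ((((sm hK p).differentiable (by simp) t).const_mul _).sub
        (((sm hF p).differentiable (by simp) t).const_mul _))).differentiableWithinAt)
    (fun t ht => by
      have h1 := hasDerivAt_iteratedDeriv hs.isOpen hK.contDiffOn p ht
      have h2 := hasDerivAt_iteratedDeriv hs.isOpen hF.contDiffOn p ht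
      have := ((hγ t ht).sub ((h1.const_mul δ₂).sub (h2.const_mul δ₃))).deriv
      rw [sub_self] at this
      exact this)
  refine ⟨δ₀, δ₁, δ₂, δ₃, δ₁ * δ₃ / δ₂ ^ 2 * c + δ₄, hδ, ?_⟩
  filter_upwards [Metric.ball_mem_nhds e.1 hε'] with z hz
  obtain ⟨hzI, hzD⟩ := hsub hz
  obtain ⟨h1, h2, h3⟩ := hform z.1 z.2.1 z.2.2 hz
  change Φ (lift p r K F z) = _ at h1
  refine ⟨hzD, ?_, ?_⟩
  · rw [h1]
    have hcz : γ z.1 = c + (δ₂ * iteratedDeriv p K z.1 - δ₃ * iteratedDeriv p F z.1) := by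
      linarith [hc z.1 hzI]
    refine Prod.ext rfl (Prod.ext ?_ rfl)
    change δ₁ * z.2.1 + δ₁ * δ₃ / δ₂ ^ 2 * γ z.1 + δ₄ = δ₁ * z.2.1 + δ₁ * δ₃ / δ₂ ^ 2 *
      (δ₂ * iteratedDeriv p K z.1 - δ₃ * iteratedDeriv p F z.1) + (δ₁ * δ₃ / δ₂ ^ 2 * c + δ₄)
    rw [hcz]; ring
  · rw [hΨ z hzI hzD, h1]
    simp only
    rw [h2, h3]
    rfl

/-- Each parameter is read off from `Φ` alone: `δ₁ = X_x`, `δ₂ = U_u`, then `δ₃`, `δ₀`, `δ₄` as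
differences with terms already fixed. Each such expression is a function on `D` that is locally
constant along suitable lifts, hence constant. -/
theorem IsGeneralizedExtendedEquivalence.exists_form (hD : IsOpen D) (hconn : IsConnected D)
    (hne : ∀ e ∈ D, e.2.2 (elementIdx p r) ≠ 0)
    (h : IsGeneralizedExtendedEquivalence p r D Φ Ψ) :
    ∃ δ₀ δ₁ δ₂ δ₃ δ₄ : ℝ, δ₁ * δ₂ ≠ 0 ∧ ∀ e ∈ D, Φ e = extendedBase δ₀ δ₁ δ₂ δ₃ δ₄ e ∧
      Ψ e = extendedElements δ₁ δ₂ δ₃ e := by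
  have cΦ : ∀ e ∈ D, ContDiffAt ℝ ∞ Φ e := fun e he => h.smooth_base.contDiffAt (hD.mem_nhds he)
  have glue : ∀ g : ExtendedSpace p r → ℝ, (∀ e ∈ D, ContDiffAt ℝ ∞ g e) →
      (∀ (K F : ℝ → ℝ) (z₀ : Base) (δ₀ δ₁ δ₂ δ₃ δ₄ : ℝ), (∀ᶠ z in 𝓝 z₀, lift p r K F z ∈ D ∧
        Φ (lift p r K F z) = extendedBase δ₀ δ₁ δ₂ δ₃ δ₄ (lift p r K F z)) →
        ∃ c, ∀ᶠ z in 𝓝 z₀, g (lift p r K F z) = c) → ∃ c, ∀ e ∈ D, g e = c := by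
    intro g hg hloc
    refine exists_const_of_lifts hD hconn.isPreconnected hg fun e he a b => ?_
    obtain ⟨K, F, hK, hF, hl, ha, hb, δ₀, δ₁, δ₂, δ₃, δ₄, -, hev⟩ := h.local_form hD hne he a b
    obtain ⟨c, hc⟩ := hloc K F e.1 δ₀ δ₁ δ₂ δ₃ δ₄ (hev.mono fun z hz => ⟨hz.1, hz.2.1⟩)
    refine ⟨K, F, hK, hF, hl, ha, hb, ?_⟩
    have h0 := hc.self_of_nhds
    rw [hl] at h0
    rwa [h0]
  -- Moving in `x` and `u` alone does not change the jets of `K` and `F`, so these partial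
  -- derivatives on `D` can be computed inside one lift.
  have line : ∀ (K F : ℝ → ℝ) (z v : Base) (s : ℝ), v.1 = 0 →
      lift p r K F z + s • ((v, 0, 0) : ExtendedSpace p r) = lift p r K F (z + s • v) := by
    intro K F z v s hv
    refine Prod.ext rfl (Prod.ext ?_ ?_) <;> simp [lift, hv]
  have slope : ∀ (K F : ℝ → ℝ) (z₀ : Base) (δ₀ δ₁ δ₂ δ₃ δ₄ : ℝ), (∀ᶠ z in 𝓝 z₀,
      lift p r K F z ∈ D ∧
        Φ (lift p r K F z) = extendedBase δ₀ δ₁ δ₂ δ₃ δ₄ (lift p r K F z)) → ∀ᶠ z in 𝓝 z₀,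
      dir (((0, 1, 0), 0, 0) : ExtendedSpace p r) (fun e => (Φ e).2.1) (lift p r K F z) = δ₁ ∧
      dir (((0, 0, 1), 0, 0) : ExtendedSpace p r) (fun e => (Φ e).2.2) (lift p r K F z) = δ₂ := by
    intro K F z₀ δ₀ δ₁ δ₂ δ₃ δ₄ hev
    filter_upwards [hev.eventually_nhds] with z hz
    have hzD := hz.self_of_nhds.1
    have key : ∀ (v : Base) (g : Base → ℝ) (d : ℝ), v.1 = 0 → ContDiff ℝ ∞ g →
        HasDerivAt (fun s : ℝ => g (extendedBase δ₀ δ₁ δ₂ δ₃ δ₄ (lift p r K F z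
          + s • ((v, 0, 0) : ExtendedSpace p r)))) d 0 →
        dir ((v, 0, 0) : ExtendedSpace p r) (fun e => g (Φ e)) (lift p r K F z) = d := by
      intro v g d hv hg hd
      have h1 : HasDerivAt (fun s : ℝ => g (Φ (lift p r K F z + s • ((v, 0, 0) : ExtendedSpace p r))))
          (dir ((v, 0, 0) : ExtendedSpace p r) (fun e => g (Φ e)) (lift p r K F z)) 0 := by
        have := hasDerivAt_line (g := fun e => g (Φ e)) (z := lift p r K F z) (s := 0)
          (v := ((v, 0, 0) : ExtendedSpace p r)) (by
            rw [zero_smul, add_zero]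
            exact (hg.contDiffAt.comp _ (cΦ _ hzD)).differentiableAt (by simp))
        rwa [zero_smul, add_zero] at this
      have hc : Tendsto (fun s : ℝ => z + s • v) (𝓝 0) (𝓝 z) := by
        have : Continuous fun s : ℝ => z + s • v := by fun_prop
        simpa using this.tendsto 0
      refine h1.unique (hd.congr_of_eventuallyEq ?_)
      filter_upwards [hc.eventually hz] with s hs
      rw [line K F z v s hv, hs.2]
    constructor
    · refine key (0, 1, 0) (fun z => z.2.1) δ₁ rfl (by fun_prop) ?_
      have h1 : HasDerivAt (fun s : ℝ => (δ₁ * (z.2.1 + s) + δ₁ * δ₃ / δ₂ ^ 2 *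
          (δ₂ * iteratedDeriv p K z.1 - δ₃ * iteratedDeriv p F z.1) + δ₄)) δ₁ 0 := by
        simpa using ((((hasDerivAt_id (0 : ℝ)).const_add z.2.1).const_mul δ₁).add_const
          (δ₁ * δ₃ / δ₂ ^ 2 * (δ₂ * iteratedDeriv p K z.1 - δ₃ * iteratedDeriv p F z.1))).add_const δ₄
      refine h1.congr_of_eventuallyEq (Eventually.of_forall fun s => ?_)
      simp [extendedBase, lift, integralIdx]
    · refine key (0, 0, 1) (fun z => z.2.2) δ₂ rfl (by fun_prop) ?_
      have h1 : HasDerivAt (fun s : ℝ => δ₂ * (z.2.2 + s) + δ₃) δ₂ 0 := by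
        simpa using (((hasDerivAt_id (0 : ℝ)).const_add z.2.2).const_mul δ₂).add_const δ₃
      refine h1.congr_of_eventuallyEq (Eventually.of_forall fun s => ?_)
      simp [extendedBase, lift]
  obtain ⟨c₁, h1⟩ := glue (dir (((0, 1, 0), 0, 0) : ExtendedSpace p r) fun e => (Φ e).2.1)
    (fun e he => contDiffAt_dir _ (cΦ e he).snd.fst)
    (fun K F z₀ δ₀ δ₁ δ₂ δ₃ δ₄ hev =>
      ⟨δ₁, (slope K F z₀ δ₀ δ₁ δ₂ δ₃ δ₄ hev).mono fun z hz => hz.1⟩)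
  obtain ⟨c₂, h2⟩ := glue (dir (((0, 0, 1), 0, 0) : ExtendedSpace p r) fun e => (Φ e).2.2)
    (fun e he => contDiffAt_dir _ (cΦ e he).snd.snd)
    (fun K F z₀ δ₀ δ₁ δ₂ δ₃ δ₄ hev =>
      ⟨δ₂, (slope K F z₀ δ₀ δ₁ δ₂ δ₃ δ₄ hev).mono fun z hz => hz.2⟩)
  have same : ∀ (K F : ℝ → ℝ) (z₀ : Base) (δ₀ δ₁ δ₂ δ₃ δ₄ : ℝ), (∀ᶠ z in 𝓝 z₀,
      lift p r K F z ∈ D ∧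
        Φ (lift p r K F z) = extendedBase δ₀ δ₁ δ₂ δ₃ δ₄ (lift p r K F z)) → δ₁ = c₁ ∧ δ₂ = c₂ := by
    intro K F z₀ δ₀ δ₁ δ₂ δ₃ δ₄ hev
    obtain ⟨s1, s2⟩ := (slope K F z₀ δ₀ δ₁ δ₂ δ₃ δ₄ hev).self_of_nhds
    have hD0 := hev.self_of_nhds.1
    exact ⟨s1.symm.trans (h1 _ hD0), s2.symm.trans (h2 _ hD0)⟩
  obtain ⟨c₃, h3⟩ := glue (fun e => (Φ e).2.2 - c₂ * e.1.2.2)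
    (fun e he => (cΦ e he).snd.snd.sub (by fun_prop))
    (fun K F z₀ δ₀ δ₁ δ₂ δ₃ δ₄ hev => ⟨δ₃, hev.mono fun z hz => by
      obtain ⟨-, s2⟩ := same K F z₀ δ₀ δ₁ δ₂ δ₃ δ₄ hev
      rw [hz.2, s2]; simp [extendedBase]⟩)
  have same₃ : ∀ (K F : ℝ → ℝ) (z₀ : Base) (δ₀ δ₁ δ₂ δ₃ δ₄ : ℝ), (∀ᶠ z in 𝓝 z₀,
      lift p r K F z ∈ D ∧
        Φ (lift p r K F z) = extendedBase δ₀ δ₁ δ₂ δ₃ δ₄ (lift p r K F z)) → δ₃ = c₃ := by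
    intro K F z₀ δ₀ δ₁ δ₂ δ₃ δ₄ hev
    obtain ⟨-, s2⟩ := same K F z₀ δ₀ δ₁ δ₂ δ₃ δ₄ hev
    obtain ⟨hD0, e0⟩ := hev.self_of_nhds
    have := h3 _ hD0
    simp only [e0, extendedBase, s2] at this
    linarith
  obtain ⟨c₀, h0⟩ := glue (fun e => (Φ e).1 - c₁ ^ 3 * e.1.1)
    (fun e he => (cΦ e he).fst.sub (by fun_prop))
    (fun K F z₀ δ₀ δ₁ δ₂ δ₃ δ₄ hev => ⟨δ₀, hev.mono fun z hz => by
      obtain ⟨s1, -⟩ := same K F z₀ δ₀ δ₁ δ₂ δ₃ δ₄ hev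
      rw [hz.2, s1]; simp [extendedBase]⟩)
  obtain ⟨c₄, h4⟩ := glue (fun e => (Φ e).2.1 - (c₁ * e.1.2.1 + c₁ * c₃ / c₂ ^ 2 *
      (c₂ * e.2.1 (integralIdx p r) - c₃ * e.2.2 (integralIdx p r))))
    (fun e he => (cΦ e he).snd.fst.sub (by fun_prop))
    (fun K F z₀ δ₀ δ₁ δ₂ δ₃ δ₄ hev => ⟨δ₄, hev.mono fun z hz => by
      obtain ⟨s1, s2⟩ := same K F z₀ δ₀ δ₁ δ₂ δ₃ δ₄ hev
      have s3 := same₃ K F z₀ δ₀ δ₁ δ₂ δ₃ δ₄ hev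
      rw [hz.2, s1, s2, s3]; simp [extendedBase]⟩)
  have pt : ∀ e ∈ D, c₁ * c₂ ≠ 0 ∧ Ψ e = extendedElements c₁ c₂ c₃ e := by
    intro e he
    obtain ⟨K, F, -, -, hl, -, -, δ₀, δ₁, δ₂, δ₃, δ₄, hδ, hev⟩ := h.local_form hD hne he 0 0
    have hev' := hev.mono fun z hz => (⟨hz.1, hz.2.1⟩ : _ ∧ _)
    obtain ⟨s1, s2⟩ := same K F e.1 δ₀ δ₁ δ₂ δ₃ δ₄ hev'
    have s3 := same₃ K F e.1 δ₀ δ₁ δ₂ δ₃ δ₄ hev'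
    have := hev.self_of_nhds.2.2
    rw [hl] at this
    rw [← s1, ← s2, ← s3]
    exact ⟨hδ, this⟩
  obtain ⟨e₀, he₀⟩ := hconn.nonempty
  refine ⟨c₀, c₁, c₂, c₃, c₄, (pt e₀ he₀).1, fun e he => ⟨?_, (pt e he).2⟩⟩
  have e0 := h0 e he
  have e3 := h3 e he
  have e4 := h4 e he
  refine Prod.ext ?_ (Prod.ext ?_ ?_) <;> simp only [extendedBase] <;> linarith

end Extended

/-! ### The usual equivalence group. -/

theorem exists_const_of_eventually {E : Type*} [NormedAddCommGroup E] [NormedSpace ℝ E]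
    {Ω : Set E} (hΩ : IsOpen Ω) (hconn : IsPreconnected Ω) {g : E → ℝ}
    (h : ∀ z ∈ Ω, ∃ c, ∀ᶠ y in 𝓝 z, g y = c) : ∃ c, ∀ z ∈ Ω, g z = c := by
  refine hΩ.exists_is_const_of_fderiv_eq_zero (𝕜 := ℝ) hconn (fun z hz => ?_) fun z hz => ?_
  · obtain ⟨c, hc⟩ := h z hz
    have : g =ᶠ[𝓝 z] fun _ => c := hc
    exact (this.differentiableAt_iff.2 (differentiableAt_const c)).differentiableWithinAt
  · obtain ⟨c, hc⟩ := h z hz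
    have : g =ᶠ[𝓝 z] fun _ => c := hc
    rw [this.fderiv_eq]; simp

section Usual

variable {D : Set UsualSpace} {Φ : Base → Base} {Ψ : UsualSpace → ℝ × ℝ}

theorem isOpen_baseSet (hD : IsOpen D) : IsOpen (baseSet D) := isOpenMap_fst D hD

theorem IsUsualEquivalence.of_form (hD : IsOpen D) {δ₀ δ₁ δ₂ δ₄ : ℝ} (hδ : δ₁ * δ₂ ≠ 0)
    (hΦ : ∀ e ∈ D, Φ e.1 = (δ₁ ^ 3 * e.1.1 + δ₀, δ₁ * e.1.2.1 + δ₄, δ₂ * e.1.2.2))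
    (hΨ : ∀ e ∈ D, Ψ e = (δ₂ * e.2.1 / (δ₁ ^ 2 * δ₂ ^ 2), e.2.2 / (δ₁ ^ 2 * δ₂ ^ 2))) :
    IsUsualEquivalence D Φ Ψ := by
  have d1 : δ₁ ≠ 0 := left_ne_zero_of_mul hδ
  have d2 : δ₂ ≠ 0 := right_ne_zero_of_mul hδ
  have hΦ' : ∀ z ∈ baseSet D, Φ z = (δ₁ ^ 3 * z.1 + δ₀, δ₁ * z.2.1 + δ₄, δ₂ * z.2.2) := by
    rintro _ ⟨e, he, rfl⟩
    exact hΦ e he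
  refine ⟨ContDiffOn.congr ?_ hΦ', ContDiffOn.congr ?_ hΨ, ?_, ?_⟩
  · exact ContDiff.contDiffOn (by fun_prop)
  · exact ContDiff.contDiffOn (by fun_prop)
  · intro e he
    have ev : (fun e' : UsualSpace => ((Φ e'.1, Ψ e') : UsualSpace)) =ᶠ[𝓝 e] fun e' =>
        ((δ₁ ^ 3 * e'.1.1 + δ₀, δ₁ * e'.1.2.1 + δ₄, δ₂ * e'.1.2.2),
          δ₂ * e'.2.1 / (δ₁ ^ 2 * δ₂ ^ 2), e'.2.2 / (δ₁ ^ 2 * δ₂ ^ 2)) := by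
      filter_upwards [hD.mem_nhds he] with y hy
      rw [hΦ y hy, hΨ y hy]
    have hb := hasFDerivAt_fst (𝕜 := ℝ) (p := e)
    have hs := hasFDerivAt_snd (𝕜 := ℝ) (p := e)
    have e1 := (hb.fst.const_mul (δ₁ ^ 3)).add_const δ₀
    have e2 := (hb.snd.fst.const_mul δ₁).add_const δ₄
    have e3 := hb.snd.snd.const_mul δ₂
    have e4 := ((hs.fst.const_mul δ₂).mul_const (δ₁ ^ 2 * δ₂ ^ 2)⁻¹)
    have e5 := hs.snd.mul_const (δ₁ ^ 2 * δ₂ ^ 2)⁻¹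
    simp only [← div_eq_mul_inv] at e4 e5
    rw [ev.fderiv_eq, ((e1.prodMk (e2.prodMk e3)).prodMk (e4.prodMk e5)).fderiv]
    rw [ContinuousLinearMap.det, Ne, LinearMap.det_eq_zero_iff_ker_ne_bot, not_not,
      LinearMap.ker_eq_bot']
    intro ζ hζ
    simp [d1, d2] at hζ
    obtain ⟨⟨h1, h2, h3⟩, h4, h5⟩ := hζ
    refine Prod.ext (Prod.ext h1 (Prod.ext h2 h3)) (Prod.ext h4 h5)
  · intro I k f hs
    obtain ⟨I', k', f', ht, hrel⟩ := hs.target δ₀ 0 hδ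
    have hform : ∀ z ∈ {z : Base | z.1 ∈ I ∧ (z, k z.1, f z.1) ∈ D},
        Φ z = (δ₁ ^ 3 * z.1 + δ₀, δ₁ * z.2.1 + δ₄, δ₂ * z.2.2 + 0) := by
      rintro z ⟨-, hz⟩
      rw [add_zero]; exact hΦ _ hz
    have hopen : IsOpen {z : Base | z.1 ∈ I ∧ (z, k z.1, f z.1) ∈ D} := by
      have hc : ∀ {g : ℝ → ℝ}, ContDiffOn ℝ ∞ g I →
          ContinuousOn (fun z : Base => g z.1) {z : Base | z.1 ∈ I} := fun hg =>
        hg.continuousOn.comp continuous_fst.continuousOn fun _ h => h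
      exact (continuousOn_id.prodMk ((hc hs.smooth_k).prodMk (hc hs.smooth_f))).isOpen_inter_preimage
        (hs.isOpen.preimage continuous_fst) hD
    refine ⟨I', k', f', isAdmissible_of_form hopen hs ht (fun z hz => hz.1) (fun z hz => ?_) hδ
      (ξ := fun _ => δ₄) (fun t _ => ?_) hform (fun z hz => (hrel z.1 hz.1).2.1)
      (fun z hz => (hrel z.1 hz.1).2.2), fun z hz hzD => ?_⟩
    · rw [hform z hz]; exact (hrel z.1 hz.1).1
    · exact (hasDerivAt_const t δ₄).congr_deriv (by simp)
    · rw [hΨ _ hzD, hform z ⟨hz, hzD⟩]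
      simp only
      rw [(hrel z.1 hz).2.1, (hrel z.1 hz).2.2, mul_zero, zero_mul, sub_zero]

/-- Constant arbitrary elements through `e` suffice, since `Φ` does not involve `(k, f)` and `Ψ` is
evaluated only at `e`. -/
theorem IsUsualEquivalence.local_form (hD : IsOpen D) (hne : ∀ e ∈ D, e.2.2 ≠ 0)
    (h : IsUsualEquivalence D Φ Ψ) {e : UsualSpace} (he : e ∈ D) :
    ∃ (δ₀ δ₁ δ₂ δ₃ δ₄ : ℝ) (γ : ℝ → ℝ), δ₁ * δ₂ ≠ 0 ∧
      (∀ t, HasDerivAt γ (δ₂ * e.2.1 - δ₃ * e.2.2) t) ∧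
      (∀ᶠ z in 𝓝 e.1, Φ z = (δ₁ ^ 3 * z.1 + δ₀, δ₁ * z.2.1 + δ₁ * δ₃ / δ₂ ^ 2 * γ z.1 + δ₄,
        δ₂ * z.2.2 + δ₃)) ∧
      Ψ e = ((δ₂ * e.2.1 - 2 * δ₃ * e.2.2) / (δ₁ ^ 2 * δ₂ ^ 2), e.2.2 / (δ₁ ^ 2 * δ₂ ^ 2)) := by
  have hs : IsArbitraryElement univ (fun _ => e.2.1) (fun _ => e.2.2) :=
    ⟨isOpen_univ, ordConnected_univ, univ_nonempty, contDiffOn_const, contDiffOn_const,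
      fun _ _ => hne e he⟩
  obtain ⟨I', k', f', hadm, hΨ⟩ := h.maps _ _ _ hs
  have hopen : IsOpen {z : Base | z.1 ∈ univ ∧ (z, e.2.1, e.2.2) ∈ D} := by
    simp only [mem_univ, true_and]
    exact hD.preimage (Continuous.prodMk_left e.2)
  obtain ⟨ε, hε, hsub⟩ := Metric.isOpen_iff.1 hopen e.1 ⟨mem_univ _, he⟩
  obtain ⟨δ₀, δ₁, δ₂, δ₃, δ₄, γ, hδ, hγ, hform⟩ := (hadm.mono hsub).exists_form Metric.isOpen_ball
    ⟨⟨_, Metric.mem_ball_self hε⟩, (convex_ball _ _).isPreconnected⟩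
  refine ⟨δ₀, δ₁, δ₂, δ₃, δ₄, γ, hδ, fun t => hγ t (mem_univ t), ?_, ?_⟩
  · filter_upwards [Metric.ball_mem_nhds e.1 hε] with z hz using (hform z.1 z.2.1 z.2.2 hz).1
  · obtain ⟨h1, h2, h3⟩ := hform e.1.1 e.1.2.1 e.1.2.2 (Metric.mem_ball_self hε)
    have := hΨ e.1 (mem_univ _) he
    change Φ e.1 = _ at h1
    rw [h1] at this
    simp only at this
    rw [h2, h3] at this
    exact this

/-- Over one base point, change `k` by a small `s ≠ 0`. The value of `X_t` stays the same because
`Φ` does, but the formula for it changes by `δ₁ δ₃ s / δ₂`; hence `δ₃ = 0`. -/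
theorem IsUsualEquivalence.local_form_zero (hD : IsOpen D) (hne : ∀ e ∈ D, e.2.2 ≠ 0)
    (h : IsUsualEquivalence D Φ Ψ) {e : UsualSpace} (he : e ∈ D) :
    ∃ δ₀ δ₁ δ₂ δ₄ : ℝ, δ₁ * δ₂ ≠ 0 ∧ Dx (xComp Φ) e.1 = δ₁ ∧ Du (uComp Φ) e.1 = δ₂ ∧
      (∀ᶠ z in 𝓝 e.1, Φ z = (δ₁ ^ 3 * z.1 + δ₀, δ₁ * z.2.1 + δ₄, δ₂ * z.2.2)) ∧
      Ψ e = (δ₂ * e.2.1 / (δ₁ ^ 2 * δ₂ ^ 2), e.2.2 / (δ₁ ^ 2 * δ₂ ^ 2)) := by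
  have partials : ∀ (δ₀ δ₁ δ₂ δ₃ δ₄ a b : ℝ) (γ : ℝ → ℝ), (∀ t, HasDerivAt γ (δ₂ * a - δ₃ * b) t) →
      (∀ᶠ z in 𝓝 e.1, Φ z = (δ₁ ^ 3 * z.1 + δ₀, δ₁ * z.2.1 + δ₁ * δ₃ / δ₂ ^ 2 * γ z.1 + δ₄,
        δ₂ * z.2.2 + δ₃)) →
      Dx (xComp Φ) e.1 = δ₁ ∧ Du (uComp Φ) e.1 = δ₂ ∧ uComp Φ e.1 = δ₂ * e.1.2.2 + δ₃ ∧
        Dt (xComp Φ) e.1 = δ₁ * δ₃ / δ₂ ^ 2 * (δ₂ * a - δ₃ * b) := by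
    intro δ₀ δ₁ δ₂ δ₃ δ₄ a b γ hγ hev
    have hb := hasFDerivAt_fst (𝕜 := ℝ) (p := e.1)
    have hs := hasFDerivAt_snd (𝕜 := ℝ) (p := e.1)
    have e2 : HasFDerivAt (fun z : Base => δ₁ * z.2.1 + δ₁ * δ₃ / δ₂ ^ 2 * γ z.1 + δ₄) _ e.1 :=
      ((hs.fst.const_mul δ₁).add
        (((hγ e.1.1).hasFDerivAt.comp e.1 hb).const_mul (δ₁ * δ₃ / δ₂ ^ 2))).add_const δ₄
    have e3 : HasFDerivAt (fun z : Base => δ₂ * z.2.2 + δ₃) _ e.1 :=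
      (hs.snd.const_mul δ₂).add_const δ₃
    have v2 : xComp Φ =ᶠ[𝓝 e.1] fun z : Base => δ₁ * z.2.1 + δ₁ * δ₃ / δ₂ ^ 2 * γ z.1 + δ₄ := by
      filter_upwards [hev] with z hz
      simp [xComp, hz]
    have v3 : uComp Φ =ᶠ[𝓝 e.1] fun z : Base => δ₂ * z.2.2 + δ₃ := by
      filter_upwards [hev] with z hz
      simp [uComp, hz]
    refine ⟨?_, ?_, v3.self_of_nhds, ?_⟩
    · rw [Dx, dir, v2.fderiv_eq, e2.fderiv]; simp
    · rw [Du, dir, v3.fderiv_eq, e3.fderiv]; simp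
    · rw [Dt, dir, v2.fderiv_eq, e2.fderiv]; simp
  obtain ⟨δ₀, δ₁, δ₂, δ₃, δ₄, γ, hδ, hγ, hev, hΨ⟩ := h.local_form hD hne he
  obtain ⟨p1, p2, p3, p4⟩ := partials _ _ _ _ _ _ _ _ hγ hev
  have hnear : ∀ᶠ s : ℝ in 𝓝[≠] 0, (e.1, e.2.1 + s, e.2.2) ∈ D := by
    have hc : Continuous fun s : ℝ => ((e.1, e.2.1 + s, e.2.2) : UsualSpace) := by fun_prop
    exact (hc.continuousAt.eventually_mem (by simpa using hD.mem_nhds he)).filter_mono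
      nhdsWithin_le_nhds
  obtain ⟨s, hs, hs0⟩ := (hnear.and eventually_mem_nhdsWithin).exists
  obtain ⟨η₀, η₁, η₂, η₃, η₄, γ', hη, hγ', hev', -⟩ := h.local_form hD hne hs
  obtain ⟨q1, q2, q3, q4⟩ := partials _ _ _ _ _ _ _ _ hγ' hev'
  have d1 : δ₁ ≠ 0 := left_ne_zero_of_mul hδ
  have d2 : δ₂ ≠ 0 := right_ne_zero_of_mul hδ
  have r1 : η₁ = δ₁ := q1.symm.trans p1
  have r2 : η₂ = δ₂ := q2.symm.trans p2
  have r3 : η₃ = δ₃ := by rw [p3, r2] at q3; linarith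
  rw [p4, r1, r2, r3] at q4
  have d3 : δ₃ = 0 := by
    have h1 : δ₁ * δ₃ / δ₂ ^ 2 * (δ₂ * s) = 0 := by simp only at q4; linarith
    rcases mul_eq_zero.1 h1 with h2 | h2
    · rcases div_eq_zero_iff.1 h2 with h3 | h3
      · exact (mul_eq_zero.1 h3).resolve_left d1
      · exact absurd h3 (pow_ne_zero 2 d2)
    · exact absurd h2 (mul_ne_zero d2 hs0)
  subst d3
  refine ⟨δ₀, δ₁, δ₂, δ₄, hδ, p1, p2, ?_, ?_⟩
  · filter_upwards [hev] with z hz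
    rw [hz]; simp
  · rw [hΨ]; simp

/-- All parameters are visible in `Φ`, which lives on the projection of `D`; connectedness is
therefore needed only there, and the formula for `Ψ` follows pointwise. -/
theorem IsUsualEquivalence.exists_form (hD : IsOpen D) (hconn : IsConnected (baseSet D))
    (hne : ∀ e ∈ D, e.2.2 ≠ 0) (h : IsUsualEquivalence D Φ Ψ) :
    ∃ δ₀ δ₁ δ₂ δ₄ : ℝ, δ₁ * δ₂ ≠ 0 ∧ ∀ e ∈ D,
      Φ e.1 = (δ₁ ^ 3 * e.1.1 + δ₀, δ₁ * e.1.2.1 + δ₄, δ₂ * e.1.2.2) ∧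
      Ψ e = (δ₂ * e.2.1 / (δ₁ ^ 2 * δ₂ ^ 2), e.2.2 / (δ₁ ^ 2 * δ₂ ^ 2)) := by
  have hΩ := isOpen_baseSet hD
  have glue : ∀ g : Base → ℝ, (∀ (z₀ : Base) (δ₀ δ₁ δ₂ δ₄ : ℝ), (∀ᶠ z in 𝓝 z₀, z ∈ baseSet D ∧
      Dx (xComp Φ) z = δ₁ ∧ Du (uComp Φ) z = δ₂ ∧
      Φ z = (δ₁ ^ 3 * z.1 + δ₀, δ₁ * z.2.1 + δ₄, δ₂ * z.2.2)) → ∃ c, ∀ᶠ z in 𝓝 z₀, g z = c) →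
      ∃ c, ∀ z ∈ baseSet D, g z = c := by
    intro g hg
    refine exists_const_of_eventually hΩ hconn.isPreconnected ?_
    rintro _ ⟨e, he, rfl⟩
    obtain ⟨δ₀, δ₁, δ₂, δ₄, -, h1, h2, hev, -⟩ := h.local_form_zero hD hne he
    refine hg e.1 δ₀ δ₁ δ₂ δ₄ ?_
    filter_upwards [hev.eventually_nhds, hΩ.mem_nhds ⟨e, he, rfl⟩] with z hz hzD
    refine ⟨hzD, ?_, ?_, hz.self_of_nhds⟩
    · have v : xComp Φ =ᶠ[𝓝 z] fun z : Base => δ₁ * z.2.1 + δ₄ := by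
        filter_upwards [hz] with y hy
        simp [xComp, hy]
      rw [Dx, dir, v.fderiv_eq, (((hasFDerivAt_snd (𝕜 := ℝ) (p := z)).fst.const_mul
        δ₁).add_const δ₄).fderiv]
      simp
    · have v : uComp Φ =ᶠ[𝓝 z] fun z : Base => δ₂ * z.2.2 := by
        filter_upwards [hz] with y hy
        simp [uComp, hy]
      rw [Du, dir, v.fderiv_eq, ((hasFDerivAt_snd (𝕜 := ℝ) (p := z)).snd.const_mul δ₂).fderiv]
      simp
  obtain ⟨c₁, h1⟩ := glue (Dx (xComp Φ)) fun z₀ δ₀ δ₁ δ₂ δ₄ hev =>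
    ⟨δ₁, hev.mono fun z hz => hz.2.1⟩
  obtain ⟨c₂, h2⟩ := glue (Du (uComp Φ)) fun z₀ δ₀ δ₁ δ₂ δ₄ hev =>
    ⟨δ₂, hev.mono fun z hz => hz.2.2.1⟩
  obtain ⟨c₀, h0⟩ := glue (fun z => tComp Φ z - c₁ ^ 3 * z.1) fun z₀ δ₀ δ₁ δ₂ δ₄ hev =>
    ⟨δ₀, hev.mono fun z ⟨hz, a1, a2, a3⟩ => by
      rw [← h1 z hz, a1]; simp [tComp, a3]⟩
  obtain ⟨c₄, h4⟩ := glue (fun z => xComp Φ z - c₁ * z.2.1) fun z₀ δ₀ δ₁ δ₂ δ₄ hev =>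
    ⟨δ₄, hev.mono fun z ⟨hz, a1, a2, a3⟩ => by
      rw [← h1 z hz, a1]; simp [xComp, a3]⟩
  have pt : ∀ e ∈ D, c₁ * c₂ ≠ 0 ∧ Φ e.1 = (c₁ ^ 3 * e.1.1 + c₀, c₁ * e.1.2.1 + c₄, c₂ * e.1.2.2) ∧
      Ψ e = (c₂ * e.2.1 / (c₁ ^ 2 * c₂ ^ 2), e.2.2 / (c₁ ^ 2 * c₂ ^ 2)) := by
    intro e he
    have hb : e.1 ∈ baseSet D := ⟨e, he, rfl⟩
    obtain ⟨δ₀, δ₁, δ₂, δ₄, hδ, a1, a2, hev, hΨ⟩ := h.local_form_zero hD hne he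
    rw [h1 _ hb] at a1
    rw [h2 _ hb] at a2
    subst a1 a2
    have e0 := h0 _ hb
    have e4 := h4 _ hb
    refine ⟨hδ, Prod.ext ?_ (Prod.ext ?_ ?_), hΨ⟩
    · simp only [tComp] at e0 ⊢; linarith
    · simp only [xComp] at e4 ⊢; linarith
    · rw [hev.self_of_nhds]
  obtain ⟨_, e₀, he₀, rfl⟩ := hconn.nonempty
  exact ⟨c₀, c₁, c₂, c₄, (pt e₀ he₀).1, fun e he => (pt e he).2⟩

end Usual

end Gardner

/-! ### The three statements together. -/

theorem theorem2 :
    -- the generalized extended equivalence group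
    (∀ (p r : ℕ) (D : Set (Gardner.ExtendedSpace p r)), IsOpen D → IsConnected D →
      (∀ e ∈ D, e.2.2 (Gardner.elementIdx p r) ≠ 0) →
      ∀ (Φ : Gardner.ExtendedSpace p r → Gardner.Base) (Ψ : Gardner.ExtendedSpace p r → ℝ × ℝ),
        Gardner.IsGeneralizedExtendedEquivalence p r D Φ Ψ ↔
          ∃ δ₀ δ₁ δ₂ δ₃ δ₄ : ℝ, δ₁ * δ₂ ≠ 0 ∧
            ∀ (t x u : ℝ) (κ l : Fin (p + r + 2) → ℝ), ((t, x, u), κ, l) ∈ D →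
              Φ ((t, x, u), κ, l) =
                (δ₁ ^ 3 * t + δ₀,
                  δ₁ * x + δ₁ * δ₃ / δ₂ ^ 2 *
                    (δ₂ * κ (Gardner.integralIdx p r) - δ₃ * l (Gardner.integralIdx p r)) + δ₄,
                  δ₂ * u + δ₃) ∧
              Ψ ((t, x, u), κ, l) =
                ((δ₂ * κ (Gardner.elementIdx p r) - 2 * δ₃ * l (Gardner.elementIdx p r)) /
                    (δ₁ ^ 2 * δ₂ ^ 2),
                  l (Gardner.elementIdx p r) / (δ₁ ^ 2 * δ₂ ^ 2))) ∧
    -- whatever the nonlocal dependence on the arbitrary elements: for each single equation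
    -- there are no other point transformations to equations of the class
    (∀ (I : Set ℝ) (k f : ℝ → ℝ) (I' : Set ℝ) (k' f' : ℝ → ℝ),
      Gardner.IsArbitraryElement I k f → Gardner.IsArbitraryElement I' k' f' →
      ∀ (Ω : Set Gardner.Base) (φ : Gardner.Base → Gardner.Base), IsOpen Ω → IsConnected Ω →
        (∀ z ∈ Ω, z.1 ∈ I) → (∀ z ∈ Ω, (φ z).1 ∈ I') →
        (Gardner.IsAdmissible Ω φ I k f I' k' f' ↔
          ∃ (δ₀ δ₁ δ₂ δ₃ δ₄ : ℝ) (γ : ℝ → ℝ), δ₁ * δ₂ ≠ 0 ∧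
            (∀ t ∈ I, HasDerivAt γ (δ₂ * k t - δ₃ * f t) t) ∧
            ∀ t x u : ℝ, (t, x, u) ∈ Ω →
              φ (t, x, u) =
                (δ₁ ^ 3 * t + δ₀, δ₁ * x + δ₁ * δ₃ / δ₂ ^ 2 * γ t + δ₄, δ₂ * u + δ₃) ∧
              k' (δ₁ ^ 3 * t + δ₀) = (δ₂ * k t - 2 * δ₃ * f t) / (δ₁ ^ 2 * δ₂ ^ 2) ∧
              f' (δ₁ ^ 3 * t + δ₀) = f t / (δ₁ ^ 2 * δ₂ ^ 2))) ∧
    -- the usual equivalence group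
    (∀ D : Set Gardner.UsualSpace, IsOpen D → IsConnected (Gardner.baseSet D) →
      (∀ e ∈ D, e.2.2 ≠ 0) →
      ∀ (Φ : Gardner.Base → Gardner.Base) (Ψ : Gardner.UsualSpace → ℝ × ℝ),
        Gardner.IsUsualEquivalence D Φ Ψ ↔
          ∃ δ₀ δ₁ δ₂ δ₄ : ℝ, δ₁ * δ₂ ≠ 0 ∧
            ∀ t x u k f : ℝ, ((t, x, u), k, f) ∈ D →
              Φ (t, x, u) = (δ₁ ^ 3 * t + δ₀, δ₁ * x + δ₄, δ₂ * u) ∧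
              Ψ ((t, x, u), k, f) =
                (δ₂ * k / (δ₁ ^ 2 * δ₂ ^ 2), f / (δ₁ ^ 2 * δ₂ ^ 2))) := by
  refine ⟨fun p r D hD hconn hne Φ Ψ => ⟨fun h => ?_, ?_⟩,
    fun I k f I' k' f' hs ht Ω φ hΩ hconn hsm htm =>
      ⟨fun h => h.exists_form hΩ hconn, ?_⟩,
    fun D hD hconn hne Φ Ψ => ⟨fun h => ?_, ?_⟩⟩
  · obtain ⟨δ₀, δ₁, δ₂, δ₃, δ₄, hδ, hform⟩ := h.exists_form hD hconn hne
    exact ⟨δ₀, δ₁, δ₂, δ₃, δ₄, hδ, fun t x u κ l he => hform _ he⟩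
  · rintro ⟨δ₀, δ₁, δ₂, δ₃, δ₄, hδ, hform⟩
    exact .of_form hD hδ (fun e he => (hform _ _ _ _ _ he).1) fun e he => (hform _ _ _ _ _ he).2
  · rintro ⟨δ₀, δ₁, δ₂, δ₃, δ₄, γ, hδ, hγ, hform⟩
    refine Gardner.isAdmissible_of_form hΩ hs ht hsm htm hδ
      (ξ := fun t => δ₁ * δ₃ / δ₂ ^ 2 * γ t + δ₄)
      (fun t ht => ((hγ t ht).const_mul _).add_const _) (fun z hz => ?_)
      (fun z hz => (hform _ _ _ hz).2.1) fun z hz => (hform _ _ _ hz).2.2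
    rw [← add_assoc]
    exact (hform _ _ _ hz).1
  · obtain ⟨δ₀, δ₁, δ₂, δ₄, hδ, hform⟩ := h.exists_form hD hconn hne
    exact ⟨δ₀, δ₁, δ₂, δ₄, hδ, fun t x u k f he => hform _ he⟩
  · rintro ⟨δ₀, δ₁, δ₂, δ₄, hδ, hform⟩
    exact .of_form hD hδ (fun e he => (hform _ _ _ _ _ he).1) fun e he => (hform _ _ _ _ _ he).2
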